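/- **Setting.** Let $\gamma>0$ and let $\Omega\subset\mathbb R^2$ be a non-empty open set contained in the unit ball $B_1$ centred at the origin. Write $\square=[-\pi,\pi)^2$ and $\square^*=[-\tfrac12,\tfrac12)^2$; indices after a comma denote (weak) partial derivatives. For $f\in L^2(\Omega)$ let $Af=p$ be the solution of $-\Delta p=\chi_\Omega f$ in $\mathbb R^2$ (in the sense of distributions) with $p(x)=-\frac{1}{2\pi}\big(\int_\Omega f\big)\ln|x|+o(1)$ as $|x|\to\infty$. For $f,\tilde f\in L^2(\Omega;\mathbb C^2)$ put $$\mathfrak b(f,\tilde f)=\gamma^{-1}\int_\Omega f\cdot\overline{\tilde f}-\int_\Omega\Big[\big((Af_1)_{,22}+(Af_2)_{,12}\big)\overline{\tilde f_1}+\big((Af_1)_{,21}+(Af_2)_{,11}\big)\overline{\tilde f_2}\Big],$$ $$\mathfrak c_1(f,\tilde f)=\Big(\int_\Omega f_1\Big)\overline{\Big(\int_\Omega\tilde f_1\Big)}+\Big(\int_\Omega f_2\Big)\overline{\Big(\int_\Omega\tilde f_2\Big)},$$ $$\mathfrak c_2(f,\tilde f)=\int_\Omega\big(f_1\overline{A\tilde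 f_1}+f_2\overline{A\tilde f_2}\big)+\gamma\int_\Omega\big((Af_1)_{,2}+(Af_2)_{,1}\big)\overline{\big((A\tilde f_1)_{,2}+(A\tilde f_2)_{,1}\big)},$$ and write $\mathfrak b[f]=\mathfrak b(f,f)$, and similarly for $\mathfrak c_1,\mathfrak c_2$. For $\theta\in\square^*\setminus\{0\}$ let $G_\theta$ be the Green function of the $\theta$-quasi-periodic Laplacian, i.e. the solution of $-\Delta G_\theta=\delta_0$ in $\square$ (with $\delta_0$ the Dirac mass at the origin) of the form $e^{i\theta\cdot x}U(x)$ with $U$ being $\square$-periodic; let $g_\theta(x)=G_\theta(x)+\frac1{2\pi}\ln|x|$ be its regular part (which extends continuously to $x=0$), and for $\delta\in(0,\pi)$ put $$\nu_{\theta,\delta}=g_\theta(0)-\tfrac1{2\pi}\ln\delta .$$ Let $L^2_0(\Omega;\mathbb C^2)=\{f\in L^2(\Omega;\mathbb C^2):\int_\Omega f_1=\int_\Omega f_2=0\}$. Identify $c\in\mathbb C^2$ with the constant function, and let $N:\mathbb C^2\to L^2_0(\Omega;\mathbb C^2)$ be defined by $\mathfrak b(Nc,g)=-\mathfrak b(c,g)$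 for all $g\in L^2_0(\Omega;\mathbb C^2)$. For $n\ge1$ define $$\mu_n^{(\delta)}(\theta)=\inf_{\substack{V\subset L^2(\Omega;\mathbb C^2)\\ \dim V=n}}\ \sup_{f\in V\setminus\{0\}}\frac{\mathfrak b[f]}{\nu_{\theta,\delta}\,\mathfrak c_1[f]+\mathfrak c_2[f]},$$ $$\Lambda_n^{(\delta)}(\theta)=\inf_{\substack{V\subset L^2_0(\Omega;\mathbb C^2)\times\mathbb C^2\\ \dim V=n}}\ \sup_{(g,c)\in V\setminus\{0\}}\frac{\mathfrak b[(I+N)c]+\mathfrak b[g]}{\nu_{\theta,\delta}\,\mathfrak c_1[c]+\mathfrak c_2[g]}.$$ **Proposition.** There exists a constant $C_2>0$, depending only on $\gamma$ and $\Omega$, such that $$\big|\mu_n^{(\delta)}(\theta)-\Lambda_n^{(\delta)}(\theta)\big|\le C_2\,\ln(\pi/\delta)^{-1/2}\,\mu_n^{(\delta)}(\theta)$$ for all $\delta\in(0,\pi/e)$, all $\theta\in\square^*\setminus\{0\}$ and all integers $n\ge1$. -/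

import Mathlib

open MeasureTheory Filter Set
open scoped ContDiff Topology ComplexConjugate

noncomputable section

namespace ArrowFibre

/-- The plane `ℝ²` with its Euclidean norm and Lebesgue measure. Coordinates are numbered `0, 1`. -/
abbrev Plane : Type := EuclideanSpace ℝ (Fin 2)

/-- The standard basis vectors of the plane. -/
def e (i : Fin 2) : Plane := EuclideanSpace.single i 1

/-! ### Weak derivatives -/

/-- Smooth compactly supported real test functions on the plane. -/
def IsTest (φ : Plane → ℝ) : Prop := ContDiff ℝ ∞ φ ∧ HasCompactSupport φ

/-- `g` is the weak partial derivative of `p` in direction `i` on the plane. -/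
def IsWeakPartial (i : Fin 2) (p g : Plane → ℂ) : Prop :=
  LocallyIntegrable p ∧ LocallyIntegrable g ∧
    ∀ φ : Plane → ℝ, IsTest φ → ∫ x, (fderiv ℝ φ x (e i)) • p x = - ∫ x, φ x • g x

/-- The weak partial derivative `p_{,i}`; it is unique up to null sets when it exists. -/
def weakPartial (i : Fin 2) (p : Plane → ℂ) : Plane → ℂ :=
  Classical.epsilon (IsWeakPartial i p)

/-! ### The operator `A` -/

/-- `p` solves `-Δ p = χ_Ω f` in `ℝ²` in the sense of distributions, with
`p(x) = -(d / 2π) ln |x| + o(1)` as `|x| → ∞`, where `d = ∫_Ω f`. -/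
def IsPotential (Ω : Set Plane) (f p : Plane → ℂ) : Prop :=
  LocallyIntegrable p ∧
    (∀ φ : Plane → ℝ, IsTest φ →
      - ∫ x, (Laplacian.laplacian φ x) • p x = ∫ x in Ω, φ x • f x) ∧
    Tendsto (fun x => p x + (∫ y in Ω, f y) / (2 * Real.pi) * (Real.log ‖x‖ : ℂ))
      (cocompact Plane) (𝓝 0)

/-- `A f`, the solution of the above problem (unique up to null sets). It depends only on the
restriction of `f` to `Ω`. -/
def A (Ω : Set Plane) (f : Plane → ℂ) : Plane → ℂ := Classical.epsilon (IsPotential Ω f)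

/-! ### The sesquilinear forms -/

/-- The form `𝔟`. -/
def formB (γ : ℝ) (Ω : Set Plane) (f h : Fin 2 → Plane → ℂ) : ℂ :=
  (γ : ℂ)⁻¹ * (∫ x in Ω, (f 0 x * conj (h 0 x) + f 1 x * conj (h 1 x)))
  - ∫ x in Ω,
      ((weakPartial 1 (weakPartial 1 (A Ω (f 0))) x
          + weakPartial 1 (weakPartial 0 (A Ω (f 1))) x) * conj (h 0 x)
        + (weakPartial 0 (weakPartial 1 (A Ω (f 0))) x
          + weakPartial 0 (weakPartial 0 (A Ω (f 1))) x) * conj (h 1 x))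

/-- The form `𝔠₁`. -/
def formC1 (Ω : Set Plane) (f h : Fin 2 → Plane → ℂ) : ℂ :=
  (∫ x in Ω, f 0 x) * conj (∫ x in Ω, h 0 x) + (∫ x in Ω, f 1 x) * conj (∫ x in Ω, h 1 x)

/-- The form `𝔠₂`. -/
def formC2 (γ : ℝ) (Ω : Set Plane) (f h : Fin 2 → Plane → ℂ) : ℂ :=
  (∫ x in Ω, (f 0 x * conj (A Ω (h 0) x) + f 1 x * conj (A Ω (h 1) x)))
  + (γ : ℂ) * ∫ x in Ω,
      (weakPartial 1 (A Ω (f 0)) x + weakPartial 0 (A Ω (f 1)) x)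
        * conj (weakPartial 1 (A Ω (h 0)) x + weakPartial 0 (A Ω (h 1)) x)

/-- The quadratic form `𝔟[f] = 𝔟(f, f)`, as a real number (the form is Hermitian). -/
def quadB (γ : ℝ) (Ω : Set Plane) (f : Fin 2 → Plane → ℂ) : ℝ := (formB γ Ω f f).re

/-- The quadratic form `𝔠₁[f]`. -/
def quadC1 (Ω : Set Plane) (f : Fin 2 → Plane → ℂ) : ℝ := (formC1 Ω f f).re

/-- The quadratic form `𝔠₂[f]`. -/
def quadC2 (γ : ℝ) (Ω : Set Plane) (f : Fin 2 → Plane → ℂ) : ℝ := (formC2 γ Ω f f).re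

/-! ### The quasi-periodic Green function and `ν` -/

/-- The periodicity cell `□ = [-π, π)²`. -/
def cell : Set Plane := {x | ∀ i, x i ∈ Ico (-Real.pi) Real.pi}

/-- The quasimomentum cell `□* = [-1/2, 1/2)²`. -/
def dualCell : Set Plane := {θ | ∀ i, θ i ∈ Ico (-(1 / 2) : ℝ) (1 / 2)}

/-- `u` is `θ`-quasi-periodic: `u(x) = e^{iθ·x} U(x)` with `U` being `2π`-periodic in both
coordinates. -/
def IsQuasiPeriodic (θ : Plane) (u : Plane → ℂ) : Prop :=
  ∀ (x : Plane) (j : Fin 2),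
    u (x + (2 * Real.pi) • e j) = Complex.exp (2 * Real.pi * θ j * Complex.I) * u x

/-- `G` is a `θ`-quasi-periodic solution of `-Δ G = δ₀` in `□`, in the weak sense, i.e. tested
over the cell against smooth `θ`-quasi-periodic functions. -/
def IsGreen (θ : Plane) (G : Plane → ℂ) : Prop :=
  IsQuasiPeriodic θ G ∧ IntegrableOn G cell ∧
    ∀ φ : Plane → ℂ, ContDiff ℝ ∞ φ → IsQuasiPeriodic θ φ →
      - ∫ x in cell, G x * conj (Laplacian.laplacian φ x) = conj (φ 0)

/-- `g` is the regular part `G(x) + (1 / 2π) ln |x|` of the `θ`-quasi-periodic Green function `G`,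
taken in its representative that is continuous in the interior of the cell (in particular
at the origin). -/
def IsRegularPart (θ : Plane) (g : Plane → ℂ) : Prop :=
  IsGreen θ (fun x => g x - ((1 / (2 * Real.pi) * Real.log ‖x‖ : ℝ) : ℂ)) ∧
    ContinuousOn g {x | ∀ i, x i ∈ Ioo (-Real.pi) Real.pi}

/-- The regular part `g_θ` of the `θ`-quasi-periodic Green function, for `θ ∈ □* \ {0}`. -/
def greenRegular (θ : Plane) : Plane → ℂ := Classical.epsilon (IsRegularPart θ)

/-- `ν_{θ,δ} = g_θ(0) - (1 / 2π) ln δ`; the value `g_θ(0)` is real. -/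
def nu (θ : Plane) (δ : ℝ) : ℝ := (greenRegular θ 0).re - 1 / (2 * Real.pi) * Real.log δ

/-! ### The spaces and the operator `N` -/

/-- `L²(Ω; ℂ²)`, as pairs of elements of `L²(Ω)`. -/
abbrev L2 (Ω : Set Plane) : Type := Fin 2 → Lp ℂ 2 (volume.restrict Ω)

/-- The functions that represent an element of `L²(Ω; ℂ²)`. -/
def fn {Ω : Set Plane} (f : L2 Ω) : Fin 2 → Plane → ℂ := fun i => f i

/-- A vector `c ∈ ℂ²` as a constant function. -/
def const (c : Fin 2 → ℂ) : Fin 2 → Plane → ℂ := fun i _ => c i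

/-- Membership in `L²₀(Ω; ℂ²)`: both components have zero integral. -/
def MeanZero {Ω : Set Plane} (f : L2 Ω) : Prop := ∀ i, ∫ x in Ω, fn f i x = 0

/-- `N c ∈ L²₀(Ω; ℂ²)`, the unique solution of `𝔟(N c, g) = -𝔟(c, g)` for all
`g ∈ L²₀(Ω; ℂ²)`. -/
def N (γ : ℝ) (Ω : Set Plane) (c : Fin 2 → ℂ) : L2 Ω :=
  Classical.epsilon fun h : L2 Ω =>
    MeanZero h ∧ ∀ g : L2 Ω, MeanZero g →
      formB γ Ω (fn h) (fn g) = - formB γ Ω (const c) (fn g)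

/-- The function `(I + N) c`. -/
def IN (γ : ℝ) (Ω : Set Plane) (c : Fin 2 → ℂ) : Fin 2 → Plane → ℂ :=
  const c + fn (N γ Ω c)

/-! ### The min-max values -/

/-- The min-max value, over the `n`-dimensional subspaces `V` contained in the set `S`, of the
quotient `num / den` on the non-zero elements of `V`. -/
def minMax {X : Type*} [AddCommGroup X] [Module ℂ X] (S : Set X) (num den : X → ℝ) (n : ℕ) : ℝ :=
  ⨅ V : {V : Submodule ℂ X // (V : Set X) ⊆ S ∧ Module.finrank ℂ V = n},
    ⨆ f : {f : X // f ∈ V.1 ∧ f ≠ 0}, num f.1 / den f.1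

/-- The values `μ_n^{(δ)}(θ)`. -/
def mu (γ : ℝ) (Ω : Set Plane) (δ : ℝ) (θ : Plane) (n : ℕ) : ℝ :=
  minMax (Set.univ : Set (L2 Ω))
    (fun f => quadB γ Ω (fn f))
    (fun f => nu θ δ * quadC1 Ω (fn f) + quadC2 γ Ω (fn f)) n

/-- The values `Λ_n^{(δ)}(θ)` of the decoupled problem, on pairs `(g, c)` in
`L²₀(Ω; ℂ²) × ℂ²`. -/
def Lam (γ : ℝ) (Ω : Set Plane) (δ : ℝ) (θ : Plane) (n : ℕ) : ℝ :=
  minMax {v : L2 Ω × (Fin 2 → ℂ) | MeanZero v.1}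
    (fun v => quadB γ Ω (IN γ Ω v.2) + quadB γ Ω (fn v.1))
    (fun v => nu θ δ * quadC1 Ω (const v.2) + quadC2 γ Ω (fn v.1)) n

end ArrowFibre

end

/-!
The two min-max problems have the same numerator after the change of variables
`f = g + (I + N) c`, where `g` has mean zero: by the definition of `N` the form `𝔟` has no cross
term (`quadB_split`), and `f ↦ (g, c)` is a linear bijection onto the admissible pairs
(`minMax_range`). Everything therefore reduces to comparing the denominators
`ν 𝔠₁[f] + 𝔠₂[f]` and `ν 𝔠₁[c] + 𝔠₂[g]`, where `𝔠₁[f] = 𝔠₁[c]`.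

The form `𝔠₂` alone is not positive, since the logarithmic energy is positive only for mean zero.
Subtracting a radial density in a thin annulus around the unit disc, whose potential is constant
on the disc by Newton's theorem (`pot_radial`), shows that `𝔠₂ + κ 𝔠₁` is positive semidefinite
with a small explicit `κ` (`re_energy_ge`, `quadC2_add_kappa_nonneg`). On the other hand
`ν ≥ κ + c₀ log (π / δ)` (`kappa_add_le_nu`), so that `𝔠₁[c]` is at most
`O(1 / log (π / δ))` times the denominator. The difference of the denominators consists of a cross
term, which the positivity of `𝔠₂ + κ 𝔠₁` bounds by the geometric mean of `𝔠₂[g]` and a multiple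
of `𝔠₁[c]`, and of terms of order `𝔠₁[c]`; this is where the factor `log (π / δ) ^ (-1/2)` comes
from (`denominators_compare`).

The operator `A` is identified with convolution with the kernel `-(1 / 2π) log ‖x‖`
(`A_ae_eq`, by a Liouville argument); its second weak derivatives define bounded operators on `L²`,
obtained by density from test functions, where two integrations by parts exchange indices
(`hess_swap`). This exhibits `𝔟[f]` as `‖J f‖²` for a bounded map `J`, bounded below, into a
Hilbert space (`formB_eq`, `norm_le_jmap`), so that `N` is an orthogonal projection in disguise
(`exists_N`).

The lower bound for `ν` rests on `Re g_θ(0) ≥ log (3/2) / 2π` (`IsRegularPart.le_re_zero`). Let `ψ`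
be the convolution square of a radial probability density in an annulus outside the disc of radius
`3/2`. Its Fourier coefficients and those of the Green function `G` are non-negative, so
`∫ G ψ ≥ 0`. Replacing `ψ` by a density concentrated at the origin changes the potential only near
the origin, by Newton's theorem again, so testing the equation for `G` with the difference of the
two potentials compares `∫ G ψ` with `g_θ(0)`. The Green function itself is the periodization of a
truncated logarithm plus an absolutely convergent Fourier series (`exists_isRegularPart`).
-/

noncomputable section

namespace ArrowFibre

/-! ### Directional derivatives and test functions -/

/-- The classical partial derivative in the `i`-th coordinate direction. -/
def pd {F : Type*} [NormedAddCommGroup F] [NormedSpace ℝ F] (i : Fin 2) (φ : Plane → F) :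
    Plane → F := fun x => fderiv ℝ φ x (e i)

/-- Complex-valued smooth compactly supported test functions. -/
def CTest (φ : Plane → ℂ) : Prop := ContDiff ℝ ∞ φ ∧ HasCompactSupport φ

/-- `f` vanishes outside some ball. -/
def BddSupp (f : Plane → ℂ) : Prop := ∃ R : ℝ, ∀ x, R < ‖x‖ → f x = 0

section Calculus

variable {F : Type*} [NormedAddCommGroup F] [NormedSpace ℝ F]

lemma contDiff_pd {φ : Plane → F} (h : ContDiff ℝ ∞ φ) (i : Fin 2) : ContDiff ℝ ∞ (pd i φ) := by
  have : ContDiff ℝ ∞ (fderiv ℝ φ) := h.fderiv_right (by simp)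
  exact this.clm_apply contDiff_const

lemma hasCompactSupport_pd {φ : Plane → F} (h : HasCompactSupport φ) (i : Fin 2) :
    HasCompactSupport (pd i φ) := h.fderiv_apply ℝ (e i)

lemma CTest.pd {φ : Plane → ℂ} (h : CTest φ) (i : Fin 2) : CTest (pd i φ) :=
  ⟨contDiff_pd h.1 i, hasCompactSupport_pd h.2 i⟩

lemma CTest.continuous {φ : Plane → ℂ} (h : CTest φ) : Continuous φ := h.1.continuous

lemma CTest.differentiable {φ : Plane → ℂ} (h : CTest φ) : Differentiable ℝ φ :=
  h.1.differentiable (by simp)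

lemma CTest.integrable {φ : Plane → ℂ} (h : CTest φ) : Integrable φ :=
  h.continuous.integrable_of_hasCompactSupport h.2

lemma CTest.memLp {φ : Plane → ℂ} (h : CTest φ) : MemLp φ 2 :=
  h.continuous.memLp_of_hasCompactSupport h.2

lemma bddSupp_of_hasCompactSupport {φ : Plane → ℂ} (h : HasCompactSupport φ) : BddSupp φ := by
  obtain ⟨R, hR⟩ := h.isCompact.isBounded.subset_closedBall (0 : Plane)
  refine ⟨R, fun x hx => ?_⟩
  by_contra hne
  have := hR (subset_tsupport _ hne)
  simp at this
  linarith

lemma CTest.bddSupp {φ : Plane → ℂ} (h : CTest φ) : BddSupp φ := bddSupp_of_hasCompactSupport h.2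

lemma CTest.add {φ ψ : Plane → ℂ} (h : CTest φ) (h' : CTest ψ) : CTest (φ + ψ) :=
  ⟨h.1.add h'.1, h.2.add h'.2⟩

lemma CTest.mul_left {φ ψ : Plane → ℂ} (h : ContDiff ℝ ∞ φ) (h' : CTest ψ) : CTest (φ * ψ) :=
  ⟨h.mul h'.1, h'.2.mul_left⟩

lemma CTest.const_mul {ψ : Plane → ℂ} (c : ℂ) (h' : CTest ψ) : CTest (fun x => c * ψ x) :=
  CTest.mul_left (φ := fun _ => c) contDiff_const h'

lemma CTest.sub {φ ψ : Plane → ℂ} (h : CTest φ) (h' : CTest ψ) : CTest (φ - ψ) := by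
  have := h.add (h'.const_mul (-1))
  convert this using 1
  ext x; simp [sub_eq_add_neg]

lemma IsTest.ofReal {φ : Plane → ℝ} (h : IsTest φ) : CTest (fun x => (φ x : ℂ)) :=
  ⟨Complex.ofRealCLM.contDiff.comp h.1, h.2.comp_left (g := fun z : ℝ => (z : ℂ)) (by simp)⟩

lemma pd_ofReal {φ : Plane → ℝ} (h : Differentiable ℝ φ) (i : Fin 2) :
    pd i (fun x => (φ x : ℂ)) = fun x => ((pd i φ x : ℝ) : ℂ) := by
  ext x
  have := (Complex.ofRealCLM.hasFDerivAt.comp x (h x).hasFDerivAt).fderiv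
  simp only [pd]
  erw [this]
  simp

lemma pd_conj {φ : Plane → ℂ} (h : Differentiable ℝ φ) (i : Fin 2) :
    pd i (fun x => conj (φ x)) = fun x => conj (pd i φ x) := by
  ext x
  have := ((Complex.conjCLE : ℂ →L[ℝ] ℂ).hasFDerivAt.comp x (h x).hasFDerivAt).fderiv
  simp only [pd]
  erw [this]
  simp

lemma pd_add {φ ψ : Plane → F} (h : Differentiable ℝ φ) (h' : Differentiable ℝ ψ) (i : Fin 2) :
    pd i (fun x => φ x + ψ x) = fun x => pd i φ x + pd i ψ x := by
  ext x; simp only [pd]; rw [fderiv_fun_add (h x) (h' x)]; simp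

lemma pd_sub {φ ψ : Plane → F} (h : Differentiable ℝ φ) (h' : Differentiable ℝ ψ) (i : Fin 2) :
    pd i (fun x => φ x - ψ x) = fun x => pd i φ x - pd i ψ x := by
  ext x; simp only [pd]; rw [fderiv_fun_sub (h x) (h' x)]; simp

lemma pd_mul {φ ψ : Plane → ℂ} (h : Differentiable ℝ φ) (h' : Differentiable ℝ ψ) (i : Fin 2) :
    pd i (fun x => φ x * ψ x) = fun x => pd i φ x * ψ x + φ x * pd i ψ x := by
  ext x; simp only [pd]; rw [fderiv_fun_mul (h x) (h' x)]; simp; ring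

lemma pd_const_mul {φ : Plane → ℂ} (h : Differentiable ℝ φ) (c : ℂ) (i : Fin 2) :
    pd i (fun x => c * φ x) = fun x => c * pd i φ x := by
  ext x; simp only [pd]; rw [fderiv_const_mul (h x) c]; simp

lemma pd_comp_sub {φ : Plane → F} (a : Plane) (i : Fin 2) :
    pd i (fun x => φ (x - a)) = fun x => pd i φ (x - a) := by
  ext x; simp only [pd]; rw [fderiv_comp_sub]

lemma pd_pd_eq {φ : Plane → F} (h : ContDiff ℝ 2 φ) (i j : Fin 2) (x : Plane) :
    pd i (pd j φ) x = fderiv ℝ (fderiv ℝ φ) x (e i) (e j) := by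
  have h1 : DifferentiableAt ℝ (fderiv ℝ φ) x :=
    ((h.fderiv_right (m := 1) (by norm_num)).differentiable (by norm_num)) x
  have h2 : fderiv ℝ (fun y => (fderiv ℝ φ y) (e j)) x = _ :=
    fderiv_clm_apply h1 (differentiableAt_const _)
  change fderiv ℝ (fun y => (fderiv ℝ φ y) (e j)) x (e i) = _
  rw [h2]
  simp

lemma pd_comm {φ : Plane → F} (h : ContDiff ℝ ∞ φ) (i j : Fin 2) :
    pd i (pd j φ) = pd j (pd i φ) := by
  have h2 : ContDiff ℝ 2 φ := h.of_le (by norm_cast)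
  ext x
  rw [pd_pd_eq h2, pd_pd_eq h2]
  exact (h2.contDiffAt.isSymmSndFDerivAt (by simp)) (e i) (e j)

lemma laplacian_eq_pd {φ : Plane → F} (h : ContDiff ℝ 2 φ) (x : Plane) :
    Laplacian.laplacian φ x = pd 0 (pd 0 φ) x + pd 1 (pd 1 φ) x := by
  have hl := congrFun (InnerProductSpace.laplacian_eq_iteratedFDeriv_orthonormalBasis φ
    (EuclideanSpace.basisFun (Fin 2) ℝ)) x
  refine hl.trans ?_
  simp [Fin.sum_univ_two, iteratedFDeriv_two_apply, pd_pd_eq h, e]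

/-- Integration by parts against a test function. -/
lemma integral_mul_pd {u φ : Plane → ℂ} (hu : ContDiff ℝ ∞ u) (hφ : CTest φ) (i : Fin 2) :
    ∫ x, u x * pd i φ x = - ∫ x, pd i u x * φ x := by
  have hi : ∀ {a b : Plane → ℂ}, Continuous a → Continuous b → HasCompactSupport b →
      Integrable (fun x => a x * b x) := fun ha hb hc =>
    (ha.mul hb).integrable_of_hasCompactSupport hc.mul_left
  exact integral_mul_fderiv_eq_neg_fderiv_mul_of_integrable
    (hi (contDiff_pd hu i).continuous hφ.continuous hφ.2)
    (hi hu.continuous (contDiff_pd hφ.1 i).continuous (hφ.pd i).2)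
    (hi hu.continuous hφ.continuous hφ.2)
    (fun x _ => hu.differentiable (by simp) x) (fun x _ => hφ.differentiable x)

end Calculus

/-! ### The logarithmic kernel and its gradient -/

/-- The fundamental solution `-(1/2π) log |x|` of `-Δ`. -/
def ker (x : Plane) : ℂ := ((-(1 / (2 * Real.pi)) * Real.log ‖x‖ : ℝ) : ℂ)

/-- The `i`-th partial derivative of the fundamental solution. -/
def kerD (i : Fin 2) (x : Plane) : ℂ := ((-(1 / (2 * Real.pi)) * (x i / ‖x‖ ^ 2) : ℝ) : ℂ)

lemma measurable_ker : Measurable ker := by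
  unfold ker; fun_prop

lemma measurable_kerD (i : Fin 2) : Measurable (kerD i) := by
  unfold kerD; fun_prop

lemma ker_neg (x : Plane) : ker (-x) = ker x := by simp [ker]

lemma conj_ker (x : Plane) : conj (ker x) = ker x := Complex.conj_ofReal _

lemma integrableOn_norm_inv (R : ℝ) :
    IntegrableOn (fun x : Plane => ‖x‖⁻¹) (Metric.ball 0 R) := by
  have := (integrableOn_fun_norm_addHaar (E := Plane) volume (f := fun r => r⁻¹) (r := R)).2
  refine this ?_
  simp only [finrank_euclideanSpace, Fintype.card_fin]
  have : IntegrableOn (fun _ : ℝ => (1 : ℝ)) (Ioo 0 R) := by simp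
  refine this.congr_fun (fun y hy => ?_) measurableSet_Ioo
  have : y ≠ 0 := hy.1.ne'
  simp [this]

lemma abs_apply_le_norm (x : Plane) (i : Fin 2) : |x i| ≤ ‖x‖ := by
  simpa using PiLp.norm_apply_le x i

lemma norm_kerD_le (i : Fin 2) (x : Plane) : ‖kerD i x‖ ≤ ‖x‖⁻¹ := by
  have hpi := Real.pi_gt_three
  rw [kerD, Complex.norm_real, Real.norm_eq_abs, abs_mul, abs_neg, abs_div (x i)]
  have h1 : |1 / (2 * Real.pi)| ≤ 1 := by
    rw [abs_of_pos (by positivity), div_le_one (by positivity)]; linarith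
  rcases eq_or_ne x 0 with rfl | hx
  · simp
  have hn : 0 < ‖x‖ := norm_pos_iff.2 hx
  have h2 : |x i| / |‖x‖ ^ 2| ≤ ‖x‖⁻¹ := by
    rw [abs_of_pos (pow_pos hn 2), div_le_iff₀ (pow_pos hn 2)]
    calc |x i| ≤ ‖x‖ := abs_apply_le_norm x i
      _ = ‖x‖⁻¹ * ‖x‖ ^ 2 := by field_simp
  calc _ ≤ 1 * (|x i| / |‖x‖ ^ 2|) := by gcongr
    _ ≤ _ := by simpa using h2

lemma abs_log_le_inv_add {r : ℝ} (hr : 0 ≤ r) : |Real.log r| ≤ r⁻¹ + r := by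
  rcases hr.eq_or_lt with rfl | h
  · simp
  · have h1 := Real.log_le_sub_one_of_pos h
    have h2 := Real.log_le_sub_one_of_pos (inv_pos.2 h)
    rw [Real.log_inv] at h2
    have := inv_pos.2 h
    rw [abs_le]; constructor <;> linarith

lemma norm_ker_le (x : Plane) : ‖ker x‖ ≤ ‖x‖⁻¹ + ‖x‖ := by
  have hpi := Real.pi_gt_three
  rw [ker, Complex.norm_real, Real.norm_eq_abs, abs_mul, abs_neg]
  have h1 : |1 / (2 * Real.pi)| ≤ 1 := by
    rw [abs_of_pos (by positivity), div_le_one (by positivity)]; linarith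
  calc _ ≤ 1 * |Real.log ‖x‖| := by gcongr
    _ ≤ _ := by simpa using abs_log_le_inv_add (norm_nonneg x)

lemma locallyIntegrable_of_ball {k : Plane → ℂ}
    (h : ∀ R, IntegrableOn k (Metric.ball 0 R)) : LocallyIntegrable k := by
  intro x
  refine ⟨Metric.ball 0 (‖x‖ + 1), Metric.isOpen_ball.mem_nhds (by simp), h _⟩

lemma locallyIntegrable_kerD (i : Fin 2) : LocallyIntegrable (kerD i) :=
  locallyIntegrable_of_ball fun R => (integrableOn_norm_inv R).mono'
    (measurable_kerD i).aestronglyMeasurable (ae_of_all _ (norm_kerD_le i))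

lemma locallyIntegrable_ker : LocallyIntegrable ker :=
  locallyIntegrable_of_ball fun R => by
    have h2 : IntegrableOn (fun x : Plane => ‖x‖) (Metric.ball 0 R) :=
      (continuous_norm.locallyIntegrable.integrableOn_isCompact
        (isCompact_closedBall 0 R)).mono_set Metric.ball_subset_closedBall
    exact ((integrableOn_norm_inv R).add h2).mono' measurable_ker.aestronglyMeasurable
      (ae_of_all _ norm_ker_le)

/-! ### Distributional derivatives of the logarithmic kernel -/

lemma integrable_locInt_mul {k φ : Plane → ℂ} (hk : LocallyIntegrable k) (hφ : Continuous φ)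
    (hs : HasCompactSupport φ) : Integrable (fun x => k x * φ x) := by
  simpa [mul_comm] using hk.integrable_smul_left_of_hasCompactSupport hφ hs

/-- The smooth regularisation `-(1/4π) log (|x|² + s)` of the logarithmic kernel. -/
def kerReg (s : ℝ) (x : Plane) : ℂ :=
  ((-(1 / (4 * Real.pi)) * Real.log (‖x‖ ^ 2 + s) : ℝ) : ℂ)

lemma contDiff_kerReg {s : ℝ} (hs : 0 < s) : ContDiff ℝ ∞ (kerReg s) := by
  refine Complex.ofRealCLM.contDiff.comp (contDiff_const.mul (ContDiff.log ?_ ?_))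
  · exact (contDiff_norm_sq ℝ).add contDiff_const
  · intro x; positivity

lemma pd_kerReg {s : ℝ} (hs : 0 < s) (i : Fin 2) (x : Plane) :
    pd i (kerReg s) x = ((-(1 / (2 * Real.pi)) * (x i / (‖x‖ ^ 2 + s)) : ℝ) : ℂ) := by
  have h1 : HasFDerivAt (fun x : Plane => ‖x‖ ^ 2 + s) (2 • innerSL ℝ x) x :=
    ((hasStrictFDerivAt_norm_sq x).hasFDerivAt).add_const s
  have h2 := (h1.log (by positivity)).const_mul (-(1 / (4 * Real.pi)))
  have h3 := (Complex.ofRealCLM.hasFDerivAt.comp x h2).fderiv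
  have h4 : fderiv ℝ (kerReg s) x = _ := h3
  rw [pd, h4]
  simp [e, EuclideanSpace.inner_single_right]
  have : (Real.pi : ℂ) ≠ 0 := by exact_mod_cast Real.pi_ne_zero
  have h5 : ((‖x‖ : ℂ) ^ 2 + s) ≠ 0 := by
    have : (‖x‖ ^ 2 + s : ℝ) ≠ 0 := by positivity
    exact_mod_cast this
  field_simp
  ring

lemma tendsto_kerReg {x : Plane} (hx : x ≠ 0) :
    Tendsto (fun n : ℕ => kerReg (1 / ((n : ℝ) + 1)) x) atTop (𝓝 (ker x)) := by
  have hn : 0 < ‖x‖ := norm_pos_iff.2 hx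
  have h1 : Tendsto (fun n : ℕ => ‖x‖ ^ 2 + 1 / ((n : ℝ) + 1)) atTop (𝓝 (‖x‖ ^ 2 + 0)) :=
    tendsto_const_nhds.add tendsto_one_div_add_atTop_nhds_zero_nat
  have h2 := (h1.log (by positivity)).const_mul (-(1 / (4 * Real.pi)))
  have h3 := (Complex.continuous_ofReal.tendsto _).comp h2
  have h4 : ker x = ((-(1 / (4 * Real.pi)) * Real.log (‖x‖ ^ 2 + 0) : ℝ) : ℂ) := by
    rw [ker, add_zero, Real.log_pow]
    push_cast
    ring
  rw [h4]
  exact h3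

lemma norm_kerReg_le {s : ℝ} (hs : 0 < s) (hs1 : s ≤ 1) {x : Plane} (hx : x ≠ 0) :
    ‖kerReg s x‖ ≤ ‖ker x‖ + (‖x‖ ^ 2 + 1) := by
  have hpi := Real.pi_gt_three
  have hn : 0 < ‖x‖ := norm_pos_iff.2 hx
  have h1 : Real.log (‖x‖ ^ 2) ≤ Real.log (‖x‖ ^ 2 + s) :=
    Real.log_le_log (by positivity) (by linarith)
  have h2 : Real.log (‖x‖ ^ 2 + s) ≤ ‖x‖ ^ 2 + 1 := by
    have := Real.log_le_sub_one_of_pos (show 0 < ‖x‖ ^ 2 + s by positivity)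
    linarith
  rw [Real.log_pow] at h1
  push_cast at h1
  rw [ker, kerReg, Complex.norm_real, Complex.norm_real, Real.norm_eq_abs, Real.norm_eq_abs,
    abs_mul, abs_mul, abs_neg, abs_neg, abs_of_pos (show 0 < 1 / (4 * Real.pi) by positivity),
    abs_of_pos (show 0 < 1 / (2 * Real.pi) by positivity)]
  have h3 : |Real.log (‖x‖ ^ 2 + s)| ≤ 2 * |Real.log ‖x‖| + (‖x‖ ^ 2 + 1) := by
    have := neg_abs_le (Real.log ‖x‖)
    have := abs_nonneg (Real.log ‖x‖)
    rw [abs_le]; constructor <;> nlinarith [sq_nonneg ‖x‖]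
  calc 1 / (4 * Real.pi) * |Real.log (‖x‖ ^ 2 + s)|
      ≤ 1 / (4 * Real.pi) * (2 * |Real.log ‖x‖| + (‖x‖ ^ 2 + 1)) := by gcongr
    _ = 1 / (2 * Real.pi) * |Real.log ‖x‖| + 1 / (4 * Real.pi) * (‖x‖ ^ 2 + 1) := by
        field_simp; ring
    _ ≤ 1 / (2 * Real.pi) * |Real.log ‖x‖| + 1 * (‖x‖ ^ 2 + 1) := by
        gcongr
        rw [div_le_one (by positivity)]; linarith
    _ = _ := by ring

lemma norm_pd_kerReg_le {s : ℝ} (hs : 0 < s) (i : Fin 2) (x : Plane) :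
    ‖pd i (kerReg s) x‖ ≤ ‖kerD i x‖ := by
  rw [pd_kerReg hs, kerD, Complex.norm_real, Complex.norm_real, norm_mul, norm_mul]
  gcongr
  rw [Real.norm_eq_abs, Real.norm_eq_abs, abs_div, abs_div]
  rcases eq_or_ne x 0 with rfl | hx
  · simp
  have hn : 0 < ‖x‖ := norm_pos_iff.2 hx
  rw [abs_of_pos (show 0 < ‖x‖ ^ 2 + s by positivity), abs_of_pos (pow_pos hn 2)]
  gcongr
  linarith

lemma tendsto_pd_kerReg (i : Fin 2) {x : Plane} (hx : x ≠ 0) :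
    Tendsto (fun n : ℕ => pd i (kerReg (1 / ((n : ℝ) + 1))) x) atTop (𝓝 (kerD i x)) := by
  have hn : 0 < ‖x‖ := norm_pos_iff.2 hx
  have h1 : Tendsto (fun n : ℕ => ‖x‖ ^ 2 + 1 / ((n : ℝ) + 1)) atTop (𝓝 (‖x‖ ^ 2 + 0)) :=
    tendsto_const_nhds.add tendsto_one_div_add_atTop_nhds_zero_nat
  have h2 := ((tendsto_const_nhds (x := x i)).div h1 (by positivity)).const_mul (-(1 / (2 * Real.pi)))
  have h3 := (Complex.continuous_ofReal.tendsto _).comp h2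
  simp only [add_zero] at h3
  refine Tendsto.congr (fun n => ?_) h3
  rw [pd_kerReg (by positivity)]
  rfl

lemma ae_ne_zero : ∀ᵐ x : Plane, x ≠ 0 := by
  rw [ae_iff]; simp

/-- In the sense of distributions, the partial derivatives of the logarithmic kernel are
given by its classical gradient. -/
lemma integral_ker_mul_pd {φ : Plane → ℂ} (hφ : CTest φ) (i : Fin 2) :
    ∫ x, ker x * pd i φ x = - ∫ x, kerD i x * φ x := by
  have h1 : Tendsto (fun n : ℕ => ∫ x, kerReg (1 / ((n : ℝ) + 1)) x * pd i φ x) atTop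
      (𝓝 (∫ x, ker x * pd i φ x)) := by
    refine tendsto_integral_of_dominated_convergence
      (fun x => ‖ker x * pd i φ x‖ + (‖x‖ ^ 2 + 1) * ‖pd i φ x‖) (fun n => ?_) ?_ (fun n => ?_) ?_
    · exact ((contDiff_kerReg (by positivity)).continuous.mul
        (hφ.pd i).continuous).aestronglyMeasurable
    · refine (integrable_locInt_mul locallyIntegrable_ker (hφ.pd i).continuous
        (hφ.pd i).2).norm.add ?_
      refine Continuous.integrable_of_hasCompactSupport ?_ ?_
      · have := (hφ.pd i).continuous
        fun_prop
      · exact (hφ.pd i).2.norm.mul_left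
    · filter_upwards [ae_ne_zero] with x hx
      rw [norm_mul, norm_mul, ← add_mul]
      gcongr
      refine norm_kerReg_le (by positivity) ?_ hx
      rw [div_le_one (by positivity)]; linarith [(Nat.cast_nonneg n : (0 : ℝ) ≤ n)]
    · filter_upwards [ae_ne_zero] with x hx
      exact (tendsto_kerReg hx).mul_const _
  have h2 : Tendsto (fun n : ℕ => ∫ x, pd i (kerReg (1 / ((n : ℝ) + 1))) x * φ x) atTop
      (𝓝 (∫ x, kerD i x * φ x)) := by
    refine tendsto_integral_of_dominated_convergence
      (fun x => ‖kerD i x * φ x‖) (fun n => ?_) ?_ (fun n => ?_) ?_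
    · exact ((contDiff_pd (contDiff_kerReg (by positivity)) i).continuous.mul
        hφ.continuous).aestronglyMeasurable
    · exact (integrable_locInt_mul (locallyIntegrable_kerD i) hφ.continuous hφ.2).norm
    · refine ae_of_all _ fun x => ?_
      rw [norm_mul, norm_mul]
      gcongr
      exact norm_pd_kerReg_le (by positivity) i x
    · filter_upwards [ae_ne_zero] with x hx
      exact (tendsto_pd_kerReg i hx).mul_const _
  refine tendsto_nhds_unique h1 (h2.neg.congr fun n => ?_)
  rw [integral_mul_pd (contDiff_kerReg (by positivity)) hφ]

/-! ### Polar coordinates -/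

/-- The point of the plane with polar coordinates `(r, t)`. -/
def pt (r t : ℝ) : Plane := !₂[r * Real.cos t, r * Real.sin t]

/-- The isometry between the complex numbers and the plane. -/
def planeEquiv : ℂ ≃ₗᵢ[ℝ] Plane := Complex.orthonormalBasisOneI.repr

lemma planeEquiv_polar (p : ℝ × ℝ) :
    planeEquiv (Complex.polarCoord.symm p) = pt p.1 p.2 := by
  ext i
  fin_cases i <;>
  simp [planeEquiv, pt, Complex.polarCoord_symm_apply, Complex.cos_ofReal_re,
    Complex.sin_ofReal_re, Complex.orthonormalBasisOneI_repr_apply, Complex.cos_ofReal_im,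
    Complex.sin_ofReal_im]

lemma norm_pt (r t : ℝ) : ‖pt r t‖ = |r| := by
  rw [EuclideanSpace.norm_eq]
  simp only [pt, Fin.sum_univ_two, Real.norm_eq_abs, sq_abs]
  simp only [Matrix.cons_val_zero, Matrix.cons_val_one]
  rw [← Real.sqrt_sq_eq_abs]
  congr 1
  nlinarith [Real.sin_sq_add_cos_sq t]

lemma continuous_pt : Continuous (fun p : ℝ × ℝ => pt p.1 p.2) := by
  have : (fun p : ℝ × ℝ => pt p.1 p.2) = fun p => WithLp.toLp 2
      (![p.1 * Real.cos p.2, p.1 * Real.sin p.2] : Fin 2 → ℝ) := rfl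
  rw [this]
  refine (PiLp.continuous_toLp 2 _).comp ?_
  refine continuous_pi fun i => ?_
  fin_cases i <;> simp <;> fun_prop

lemma integral_planeEquiv (F : Plane → ℂ) : ∫ z, F (planeEquiv z) = ∫ x, F x :=
  planeEquiv.measurePreserving.integral_comp planeEquiv.toHomeomorph.measurableEmbedding F

lemma integrable_polar {F : Plane → ℂ} (hm : Measurable F) (hF : Integrable F) :
    Integrable (fun p : ℝ × ℝ => (p.1 : ℂ) * F (pt p.1 p.2))
      ((volume.restrict (Ioi 0)).prod (volume.restrict (Ioo (-Real.pi) Real.pi))) := by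
  rw [Measure.prod_restrict, ← Measure.volume_eq_prod]
  refine ⟨?_, ?_⟩
  · exact ((Complex.measurable_ofReal.comp measurable_fst).mul
      (hm.comp continuous_pt.measurable)).aestronglyMeasurable
  · have h1 := Complex.lintegral_comp_polarCoord_symm (fun z => ‖F (planeEquiv z)‖ₑ)
    have h2 : ∫⁻ z, ‖F (planeEquiv z)‖ₑ = ∫⁻ x, ‖F x‖ₑ :=
      planeEquiv.measurePreserving.lintegral_comp (f := fun x => ‖F x‖ₑ) hm.enorm
    rw [h2] at h1
    have h3 : ∫⁻ x, ‖F x‖ₑ < ⊤ := hF.2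
    rw [← h1] at h3
    refine lt_of_le_of_lt (le_of_eq ?_) h3
    refine setLIntegral_congr_fun (measurableSet_Ioi.prod measurableSet_Ioo) fun p hp => ?_
    have hp1 : 0 < p.1 := hp.1
    simp only [planeEquiv_polar, enorm_mul, smul_eq_mul]
    congr 1
    rw [← ofReal_norm, Complex.norm_real, Real.norm_of_nonneg hp1.le]

lemma integral_polar {F : Plane → ℂ} (hm : Measurable F) (hF : Integrable F) :
    ∫ x, F x = ∫ r in Ioi (0 : ℝ), ∫ t in Ioo (-Real.pi) Real.pi, (r : ℂ) * F (pt r t) := by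
  rw [← integral_planeEquiv, ← Complex.integral_comp_polarCoord_symm]
  have h := integral_prod _ (integrable_polar hm hF)
  rw [← h, Measure.prod_restrict, ← Measure.volume_eq_prod]
  refine setIntegral_congr_fun (measurableSet_Ioi.prod measurableSet_Ioo) fun p hp => ?_
  have h2 := planeEquiv_polar p
  simp only [Complex.real_smul]
  rw [h2]

lemma integral_polar_swap {F : Plane → ℂ} (hm : Measurable F) (hF : Integrable F) :
    ∫ x, F x = ∫ t in Ioo (-Real.pi) Real.pi, ∫ r in Ioi (0 : ℝ), (r : ℂ) * F (pt r t) := by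
  rw [integral_polar hm hF]
  exact integral_integral_swap (integrable_polar hm hF)

/-- Integration of the radial derivative along a ray. -/
lemma integral_ray {φ : Plane → ℂ} (hφ : CTest φ) (t : ℝ) :
    ∫ r in Ioi (0 : ℝ), (Real.cos t * pd 0 φ (pt r t) + Real.sin t * pd 1 φ (pt r t))
      = - φ 0 := by
  have hdec : ∀ r, pt r t = r • pt 1 t := by
    intro r; ext i; fin_cases i <;> simp [pt]
  have hω : pt 1 t = Real.cos t • e 0 + Real.sin t • e 1 := by
    ext i; fin_cases i <;> simp [pt, e]
  have hd : ∀ r : ℝ, HasDerivAt (fun r => φ (pt r t))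
      (Real.cos t * pd 0 φ (pt r t) + Real.sin t * pd 1 φ (pt r t)) r := by
    intro r
    have h1 : HasDerivAt (fun r : ℝ => pt r t) (pt 1 t) r := by
      have := (hasDerivAt_id r).smul_const (pt 1 t)
      simp only [one_smul] at this
      refine this.congr_of_eventuallyEq (Eventually.of_forall fun r => ?_)
      simp only [id]; exact hdec r
    have h2 := ((hφ.differentiable (pt r t)).hasFDerivAt.comp_hasDerivAt r h1)
    have h3 : fderiv ℝ φ (pt r t) (pt 1 t)
        = Real.cos t * pd 0 φ (pt r t) + Real.sin t * pd 1 φ (pt r t) := by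
      rw [hω, map_add, map_smul, map_smul]
      simp [pd]
    rw [← h3]
    exact h2
  obtain ⟨R, hR⟩ := hφ.bddSupp
  have hcont : Continuous (fun r : ℝ => pt r t) := continuous_pt.comp (by fun_prop : Continuous
    fun r : ℝ => (r, t))
  have hz : ∀ r : ℝ, R < |r| → φ (pt r t) = 0 := fun r hr => hR _ (by rwa [norm_pt])
  have hcs : ∀ i, HasCompactSupport (fun r : ℝ => pd i φ (pt r t)) := by
    intro i
    obtain ⟨R', hR'⟩ := (hφ.pd i).bddSupp
    refine HasCompactSupport.intro (isCompact_Icc (a := -R') (b := R')) fun r hr => ?_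
    refine hR' _ ?_
    rw [norm_pt]
    by_contra hcon
    exact hr (abs_le.1 (not_lt.1 hcon))
  have hint : Integrable (fun r : ℝ =>
      (Real.cos t * pd 0 φ (pt r t) + Real.sin t * pd 1 φ (pt r t) : ℂ)) := by
    refine Integrable.add ?_ ?_ <;> refine Integrable.const_mul ?_ _
    · exact ((hφ.pd 0).continuous.comp hcont).integrable_of_hasCompactSupport (hcs 0)
    · exact ((hφ.pd 1).continuous.comp hcont).integrable_of_hasCompactSupport (hcs 1)
  have hlim : Tendsto (fun r => φ (pt r t)) atTop (𝓝 0) := by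
    refine tendsto_const_nhds.congr' ?_
    filter_upwards [eventually_gt_atTop (max R 0)] with r hr
    rw [hz]
    rw [abs_of_pos (lt_of_le_of_lt (le_max_right _ _) hr)]
    exact lt_of_le_of_lt (le_max_left _ _) hr
  have := integral_Ioi_of_hasDerivAt_of_tendsto (a := 0)
    ((hd 0).continuousAt.continuousWithinAt) (fun r _ => hd r) hint.integrableOn hlim
  rw [this]
  have h0 : pt 0 t = 0 := by ext i; fin_cases i <;> simp [pt]
  simp [h0]

/-- The logarithmic kernel is a fundamental solution of `-Δ`. -/
lemma integral_ker_mul_laplacian {φ : Plane → ℂ} (hφ : CTest φ) :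
    ∫ x, ker x * (pd 0 (pd 0 φ) x + pd 1 (pd 1 φ) x) = - φ 0 := by
  have hi : ∀ i, Integrable (fun x => ker x * pd i (pd i φ) x) := fun i =>
    integrable_locInt_mul locallyIntegrable_ker ((hφ.pd i).pd i).continuous ((hφ.pd i).pd i).2
  have hj : ∀ i, Integrable (fun x => kerD i x * pd i φ x) := fun i =>
    integrable_locInt_mul (locallyIntegrable_kerD i) (hφ.pd i).continuous (hφ.pd i).2
  simp only [mul_add]
  rw [integral_add (hi 0) (hi 1), integral_ker_mul_pd (hφ.pd 0), integral_ker_mul_pd (hφ.pd 1),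
    ← neg_add, ← integral_add (hj 0) (hj 1), integral_polar_swap (F := fun x => kerD 0 x * pd 0 φ x + kerD 1 x * pd 1 φ x) _
      ((hj 0).add (hj 1))]
  · have h1 : ∀ t ∈ Ioo (-Real.pi) Real.pi, ∫ r in Ioi (0 : ℝ), (r : ℂ) *
        (kerD 0 (pt r t) * pd 0 φ (pt r t) + kerD 1 (pt r t) * pd 1 φ (pt r t))
        = (1 / (2 * Real.pi)) * φ 0 := by
      intro t _
      have h2 : ∀ r ∈ Ioi (0 : ℝ), (r : ℂ) *
        (kerD 0 (pt r t) * pd 0 φ (pt r t) + kerD 1 (pt r t) * pd 1 φ (pt r t))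
        = (-(1 / (2 * Real.pi)) : ℂ) *
          (Real.cos t * pd 0 φ (pt r t) + Real.sin t * pd 1 φ (pt r t)) := by
        intro r hr
        have hr0 : (r : ℂ) ≠ 0 := by exact_mod_cast (ne_of_gt hr)
        have hpi : (Real.pi : ℂ) ≠ 0 := by exact_mod_cast Real.pi_ne_zero
        simp only [kerD, norm_pt, sq_abs]
        simp only [pt, PiLp.toLp_apply, Matrix.cons_val_zero, Matrix.cons_val_one]
        push_cast
        field_simp
        ring
      rw [setIntegral_congr_fun measurableSet_Ioi h2, integral_const_mul, integral_ray hφ]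
      ring
    rw [setIntegral_congr_fun measurableSet_Ioo h1]
    have hpi : (Real.pi : ℂ) ≠ 0 := by exact_mod_cast Real.pi_ne_zero
    simp [Real.volume_real_Ioo_of_le (show -Real.pi ≤ Real.pi by linarith [Real.pi_pos])]
    field_simp
    ring
  · exact ((measurable_kerD 0).mul (hφ.pd 0).continuous.measurable).add
      ((measurable_kerD 1).mul (hφ.pd 1).continuous.measurable)

/-! ### Decay of the logarithmic kernel -/

lemma log_norm_sub_expansion {x y : Plane} (hx : x ≠ 0) (hy : ‖y‖ ≤ ‖x‖ / 4) :
    |Real.log ‖x - y‖ - Real.log ‖x‖ + inner ℝ x y / ‖x‖ ^ 2| ≤ 7 * (‖y‖ / ‖x‖) ^ 2 := by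
  have hn : 0 < ‖x‖ := norm_pos_iff.2 hx
  set u := ‖y‖ / ‖x‖ with hu
  have hu0 : 0 ≤ u := by positivity
  have hu4 : u ≤ 1 / 4 := by rw [hu, div_le_iff₀ hn]; linarith
  set w := inner ℝ x y / ‖x‖ ^ 2 with hw
  have hw1 : |w| ≤ u := by
    rw [hw, abs_div, abs_of_pos (pow_pos hn 2), div_le_iff₀ (pow_pos hn 2)]
    calc |inner ℝ x y| ≤ ‖x‖ * ‖y‖ := abs_real_inner_le_norm x y
      _ = u * ‖x‖ ^ 2 := by rw [hu]; field_simp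
  set s := -2 * w + u ^ 2 with hs
  have hs1 : |s| ≤ 9 / 4 * u := by
    rw [hs]
    have := abs_le.1 hw1
    rw [abs_le]; constructor <;> nlinarith
  have hs2 : |s| ≤ 9 / 16 := by linarith
  have hkey : ‖x - y‖ ^ 2 = ‖x‖ ^ 2 * (1 + s) := by
    rw [@norm_sub_sq_real, hs, hw, hu]; field_simp; ring
  have h1s : 0 < 1 + s := by have := abs_le.1 hs2; linarith
  have hlog : Real.log ‖x - y‖ = Real.log ‖x‖ + 1 / 2 * Real.log (1 + s) := by
    have := congrArg Real.log hkey
    rw [Real.log_pow, Real.log_mul (by positivity) h1s.ne', Real.log_pow] at this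
    push_cast at this
    linarith
  have hT := Real.abs_log_sub_add_sum_range_le (x := -s) (by rw [abs_neg]; linarith) 1
  simp only [Finset.range_one, Finset.sum_singleton, abs_neg, sub_neg_eq_add] at hT
  norm_num at hT
  have hT2 : |s| ^ 2 / (1 - |s|) ≤ 16 / 7 * (9 / 4 * u) ^ 2 := by
    rw [div_le_iff₀ (by linarith)]
    have : |s| ^ 2 ≤ (9 / 4 * u) ^ 2 := by gcongr
    nlinarith [sq_nonneg (9 / 4 * u)]
  rw [← sq_abs s] at hT
  have hT3 := abs_le.1 (hT.trans (by simpa using hT2))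
  rw [hlog, abs_le]
  constructor <;> nlinarith [sq_nonneg u]

lemma norm_ker_sub_expansion {x y : Plane} (hx : x ≠ 0) (hy : ‖y‖ ≤ ‖x‖ / 4) :
    ‖ker (x - y) - ker x + (y 0 * kerD 0 x + y 1 * kerD 1 x)‖ ≤ 2 * (‖y‖ / ‖x‖) ^ 2 := by
  have h := log_norm_sub_expansion hx hy
  have hpi := Real.pi_gt_three
  have heq : ker (x - y) - ker x + (y 0 * kerD 0 x + y 1 * kerD 1 x)
      = ((-(1 / (2 * Real.pi)) *
        (Real.log ‖x - y‖ - Real.log ‖x‖ + inner ℝ x y / ‖x‖ ^ 2) : ℝ) : ℂ) := by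
    simp only [ker, kerD, PiLp.inner_apply, Fin.sum_univ_two]
    push_cast
    simp
    ring
  rw [heq, Complex.norm_real, Real.norm_eq_abs, abs_mul, abs_neg,
    abs_of_pos (show 0 < 1 / (2 * Real.pi) by positivity)]
  calc _ ≤ 1 / (2 * 3) * (7 * (‖y‖ / ‖x‖) ^ 2) := by gcongr
    _ ≤ _ := by nlinarith [sq_nonneg (‖y‖ / ‖x‖)]

lemma norm_ker_sub_le {x y : Plane} (hx : x ≠ 0) (hy : ‖y‖ ≤ ‖x‖ / 4) :
    ‖ker (x - y) - ker x‖ ≤ 3 * (‖y‖ / ‖x‖) := by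
  have h := norm_ker_sub_expansion hx hy
  have hn : 0 < ‖x‖ := norm_pos_iff.2 hx
  have hu4 : ‖y‖ / ‖x‖ ≤ 1 / 4 := by rw [div_le_iff₀ hn]; linarith
  have hu0 : 0 ≤ ‖y‖ / ‖x‖ := by positivity
  have hb : ∀ i, ‖(y i : ℂ) * kerD i x‖ ≤ ‖y‖ / ‖x‖ := by
    intro i
    rw [norm_mul, Complex.norm_real, div_eq_mul_inv]
    gcongr
    · exact abs_apply_le_norm y i
    · exact norm_kerD_le i x
  have h2 : ker (x - y) - ker x = (ker (x - y) - ker x + (y 0 * kerD 0 x + y 1 * kerD 1 x))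
      - (y 0 * kerD 0 x + y 1 * kerD 1 x) := by ring
  rw [h2]
  refine (norm_sub_le _ _).trans ?_
  have := (norm_add_le ((y 0 : ℂ) * kerD 0 x) (y 1 * kerD 1 x)).trans
    (add_le_add (hb 0) (hb 1))
  nlinarith

/-! ### Convolution with a locally integrable kernel -/

/-- The convolution `∫ k(x - y) f(y) dy`. -/
def convK (k f : Plane → ℂ) (x : Plane) : ℂ := ∫ y, k (x - y) * f y

/-- The logarithmic potential of `f`. -/
def pot (f : Plane → ℂ) : Plane → ℂ := convK ker f

lemma integrable_ker_sub_mul {f : Plane → ℂ} (hf : Integrable f) {R : ℝ}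
    (hR : ∀ y, R < ‖y‖ → f y = 0) {x : Plane} (hx : x ≠ 0) (hxR : 4 * R ≤ ‖x‖) :
    Integrable (fun y => ker (x - y) * f y) := by
  refine (hf.norm.const_mul (‖ker x‖ + 1)).mono'
    (((measurable_ker.comp (measurable_const.sub measurable_id)).aestronglyMeasurable).mul
      hf.aestronglyMeasurable) (ae_of_all _ fun y => ?_)
  rw [norm_mul]
  rcases lt_or_ge R ‖y‖ with h | h
  · simp [hR y h]
  · gcongr
    have hn : 0 < ‖x‖ := norm_pos_iff.2 hx
    have h1 := norm_ker_sub_le hx (show ‖y‖ ≤ ‖x‖ / 4 by linarith)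
    have h2 : ‖y‖ / ‖x‖ ≤ 1 / 4 := by rw [div_le_iff₀ hn]; linarith
    have h3 := norm_le_norm_add_norm_sub (ker x) (ker (x - y))
    rw [norm_sub_rev] at h3
    linarith

/-- Far-field behaviour of a logarithmic potential, to first order. -/
lemma norm_pot_sub_le {f : Plane → ℂ} (hf : Integrable f) {R : ℝ}
    (hR : ∀ y, R < ‖y‖ → f y = 0) {x : Plane} (hx : x ≠ 0) (hxR : 4 * R ≤ ‖x‖) :
    ‖pot f x - ker x * ∫ y, f y‖ ≤ 3 * R * (∫ y, ‖f y‖) / ‖x‖ := by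
  have hn : 0 < ‖x‖ := norm_pos_iff.2 hx
  have hi := integrable_ker_sub_mul hf hR hx hxR
  rw [pot, convK, ← integral_const_mul, ← integral_sub hi (hf.const_mul _)]
  calc _ ≤ ∫ y, (3 * R / ‖x‖) * ‖f y‖ := by
        refine norm_integral_le_of_norm_le (hf.norm.const_mul _) (ae_of_all _ fun y => ?_)
        rw [← sub_mul, norm_mul]
        rcases lt_or_ge R ‖y‖ with h | h
        · simp [hR y h]
        · gcongr
          refine (norm_ker_sub_le hx (by linarith)).trans ?_
          rw [mul_div_assoc]; gcongr
    _ = _ := by rw [integral_const_mul]; ring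

/-- Far-field behaviour of a logarithmic potential, to second order. -/
lemma norm_pot_le_of_moments {f : Plane → ℂ} (hf : Integrable f) {R : ℝ}
    (hR : ∀ y, R < ‖y‖ → f y = 0) (h0 : ∫ y, f y = 0) (h1 : ∀ i, ∫ y : Plane, (y i : ℂ) * f y = 0)
    {x : Plane} (hx : x ≠ 0) (hxR : 4 * R ≤ ‖x‖) :
    ‖pot f x‖ ≤ 2 * R ^ 2 * (∫ y, ‖f y‖) / ‖x‖ ^ 2 := by
  have hn : 0 < ‖x‖ := norm_pos_iff.2 hx
  have hi := integrable_ker_sub_mul hf hR hx hxR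
  have hm : ∀ i, Integrable (fun y : Plane => (y i : ℂ) * f y) := by
    intro i
    refine (hf.norm.const_mul R).mono' ?_ (ae_of_all _ fun y => ?_)
    · exact (by fun_prop : Measurable fun y : Plane => (y i : ℂ)).aestronglyMeasurable.mul
        hf.aestronglyMeasurable
    · rw [norm_mul, Complex.norm_real]
      rcases lt_or_ge R ‖y‖ with h | h
      · simp [hR y h]
      · gcongr
        exact (abs_apply_le_norm y i).trans h
  have heq : pot f x = ∫ y, (ker (x - y) - ker x + (y 0 * kerD 0 x + y 1 * kerD 1 x)) * f y := by
    have : ∀ y, (ker (x - y) - ker x + (y 0 * kerD 0 x + y 1 * kerD 1 x)) * f y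
        = (ker (x - y) * f y - ker x * f y) + (kerD 0 x * (y 0 * f y) + kerD 1 x * (y 1 * f y)) :=
      fun y => by ring
    simp only [this]
    have hA : Integrable fun y => ker (x - y) * f y - ker x * f y := hi.sub (hf.const_mul _)
    have hB : Integrable fun y : Plane => kerD 0 x * (y 0 * f y) + kerD 1 x * (y 1 * f y) :=
      ((hm 0).const_mul _).add ((hm 1).const_mul _)
    rw [integral_add hA hB,
      integral_add ((hm 0).const_mul _) ((hm 1).const_mul _), integral_sub hi (hf.const_mul _),
      integral_const_mul, integral_const_mul, integral_const_mul, h0, h1, h1]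
    simp [pot, convK]
  rw [heq]
  calc _ ≤ ∫ y, (2 * R ^ 2 / ‖x‖ ^ 2) * ‖f y‖ := by
        refine norm_integral_le_of_norm_le (hf.norm.const_mul _) (ae_of_all _ fun y => ?_)
        rw [norm_mul]
        rcases lt_or_ge R ‖y‖ with h | h
        · simp [hR y h]
        · gcongr
          refine (norm_ker_sub_expansion hx (by linarith)).trans ?_
          rw [div_pow, mul_div_assoc]; gcongr
    _ = _ := by rw [integral_const_mul]; ring

section Conv

variable {k : Plane → ℂ}

lemma convK_eq_convolution (k f : Plane → ℂ) :
    convK k f = MeasureTheory.convolution k f (ContinuousLinearMap.mul ℝ ℂ) volume := by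
  ext x
  rw [convolution_eq_swap]
  rfl

lemma contDiff_convK (hk : LocallyIntegrable k) {φ : Plane → ℂ} (hφ : CTest φ) :
    ContDiff ℝ ∞ (convK k φ) := by
  rw [convK_eq_convolution]
  exact hφ.2.contDiff_convolution_right _ hk hφ.1

lemma pd_convK (hk : LocallyIntegrable k) {φ : Plane → ℂ} (hφ : CTest φ) (i : Fin 2) :
    pd i (convK k φ) = convK k (pd i φ) := by
  ext x
  have h := (hφ.2.hasFDerivAt_convolution_right (ContinuousLinearMap.mul ℝ ℂ) hk
    (hφ.1.of_le (by norm_cast)) x).fderiv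
  rw [pd, convK_eq_convolution, h, convK_eq_convolution,
    convolution_precompR_apply _ hk (hφ.2.fderiv ℝ) (hφ.1.continuous_fderiv (by simp))]
  rfl

/-- The kernel cut off outside a ball. -/
def cutK (k : Plane → ℂ) (M : ℝ) : Plane → ℂ := (Metric.ball 0 M).indicator k

lemma integrable_cutK (hk : LocallyIntegrable k) (M : ℝ) : Integrable (cutK k M) := by
  rw [cutK, integrable_indicator_iff Metric.isOpen_ball.measurableSet]
  exact (hk.integrableOn_isCompact (isCompact_closedBall 0 M)).mono_set
    Metric.ball_subset_closedBall

lemma cutK_sub_mul {f : Plane → ℂ} {R r : ℝ} (hR : ∀ y, R < ‖y‖ → f y = 0) {x : Plane}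
    (hx : ‖x‖ < r) (y : Plane) : cutK k (r + R) (x - y) * f y = k (x - y) * f y := by
  rcases lt_or_ge R ‖y‖ with h | h
  · simp [hR y h]
  · rw [cutK, indicator_of_mem]
    rw [mem_ball_zero_iff]
    exact lt_of_le_of_lt (norm_sub_le x y) (by linarith)

lemma convK_cutK {f : Plane → ℂ} {R r : ℝ} (hR : ∀ y, R < ‖y‖ → f y = 0) {x : Plane}
    (hx : ‖x‖ < r) : convK (cutK k (r + R)) f x = convK k f x :=
  integral_congr_ae (ae_of_all _ fun y => cutK_sub_mul hR hx y)

lemma integrable_conv_prod {f k : Plane → ℂ} (hk : Integrable k) (hf : Integrable f) :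
    Integrable (fun p : Plane × Plane => k (p.1 - p.2) * f p.2) (volume.prod volume) := by
  have := hf.convolution_integrand (ContinuousLinearMap.mul ℝ ℂ) hk
  simpa [mul_comm] using this

lemma integrable_convK {f k : Plane → ℂ} (hk : Integrable k) (hf : Integrable f) :
    Integrable (convK k f) := (integrable_conv_prod hk hf).integral_prod_left

lemma locallyIntegrable_convK (hk : LocallyIntegrable k) {f : Plane → ℂ} (hf : Integrable f)
    (hs : BddSupp f) : LocallyIntegrable (convK k f) := by
  obtain ⟨R, hR⟩ := hs
  refine locallyIntegrable_of_ball fun r => ?_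
  refine (integrable_convK (integrable_cutK hk (r + R)) hf).integrableOn.congr_fun
    (fun x hx => ?_) Metric.isOpen_ball.measurableSet
  exact convK_cutK hR (by simpa using hx)

/-- Fubini's theorem for a convolution tested against a compactly supported function. -/
lemma integral_convK_mul (hk : LocallyIntegrable k) {f φ : Plane → ℂ} (hf : Integrable f)
    (hs : BddSupp f) (hφ : Continuous φ) (hφs : HasCompactSupport φ) :
    ∫ x, convK k f x * φ x = ∫ y, f y * ∫ x, k (x - y) * φ x := by
  obtain ⟨R, hR⟩ := hs
  obtain ⟨r, hr⟩ := bddSupp_of_hasCompactSupport hφs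
  have hx : ∀ x y, k (x - y) * f y * φ x = cutK k (r + 1 + R) (x - y) * f y * φ x := by
    intro x y
    rcases lt_or_ge r ‖x‖ with h | h
    · simp [hr x h]
    · rw [cutK_sub_mul hR (by linarith)]
  have hint : Integrable (fun p : Plane × Plane => k (p.1 - p.2) * f p.2 * φ p.1)
      (volume.prod volume) := by
    obtain ⟨C, hC⟩ := hφ.bounded_above_of_compact_support hφs
    have := (integrable_conv_prod (integrable_cutK hk (r + 1 + R)) hf).mul_bdd (c := C)
      (g := fun p : Plane × Plane => φ p.1)
      (hφ.comp continuous_fst).aestronglyMeasurable (ae_of_all _ fun p => hC p.1)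
    refine this.congr (ae_of_all _ fun p => ?_)
    simp only [hx]
  calc ∫ x, convK k f x * φ x = ∫ x, ∫ y, k (x - y) * f y * φ x := by
        refine integral_congr_ae (ae_of_all _ fun x => ?_)
        simp only [convK]
        rw [integral_mul_const]
    _ = ∫ y, ∫ x, k (x - y) * f y * φ x := integral_integral_swap hint
    _ = _ := by
        refine integral_congr_ae (ae_of_all _ fun y => ?_)
        simp only
        rw [← integral_const_mul]
        refine integral_congr_ae (ae_of_all _ fun x => ?_)
        simp only
        ring

lemma integral_pot_mul {f φ : Plane → ℂ} (hf : Integrable f)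
    (hs : BddSupp f) (hφ : Continuous φ) (hφs : HasCompactSupport φ) :
    ∫ x, pot f x * φ x = ∫ y, f y * pot φ y := by
  rw [pot, integral_convK_mul locallyIntegrable_ker hf hs hφ hφs]
  refine integral_congr_ae (ae_of_all _ fun y => ?_)
  simp only [pot, convK]
  congr 1
  refine integral_congr_ae (ae_of_all _ fun x => ?_)
  simp only
  rw [← ker_neg, neg_sub]

lemma contDiff_pot {φ : Plane → ℂ} (hφ : CTest φ) : ContDiff ℝ ∞ (pot φ) :=
  contDiff_convK locallyIntegrable_ker hφ

lemma pd_pot {φ : Plane → ℂ} (hφ : CTest φ) (i : Fin 2) : pd i (pot φ) = pot (pd i φ) :=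
  pd_convK locallyIntegrable_ker hφ i

lemma convK_add_right (hk : LocallyIntegrable k) {φ ψ : Plane → ℂ} (hφ : CTest φ) (hψ : CTest ψ) :
    convK k (fun x => φ x + ψ x) = fun x => convK k φ x + convK k ψ x := by
  ext x
  have h : ∀ {φ : Plane → ℂ}, CTest φ → Integrable (fun y => k (x - y) * φ y) := by
    intro φ hφ
    obtain ⟨R, hR⟩ := hφ.bddSupp
    have h1 := integrable_locInt_mul (φ := fun y => φ (x - y)) hk
      (hφ.continuous.comp (by fun_prop)) (hφ.2.comp_homeomorph (Homeomorph.subLeft x))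
    have := h1.comp_sub_left x
    simpa using this
  simp only [convK, mul_add]
  exact integral_add (h hφ) (h hψ)

lemma pd_comp_sub_left {φ : Plane → ℂ} (hφ : Differentiable ℝ φ) (a : Plane) (i : Fin 2) :
    pd i (fun x => φ (a - x)) = fun x => - pd i φ (a - x) := by
  ext x
  have h := ((hφ (a - x)).hasFDerivAt.comp x ((hasFDerivAt_id x).const_sub a)).fderiv
  simp only [pd]
  erw [h]
  simp

/-- Poisson's equation `-Δ (pot φ) = φ` for a test function `φ`. -/
lemma laplacian_pot {φ : Plane → ℂ} (hφ : CTest φ) (x : Plane) :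
    pd 0 (pd 0 (pot φ)) x + pd 1 (pd 1 (pot φ)) x = - φ x := by
  have hψ : CTest (fun y => φ (x - y)) :=
    ⟨hφ.1.comp (contDiff_const.sub contDiff_id), hφ.2.comp_homeomorph (Homeomorph.subLeft x)⟩
  have h2 : ∀ i, pd i (pd i (fun y => φ (x - y))) = fun y => pd i (pd i φ) (x - y) := by
    intro i
    rw [pd_comp_sub_left hφ.differentiable]
    have := pd_comp_sub_left (hφ.pd i).differentiable x i
    have h3 := pd_const_mul (φ := fun y => pd i φ (x - y))
      (((hφ.pd i).differentiable).comp (by fun_prop)) (-1) i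
    simp only [neg_one_mul] at h3
    rw [h3, this]
    simp
  have h := integral_ker_mul_laplacian hψ
  rw [h2, h2] at h
  rw [pd_pot hφ, pd_pot hφ, pd_pot (hφ.pd 0), pd_pot (hφ.pd 1)]
  have h4 := congrFun (convK_add_right locallyIntegrable_ker ((hφ.pd 0).pd 0) ((hφ.pd 1).pd 1)) x
  rw [pot, pot, ← h4, convK]
  simp only [sub_zero] at h
  rw [← h, ← integral_sub_left_eq_self _ volume x]
  simp

end Conv

/-! ### Decay at infinity and integrability -/

/-- `u` decays at least like `|x|⁻ⁿ`. -/
def Dec (n : ℕ) (u : Plane → ℂ) : Prop := ∃ C : ℝ, ∀ x, ‖u x‖ * (1 + ‖x‖) ^ n ≤ C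

lemma Dec.mul {m n : ℕ} {u v : Plane → ℂ} (hu : Dec m u) (hv : Dec n v) :
    Dec (m + n) (fun x => u x * v x) := by
  obtain ⟨C, hC⟩ := hu
  obtain ⟨D, hD⟩ := hv
  refine ⟨C * D, fun x => ?_⟩
  rw [norm_mul, pow_add]
  calc _ = (‖u x‖ * (1 + ‖x‖) ^ m) * (‖v x‖ * (1 + ‖x‖) ^ n) := by ring
    _ ≤ C * D := mul_le_mul (hC x) (hD x) (by positivity)
        ((by positivity : (0 : ℝ) ≤ ‖u x‖ * (1 + ‖x‖) ^ m).trans (hC x))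

lemma Dec.conj {n : ℕ} {u : Plane → ℂ} (hu : Dec n u) : Dec n (fun x => conj (u x)) := by
  obtain ⟨C, hC⟩ := hu
  exact ⟨C, fun x => by simpa using hC x⟩

lemma Dec.norm_le {n : ℕ} {u : Plane → ℂ} (hu : Dec n u) :
    ∃ C : ℝ, 0 ≤ C ∧ ∀ x, ‖u x‖ ≤ C * ((1 + ‖x‖) ^ n)⁻¹ := by
  obtain ⟨C, hC⟩ := hu
  refine ⟨C, (by positivity : (0 : ℝ) ≤ ‖u 0‖ * (1 + ‖(0 : Plane)‖) ^ n).trans (hC 0),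
    fun x => ?_⟩
  rw [← div_eq_mul_inv, le_div_iff₀ (by positivity)]
  exact hC x

lemma integrable_one_add_norm_pow {n : ℕ} (hn : 3 ≤ n) :
    Integrable (fun x : Plane => ((1 + ‖x‖) ^ n)⁻¹) := by
  have h := integrable_one_add_norm (E := Plane) (μ := volume) (r := n)
    (by simp; exact_mod_cast (by omega : 2 < n))
  refine h.congr (ae_of_all _ fun x => ?_)
  simp only
  rw [Real.rpow_neg (by positivity), Real.rpow_natCast]

lemma Dec.integrable {n : ℕ} (hn : 3 ≤ n) {u : Plane → ℂ} (hc : Continuous u) (hu : Dec n u) :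
    Integrable u := by
  obtain ⟨C, _, hC⟩ := hu.norm_le
  exact ((integrable_one_add_norm_pow hn).const_mul C).mono' hc.aestronglyMeasurable
    (ae_of_all _ hC)

lemma Dec.memLp {u : Plane → ℂ} (hc : Continuous u) (hu : Dec 2 u) : MemLp u 2 := by
  rw [memLp_two_iff_integrable_sq_norm hc.aestronglyMeasurable]
  have h := (Dec.mul hu hu).integrable (by norm_num) (hc.mul hc)
  refine h.norm.congr (ae_of_all _ fun x => ?_)
  simp [sq]

lemma dec_of_bound {n : ℕ} {u : Plane → ℂ} (hc : Continuous u) {ρ C : ℝ}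
    (h : ∀ x : Plane, ρ ≤ ‖x‖ → 1 ≤ ‖x‖ → ‖u x‖ ≤ C / ‖x‖ ^ n) : Dec n u := by
  have hcont : Continuous fun x => ‖u x‖ * (1 + ‖x‖) ^ n := by fun_prop
  obtain ⟨B, hB⟩ := (isCompact_closedBall (0 : Plane) (max ρ 1)).bddAbove_image hcont.continuousOn
  refine ⟨max B (2 ^ n * C), fun x => ?_⟩
  rcases le_or_gt ‖x‖ (max ρ 1) with hx | hx
  · exact (hB ⟨x, by simpa using hx, rfl⟩).trans (le_max_left _ _)
  · have hx1 : 1 < ‖x‖ := lt_of_le_of_lt (le_max_right _ _) hx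
    have h1 := h x (le_of_lt (lt_of_le_of_lt (le_max_left _ _) hx)) hx1.le
    refine le_trans ?_ (le_max_right _ _)
    calc ‖u x‖ * (1 + ‖x‖) ^ n ≤ C / ‖x‖ ^ n * (2 * ‖x‖) ^ n := by
          gcongr
          · exact (norm_nonneg _).trans h1
          · linarith
      _ = _ := by
          rw [mul_pow]
          have : ‖x‖ ^ n ≠ 0 := by positivity
          field_simp

lemma integral_pd {φ : Plane → ℂ} (hφ : CTest φ) (i : Fin 2) : ∫ x, pd i φ x = 0 := by
  have := integral_mul_pd (u := fun _ => 1) contDiff_const hφ i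
  simpa [pd] using this

lemma pd_coord (i j : Fin 2) :
    pd i (fun x : Plane => (x j : ℂ)) = fun _ => if j = i then (1 : ℂ) else 0 := by
  ext x
  have h : HasFDerivAt (fun x : Plane => (x j : ℂ))
      (Complex.ofRealCLM.comp (EuclideanSpace.proj j : Plane →L[ℝ] ℝ)) x :=
    (Complex.ofRealCLM.comp (EuclideanSpace.proj j : Plane →L[ℝ] ℝ)).hasFDerivAt
  simp only [pd, h.fderiv, e]
  by_cases hij : j = i <;> simp [hij]

lemma integral_coord_mul_pd {φ : Plane → ℂ} (hφ : CTest φ) (h0 : ∫ x, φ x = 0) (i j : Fin 2) :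
    ∫ x : Plane, (x j : ℂ) * pd i φ x = 0 := by
  have hs : ContDiff ℝ ∞ (fun x : Plane => (x j : ℂ)) :=
    (Complex.ofRealCLM.comp (EuclideanSpace.proj j : Plane →L[ℝ] ℝ)).contDiff
  rw [integral_mul_pd hs hφ, pd_coord, integral_const_mul, h0]
  simp

lemma exists_radius {φ : Plane → ℂ} (hs : BddSupp φ) : ∃ R : ℝ, 0 ≤ R ∧ ∀ x, R < ‖x‖ → φ x = 0 := by
  obtain ⟨R, hR⟩ := hs
  exact ⟨max R 0, le_max_right _ _, fun x hx => hR x (lt_of_le_of_lt (le_max_left _ _) hx)⟩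

lemma dec_one_pot {φ : Plane → ℂ} (hφ : CTest φ) (h0 : ∫ x, φ x = 0) : Dec 1 (pot φ) := by
  obtain ⟨R, hR0, hR⟩ := exists_radius hφ.bddSupp
  refine dec_of_bound (contDiff_pot hφ).continuous (ρ := 4 * R)
    (C := 3 * R * (∫ y, ‖φ y‖)) fun x hx hx1 => ?_
  have := norm_pot_sub_le hφ.integrable hR (x := x) (by rintro rfl; simp at hx1; linarith) hx
  simpa [h0] using this

lemma dec_two_pot_pd {φ : Plane → ℂ} (hφ : CTest φ) (h0 : ∫ x, φ x = 0) (i : Fin 2) :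
    Dec 2 (pot (pd i φ)) := by
  obtain ⟨R, hR0, hR⟩ := exists_radius (hφ.pd i).bddSupp
  refine dec_of_bound (contDiff_pot (hφ.pd i)).continuous (ρ := 4 * R)
    (C := 2 * R ^ 2 * (∫ y, ‖pd i φ y‖)) fun x hx hx1 => ?_
  exact norm_pot_le_of_moments (hφ.pd i).integrable hR (integral_pd hφ i)
    (fun j => integral_coord_mul_pd hφ h0 i j) (by rintro rfl; simp at hx1; linarith) hx

lemma dec_one_pot_pd {φ : Plane → ℂ} (hφ : CTest φ) (i : Fin 2) : Dec 1 (pot (pd i φ)) :=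
  dec_one_pot (hφ.pd i) (integral_pd hφ i)

lemma dec_two_pot_pd_pd {φ : Plane → ℂ} (hφ : CTest φ) (i j : Fin 2) :
    Dec 2 (pot (pd i (pd j φ))) := dec_two_pot_pd (hφ.pd j) (integral_pd hφ j) i

/-- Integration by parts for smooth functions with enough decay. -/
lemma integral_mul_pd_of_dec {a b : ℕ} {u v : Plane → ℂ} (hu : ContDiff ℝ ∞ u)
    (hv : ContDiff ℝ ∞ v) (hab : 3 ≤ a + b) (i : Fin 2) (h1 : Dec a u) (h2 : Dec b v)
    (h3 : Dec a (pd i u)) (h4 : Dec b (pd i v)) :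
    ∫ x, u x * pd i v x = - ∫ x, pd i u x * v x :=
  integral_mul_fderiv_eq_neg_fderiv_mul_of_integrable
    ((h3.mul h2).integrable hab ((contDiff_pd hu i).continuous.mul hv.continuous))
    ((h1.mul h4).integrable hab (hu.continuous.mul (contDiff_pd hv i).continuous))
    ((h1.mul h2).integrable hab (hu.continuous.mul hv.continuous))
    (fun x _ => hu.differentiable (by simp) x) (fun x _ => hv.differentiable (by simp) x)

/-! ### A Liouville theorem -/

/-- A smooth cutoff function, equal to `1` on the unit ball and supported in the ball of
radius `2`. -/
def cutoff (x : Plane) : ℂ := (((⟨1, 2, by norm_num, by norm_num⟩ :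
  ContDiffBump (0 : Plane)) x : ℝ) : ℂ)

lemma cTest_cutoff : CTest cutoff :=
  IsTest.ofReal ⟨ContDiffBump.contDiff _, ContDiffBump.hasCompactSupport _⟩

lemma cutoff_eq_one {x : Plane} (hx : ‖x‖ ≤ 1) : cutoff x = 1 := by
  rw [cutoff, ContDiffBump.one_of_mem_closedBall]
  · simp
  · simpa using hx

lemma cutoff_eq_zero {x : Plane} (hx : 2 ≤ ‖x‖) : cutoff x = 0 := by
  rw [cutoff, ContDiffBump.zero_of_le_dist]
  · simp
  · simpa using hx

lemma pd_eq_zero_of_eventually_const {φ : Plane → ℂ} {x : Plane} {c : ℂ}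
    (h : ∀ᶠ y in 𝓝 x, φ y = c) (i : Fin 2) : pd i φ x = 0 := by
  have : φ =ᶠ[𝓝 x] fun _ => c := h
  simp [pd, this.fderiv_eq]

lemma pd_cutoff_eq_zero (i : Fin 2) {x : Plane} (hx : ‖x‖ < 1 ∨ 2 < ‖x‖) :
    pd i cutoff x = 0 := by
  rcases hx with hx | hx
  · refine pd_eq_zero_of_eventually_const (c := 1) ?_ i
    filter_upwards [(isOpen_lt continuous_norm continuous_const).mem_nhds hx] with y hy
    exact cutoff_eq_one (le_of_lt hy)
  · refine pd_eq_zero_of_eventually_const (c := 0) ?_ i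
    filter_upwards [(isOpen_lt continuous_const continuous_norm).mem_nhds hx] with y hy
    exact cutoff_eq_zero (le_of_lt hy)

lemma pd_pd_cutoff_eq_zero (i j : Fin 2) {x : Plane} (hx : ‖x‖ < 1 ∨ 2 < ‖x‖) :
    pd i (pd j cutoff) x = 0 := by
  refine pd_eq_zero_of_eventually_const (c := 0) ?_ i
  rcases hx with hx | hx
  · filter_upwards [(isOpen_lt continuous_norm continuous_const).mem_nhds hx] with y hy
    exact pd_cutoff_eq_zero j (Or.inl hy)
  · filter_upwards [(isOpen_lt continuous_const continuous_norm).mem_nhds hx] with y hy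
    exact pd_cutoff_eq_zero j (Or.inr hy)

lemma pd_comp_smul {φ : Plane → ℂ} (hφ : Differentiable ℝ φ) (c : ℝ) (i : Fin 2) :
    pd i (fun x => φ (c • x)) = fun x => (c : ℂ) * pd i φ (c • x) := by
  ext x
  have h := ((hφ (c • x)).hasFDerivAt.comp x ((hasFDerivAt_id x).const_smul c)).fderiv
  simp only [pd]
  erw [h]
  simp

lemma CTest.comp_smul {φ : Plane → ℂ} (hφ : CTest φ) {c : ℝ} (hc : c ≠ 0) :
    CTest (fun x => φ (c • x)) :=
  ⟨hφ.1.comp (contDiff_const_smul c), hφ.2.comp_homeomorph (Homeomorph.smulOfNeZero c hc)⟩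

lemma CTest.comp_sub {φ : Plane → ℂ} (hφ : CTest φ) (a : Plane) :
    CTest (fun x => φ (x - a)) :=
  ⟨hφ.1.comp (contDiff_id.sub contDiff_const), hφ.2.comp_homeomorph (Homeomorph.subRight a)⟩

lemma pd_pd_mul {φ ψ : Plane → ℂ} (h : ContDiff ℝ ∞ φ) (h' : ContDiff ℝ ∞ ψ) (i : Fin 2)
    (x : Plane) : pd i (pd i (fun x => φ x * ψ x)) x
      = pd i (pd i φ) x * ψ x + 2 * (pd i φ x * pd i ψ x) + φ x * pd i (pd i ψ) x := by
  have d : ∀ {f : Plane → ℂ}, ContDiff ℝ ∞ f → Differentiable ℝ f :=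
    fun hf => hf.differentiable (by simp)
  rw [pd_mul (d h) (d h'), pd_add (φ := fun x => pd i φ x * ψ x) (ψ := fun x => φ x * pd i ψ x)
    ((d (contDiff_pd h i)).mul (d h')) ((d h).mul (d (contDiff_pd h' i))), pd_mul (d (contDiff_pd h i)) (d h'),
    pd_mul (d h) (d (contDiff_pd h' i))]
  ring

lemma CTest.norm_bdd {φ : Plane → ℂ} (hφ : CTest φ) : ∃ C : ℝ, 0 ≤ C ∧ ∀ x, ‖φ x‖ ≤ C := by
  obtain ⟨C, hC⟩ := hφ.continuous.bounded_above_of_compact_support hφ.2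
  exact ⟨C, (norm_nonneg _).trans (hC 0), hC⟩

/-- A weakly harmonic function tending to zero at infinity is orthogonal to the test functions of
mean zero: such a test function is `-Δ q` with `q = pot ψ` decaying like `1 / |x|`, and the
error made by cutting `q` off at radius `r` is controlled by the size of `v` at distance `r`. -/
lemma integral_mul_eq_zero_of_harmonic {v : Plane → ℂ} (hv : LocallyIntegrable v)
    (hΔ : ∀ φ, CTest φ → ∫ x, v x * (pd 0 (pd 0 φ) x + pd 1 (pd 1 φ) x) = 0)
    (h0 : Tendsto v (cocompact Plane) (𝓝 0)) {ψ : Plane → ℂ} (hψ : CTest ψ)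
    (hm : ∫ x, ψ x = 0) : ∫ x, v x * ψ x = 0 := by
  obtain ⟨C₀, hC₀, hq⟩ := (dec_one_pot hψ hm).norm_le
  obtain ⟨C₁, hC₁, hq1⟩ := (dec_one_pot_pd hψ 0).norm_le
  obtain ⟨C₂, hC₂, hq2⟩ := (dec_one_pot_pd hψ 1).norm_le
  obtain ⟨R₀, hR₀, hsupp⟩ := exists_radius hψ.bddSupp
  obtain ⟨B₁, hB₁, hb1⟩ := (cTest_cutoff.pd 0).norm_bdd
  obtain ⟨B₂, hB₂, hb2⟩ := (cTest_cutoff.pd 1).norm_bdd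
  obtain ⟨B₃, hB₃, hb3⟩ := ((cTest_cutoff.pd 0).pd 0).norm_bdd
  obtain ⟨B₄, hB₄, hb4⟩ := ((cTest_cutoff.pd 1).pd 1).norm_bdd
  set K := (B₃ + B₄) * C₀ + 2 * (B₁ * C₁) + 2 * (B₂ * C₂) with hK
  have hK0 : 0 ≤ K := by positivity
  set V := (volume : Measure Plane).real (Metric.closedBall 0 2) with hV
  have hmain : ∀ ε > 0, ‖∫ x, v x * ψ x‖ ≤ ε * K * V := by
    intro ε hε
    have hev : ∀ᶠ x in cocompact Plane, ‖v x‖ < ε := by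
      have := h0.norm
      simp only [norm_zero] at this
      exact this.eventually (gt_mem_nhds hε)
    obtain ⟨s, hs, hsε⟩ := mem_cocompact.1 hev
    obtain ⟨R₁, hR₁⟩ := hs.isBounded.subset_closedBall (0 : Plane)
    set r := max (max R₀ R₁) 0 + 1 with hr
    have hr1 : 1 ≤ r := by rw [hr]; linarith [le_max_right (max R₀ R₁) 0]
    have hrR₀ : R₀ < r := by
      rw [hr]; linarith [le_max_left (max R₀ R₁) 0, le_max_left R₀ R₁]
    have hrR₁ : R₁ < r := by
      rw [hr]; linarith [le_max_left (max R₀ R₁) 0, le_max_right R₀ R₁]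
    have hr0 : 0 < r := by linarith
    have hvε : ∀ x : Plane, r ≤ ‖x‖ → ‖v x‖ ≤ ε := by
      intro x hx
      refine le_of_lt (hsε ?_)
      intro hxs
      have := hR₁ hxs
      simp at this
      linarith
    set χ : Plane → ℂ := fun x => cutoff (r⁻¹ • x) with hχ
    have hχt : CTest χ := cTest_cutoff.comp_smul (inv_ne_zero hr0.ne')
    have hχ1 : ∀ i, pd i χ = fun x => ((r⁻¹ : ℝ) : ℂ) * pd i cutoff (r⁻¹ • x) := fun i =>
      pd_comp_smul cTest_cutoff.differentiable _ i
    have hχ2 : ∀ i, pd i (pd i χ) =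
        fun x => ((r⁻¹ : ℝ) : ℂ) * (((r⁻¹ : ℝ) : ℂ) * pd i (pd i cutoff) (r⁻¹ • x)) := by
      intro i
      rw [hχ1, pd_const_mul ((cTest_cutoff.pd i).comp_smul (inv_ne_zero hr0.ne')).differentiable,
        pd_comp_smul (cTest_cutoff.pd i).differentiable]
    have hφ : CTest (fun x => pot ψ x * χ x) := CTest.mul_left (contDiff_pot hψ) hχt
    -- `Δ (q χ) = χ Δ q + E`: the commutator `E` lives on `r ≤ |x| ≤ 2r` and is `O(r⁻²)`, so that
    -- its integral against `v` is at most a constant times the supremum of `|v|` there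
    set E : Plane → ℂ := fun x => pot ψ x * (pd 0 (pd 0 χ) x + pd 1 (pd 1 χ) x)
      + 2 * (pd 0 (pot ψ) x * pd 0 χ x) + 2 * (pd 1 (pot ψ) x * pd 1 χ x) with hE
    have hE0 : ∀ x, ‖x‖ < r ∨ 2 * r < ‖x‖ → E x = 0 := by
      intro x hx
      have hx' : ‖r⁻¹ • x‖ < 1 ∨ 2 < ‖r⁻¹ • x‖ := by
        rw [norm_smul, Real.norm_of_nonneg (by positivity), inv_mul_lt_iff₀ hr0,
          lt_inv_mul_iff₀ hr0, mul_one, mul_comm r]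
        exact hx
      simp only [hE, hχ2]
      simp only [hχ1, pd_cutoff_eq_zero _ hx', pd_pd_cutoff_eq_zero _ _ hx']
      ring
    have hdecay : ∀ {C t : ℝ} {x : Plane}, 0 ≤ C → r ≤ ‖x‖ → t ≤ C * ((1 + ‖x‖) ^ 1)⁻¹ →
        t ≤ C * r⁻¹ := by
      intro C t x hC hx ht
      refine ht.trans ?_
      gcongr
      simp; linarith
    have hEb : ∀ x, ‖v x * E x‖ ≤ (Metric.closedBall (0 : Plane) (2 * r)).indicator
        (fun _ => ε * (K * (r⁻¹) ^ 2)) x := by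
      intro x
      by_cases hx : ‖x‖ < r ∨ 2 * r < ‖x‖
      · rw [hE0 x hx, mul_zero, norm_zero]
        exact indicator_nonneg (fun _ _ => by positivity) _
      · push Not at hx
        rw [indicator_of_mem (by simpa using hx.2), norm_mul]
        have hri : 0 ≤ r⁻¹ := by positivity
        have hri1 : r⁻¹ ≤ 1 := inv_le_one_of_one_le₀ hr1
        have a0 := hdecay hC₀ hx.1 (hq x)
        have a1 := hdecay hC₁ hx.1 (hq1 x)
        have a2 := hdecay hC₂ hx.1 (hq2 x)
        gcongr
        · exact hvε x hx.1
        · simp only [hE, hχ2]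
          simp only [hχ1, pd_pot hψ]
          calc _ ≤ ‖pot ψ x‖ * (r⁻¹ * (r⁻¹ * ‖pd 0 (pd 0 cutoff) (r⁻¹ • x)‖)
                  + r⁻¹ * (r⁻¹ * ‖pd 1 (pd 1 cutoff) (r⁻¹ • x)‖))
                + 2 * (‖pot (pd 0 ψ) x‖ * (r⁻¹ * ‖pd 0 cutoff (r⁻¹ • x)‖))
                + 2 * (‖pot (pd 1 ψ) x‖ * (r⁻¹ * ‖pd 1 cutoff (r⁻¹ • x)‖)) := by
                refine (norm_add_le _ _).trans (add_le_add ((norm_add_le _ _).trans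
                  (add_le_add ?_ ?_)) ?_)
                · rw [norm_mul]
                  gcongr
                  refine (norm_add_le _ _).trans (le_of_eq ?_)
                  simp only [norm_mul, Complex.norm_real, Real.norm_of_nonneg hri]
                · simp only [norm_mul, Complex.norm_real, Real.norm_of_nonneg hri]
                  simp
                · simp only [norm_mul, Complex.norm_real, Real.norm_of_nonneg hri]
                  simp
            _ ≤ (C₀ * r⁻¹) * (r⁻¹ * (1 * B₃) + r⁻¹ * (1 * B₄))
                + 2 * ((C₁ * r⁻¹) * (r⁻¹ * B₁)) + 2 * ((C₂ * r⁻¹) * (r⁻¹ * B₂)) := by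
                gcongr
                · exact hb3 _
                · exact hb4 _
                · exact hb1 _
                · exact hb2 _
            _ = K * (r⁻¹) ^ 2 := by rw [hK]; ring
    have hid : ∀ x, v x * ψ x = v x * E x
        - v x * (pd 0 (pd 0 (fun x => pot ψ x * χ x)) x
          + pd 1 (pd 1 (fun x => pot ψ x * χ x)) x) := by
      intro x
      have hl := laplacian_pot hψ x
      have hχψ : χ x * ψ x = ψ x := by
        rcases lt_or_ge R₀ ‖x‖ with h | h
        · simp [hsupp x h]
        · have : χ x = 1 := by
            refine cutoff_eq_one ?_
            rw [norm_smul, Real.norm_of_nonneg (by positivity), inv_mul_le_iff₀ hr0]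
            linarith
          rw [this, one_mul]
      rw [pd_pd_mul (contDiff_pot hψ) hχt.1, pd_pd_mul (contDiff_pot hψ) hχt.1]
      simp only [hE]
      have h1 : pd 1 (pd 1 (pot ψ)) x = - ψ x - pd 0 (pd 0 (pot ψ)) x := by
        rw [← hl]; ring
      rw [h1]
      linear_combination (-v x) * hχψ
    have hball : (volume : Measure Plane).real (Metric.closedBall 0 (2 * r)) = r ^ 2 * V := by
      have := Measure.addHaar_closedBall_mul (volume : Measure Plane) 0 hr0.le (r := r) (s := 2)
        (by norm_num)
      rw [hV, measureReal_def, measureReal_def, mul_comm 2 r, this, ENNReal.toReal_mul,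
        ENNReal.toReal_ofReal (by positivity)]
      simp
    have hbint : ∫ x, (Metric.closedBall (0 : Plane) (2 * r)).indicator
        (fun _ => ε * (K * (r⁻¹) ^ 2)) x = ε * K * V := by
      rw [integral_indicator Metric.isClosed_closedBall.measurableSet, setIntegral_const, hball]
      simp only [smul_eq_mul]
      field_simp
    have hbi : Integrable ((Metric.closedBall (0 : Plane) (2 * r)).indicator
        (fun _ => ε * (K * (r⁻¹) ^ 2))) := by
      rw [integrable_indicator_iff Metric.isClosed_closedBall.measurableSet]
      exact integrableOn_const (isCompact_closedBall (0 : Plane) (2 * r)).measure_ne_top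
    have hlapi : Integrable (fun x => v x * (pd 0 (pd 0 (fun x => pot ψ x * χ x)) x
          + pd 1 (pd 1 (fun x => pot ψ x * χ x)) x)) :=
      integrable_locInt_mul hv (((hφ.pd 0).pd 0).add ((hφ.pd 1).pd 1)).continuous
        (((hφ.pd 0).pd 0).add ((hφ.pd 1).pd 1)).2
    have hEi : Integrable (fun x => v x * E x) := by
      have h1 := (integrable_locInt_mul hv hψ.continuous hψ.2).add hlapi
      refine h1.congr (ae_of_all _ fun x => ?_)
      simp only [Pi.add_apply]
      rw [hid x]; ring
    have h2 : ∫ x, v x * ψ x = ∫ x, v x * E x := by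
      rw [integral_congr_ae (ae_of_all _ hid), integral_sub hEi hlapi, hΔ _ hφ, sub_zero]
    rw [h2, ← hbint]
    exact norm_integral_le_of_norm_le hbi (ae_of_all _ hEb)
  have hVK : 0 ≤ K * V := by positivity
  rw [← norm_le_zero_iff]
  refine le_of_forall_pos_le_add fun η hη => ?_
  have := hmain (η / (K * V + 1)) (by positivity)
  refine this.trans ?_
  rw [zero_add, mul_assoc, div_mul_eq_mul_div, div_le_iff₀ (by positivity)]
  nlinarith

/-- Liouville's theorem: a locally integrable, weakly harmonic function on the plane which tends to
zero at infinity vanishes almost everywhere. -/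
lemma ae_eq_zero_of_harmonic {v : Plane → ℂ} (hv : LocallyIntegrable v)
    (hΔ : ∀ φ, CTest φ → ∫ x, v x * (pd 0 (pd 0 φ) x + pd 1 (pd 1 φ) x) = 0)
    (h0 : Tendsto v (cocompact Plane) (𝓝 0)) : ∀ᵐ x, v x = 0 := by
  refine ae_eq_zero_of_integral_contDiff_smul_eq_zero hv fun g hg hgs => ?_
  have hψ : CTest (fun x => (g x : ℂ)) := IsTest.ofReal ⟨hg, hgs⟩
  set ψ : Plane → ℂ := fun x => (g x : ℂ) with hψd
  have h1 : ∫ x, g x • v x = ∫ x, v x * ψ x :=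
    integral_congr_ae (ae_of_all _ fun x => by simp [hψd, mul_comm])
  rw [h1]
  obtain ⟨R₀, hR₀, hsupp⟩ := exists_radius hψ.bddSupp
  set J := ∫ x, ‖ψ x‖ with hJ
  have hJ0 : 0 ≤ J := integral_nonneg fun x => norm_nonneg _
  -- moving the test function to infinity does not change the pairing
  have hmain : ∀ ε > 0, ‖∫ x, v x * ψ x‖ ≤ ε * J := by
    intro ε hε
    have hev : ∀ᶠ x in cocompact Plane, ‖v x‖ < ε := by
      have := h0.norm
      simp only [norm_zero] at this
      exact this.eventually (gt_mem_nhds hε)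
    obtain ⟨s, hs, hsε⟩ := mem_cocompact.1 hev
    obtain ⟨R₁, hR₁⟩ := hs.isBounded.subset_closedBall (0 : Plane)
    -- a translation that moves the support of `ψ` into the region where `|v| < ε`
    set a : Plane := (|R₁| + R₀ + 1) • e 0 with ha
    have hna : ‖a‖ = |R₁| + R₀ + 1 := by
      rw [ha, norm_smul, Real.norm_of_nonneg (by positivity)]; simp [e]
    have hψa : CTest (fun x => ψ (x - a)) := hψ.comp_sub a
    have hz := integral_mul_eq_zero_of_harmonic hv hΔ h0 (hψ.sub hψa) (by
      simp only [Pi.sub_apply]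
      rw [integral_sub hψ.integrable hψa.integrable, integral_sub_right_eq_self, sub_self])
    have h2 : ∫ x, v x * ψ x = ∫ x, v x * ψ (x - a) := by
      simp only [Pi.sub_apply, mul_sub] at hz
      rw [integral_sub (integrable_locInt_mul hv hψ.continuous hψ.2)
        (integrable_locInt_mul hv hψa.continuous hψa.2)] at hz
      exact sub_eq_zero.1 hz
    rw [h2]
    calc ‖∫ x, v x * ψ (x - a)‖ ≤ ∫ x, ε * ‖ψ (x - a)‖ := by
          refine norm_integral_le_of_norm_le (hψa.integrable.norm.const_mul _)
            (ae_of_all _ fun x => ?_)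
          rw [norm_mul]
          rcases lt_or_ge R₀ ‖x - a‖ with h | h
          · simp [hsupp _ h]
          · gcongr
            refine le_of_lt (hsε fun hxs => ?_)
            have h3 := hR₁ hxs
            simp at h3
            have h4 : ‖a‖ ≤ ‖x‖ + ‖x - a‖ := by
              have := norm_sub_le x (x - a)
              simpa using this
            have := le_abs_self R₁
            linarith
      _ = ε * J := by
          rw [integral_const_mul, integral_sub_right_eq_self (fun x => ‖ψ x‖)]
  rw [← norm_le_zero_iff]
  refine le_of_forall_pos_le_add fun η hη => ?_
  have := hmain (η / (J + 1)) (by positivity)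
  refine this.trans ?_
  rw [zero_add, div_mul_eq_mul_div, div_le_iff₀ (by positivity)]
  nlinarith

/-! ### The Hessian of the logarithmic potential as a bounded operator on `L²` -/

/-- The space of smooth compactly supported functions. -/
def TestSpace : Submodule ℂ (Plane → ℂ) where
  carrier := {φ | CTest φ}
  add_mem' h h' := h.add h'
  zero_mem' := ⟨contDiff_const, HasCompactSupport.zero⟩
  smul_mem' c _ h := h.const_mul c

/-- Square integrable functions on the plane. -/
abbrev LTwo : Type := Lp ℂ 2 (volume : Measure Plane)

/-- The embedding of test functions into `L²`. -/
def toLTwo : TestSpace →ₗ[ℂ] LTwo where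
  toFun φ := (CTest.memLp φ.2).toLp φ.1
  map_add' _ _ := rfl
  map_smul' _ _ := rfl

lemma denseRange_toLTwo : DenseRange toLTwo := by
  refine (Lp.dense_hasCompactSupport_contDiff (F := ℂ) (μ := (volume : Measure Plane)) (p := 2)
    (by simp)).mono ?_
  rintro f ⟨g, hfg, hc, hs⟩
  refine ⟨⟨g, hs, hc⟩, ?_⟩
  refine Lp.ext ?_
  exact (MemLp.coeFn_toLp (CTest.memLp ⟨hs, hc⟩)).trans hfg.symm

lemma coeFn_toLTwo (φ : TestSpace) : toLTwo φ =ᵐ[volume] φ.1 :=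
  MemLp.coeFn_toLp (CTest.memLp φ.2)

lemma pot_add {φ ψ : Plane → ℂ} (hφ : CTest φ) (hψ : CTest ψ) :
    pot (φ + ψ) = pot φ + pot ψ := convK_add_right locallyIntegrable_ker hφ hψ

lemma convK_const_mul (k φ : Plane → ℂ) (c : ℂ) :
    convK k (fun x => c * φ x) = fun x => c * convK k φ x := by
  ext x
  simp only [convK, mul_left_comm _ c]
  exact integral_const_mul _ _

lemma pot_smul (φ : Plane → ℂ) (c : ℂ) : pot (c • φ) = c • pot φ :=
  convK_const_mul ker φ c

lemma pd_pd_pot {φ : Plane → ℂ} (hφ : CTest φ) (i j : Fin 2) :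
    pd i (pd j (pot φ)) = pot (pd i (pd j φ)) := by
  rw [pd_pot hφ, pd_pot (hφ.pd j)]

lemma memLp_hess {φ : Plane → ℂ} (hφ : CTest φ) (i j : Fin 2) :
    MemLp (pot (pd i (pd j φ))) 2 :=
  (dec_two_pot_pd_pd hφ i j).memLp (contDiff_pot ((hφ.pd j).pd i)).continuous

/-- The second partial derivatives of the logarithmic potential of a test function. -/
def hessTest (i j : Fin 2) : TestSpace →ₗ[ℂ] LTwo where
  toFun φ := (memLp_hess φ.2 i j).toLp
  map_add' φ ψ := by
    rw [← MemLp.toLp_add]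
    congr 1
    rw [← pot_add ((φ.2.pd j).pd i) ((ψ.2.pd j).pd i)]
    congr 1
    change pd i (pd j (fun x => φ.1 x + ψ.1 x)) = _
    rw [pd_add φ.2.differentiable ψ.2.differentiable,
      pd_add (φ.2.pd j).differentiable (ψ.2.pd j).differentiable]
    rfl
  map_smul' c φ := by
    rw [RingHom.id_apply, ← MemLp.toLp_const_smul]
    congr 1
    rw [← pot_smul]
    congr 1
    change pd i (pd j (fun x => c * φ.1 x)) = _
    rw [pd_const_mul φ.2.differentiable, pd_const_mul (φ.2.pd j).differentiable]
    rfl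

lemma coeFn_hessTest (i j : Fin 2) (φ : TestSpace) :
    hessTest i j φ =ᵐ[volume] pot (pd i (pd j φ.1)) :=
  MemLp.coeFn_toLp (memLp_hess φ.2 i j)

lemma inner_eq_of_ae {F G : LTwo} {f g : Plane → ℂ} (hF : F =ᵐ[volume] f) (hG : G =ᵐ[volume] g) :
    inner ℂ F G = ∫ x, conj (f x) * g x := by
  rw [L2.inner_def]
  refine integral_congr_ae ?_
  filter_upwards [hF, hG] with x hx hy
  rw [hx, hy, RCLike.inner_apply, mul_comm]

lemma Dec.mono {m n : ℕ} (h : m ≤ n) {u : Plane → ℂ} (hu : Dec n u) : Dec m u := by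
  obtain ⟨C, hC⟩ := hu
  refine ⟨C, fun x => le_trans ?_ (hC x)⟩
  gcongr
  linarith [norm_nonneg x]

/-- Two integrations by parts exchange derivatives between two Hessians. -/
lemma hessTest_swap (i j k l : Fin 2) (φ ψ : TestSpace) :
    inner ℂ (hessTest i j φ) (hessTest k l ψ) = inner ℂ (hessTest k j φ) (hessTest i l ψ) := by
  rw [inner_eq_of_ae (coeFn_hessTest i j φ) (coeFn_hessTest k l ψ),
    inner_eq_of_ae (coeFn_hessTest k j φ) (coeFn_hessTest i l ψ)]
  have hφ : CTest φ.1 := φ.2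
  have hψ : CTest ψ.1 := ψ.2
  set u := pot (pd j φ.1) with hu
  set v := pot (pd l ψ.1) with hv
  have hus : ContDiff ℝ ∞ u := contDiff_pot (hφ.pd j)
  have hvs : ContDiff ℝ ∞ v := contDiff_pot (hψ.pd l)
  have d : ∀ {f : Plane → ℂ}, ContDiff ℝ ∞ f → Differentiable ℝ f :=
    fun hf => hf.differentiable (by simp)
  have hc : ∀ {f : Plane → ℂ}, ContDiff ℝ ∞ f → ContDiff ℝ ∞ (fun x => conj (f x)) :=
    fun hf => Complex.conjCLE.contDiff.comp hf
  have e1 : ∀ m, pot (pd m (pd j φ.1)) = pd m u := fun m => (pd_pot (hφ.pd j) m).symm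
  have e2 : ∀ m, pot (pd m (pd l ψ.1)) = pd m v := fun m => (pd_pot (hψ.pd l) m).symm
  have du : Dec 1 u := dec_one_pot_pd hφ j
  have du2 : ∀ m, Dec 2 (pd m u) := fun m => by rw [← e1]; exact dec_two_pot_pd_pd hφ m j
  have dv2 : ∀ m, Dec 2 (pd m v) := fun m => by rw [← e2]; exact dec_two_pot_pd_pd hψ m l
  have dv3 : ∀ m n, Dec 2 (pd n (pd m v)) := fun m n => by
    rw [← e2, pd_pot ((hψ.pd l).pd m)]; exact dec_two_pot_pd_pd (hψ.pd l) n m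
  -- `∫ ∂ₘ ū ∂ₙ v = - ∫ ū ∂ₘ ∂ₙ v`, which is symmetric in `m` and `n`
  have key : ∀ m n, ∫ x, conj (pd m u x) * pd n v x = - ∫ x, conj (u x) * pd m (pd n v) x := by
    intro m n
    have hpc := pd_conj (d hus) m
    have := integral_mul_pd_of_dec (hc hus) (contDiff_pd hvs n) (by norm_num) m du.conj
      (dv2 n) (by rw [hpc]; exact ((du2 m).mono (by norm_num)).conj) (dv3 n m)
    rw [hpc] at this
    rw [this, neg_neg]
  simp only [e1, e2]
  rw [key, key, pd_comm hvs]

lemma hessTest_symm (i j : Fin 2) : hessTest i j = hessTest j i := by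
  ext φ : 1
  refine Lp.ext ((coeFn_hessTest i j φ).trans ?_)
  rw [pd_comm φ.2.1 i j]
  exact (coeFn_hessTest j i φ).symm

lemma hessTest_trace (φ : TestSpace) :
    hessTest 0 0 φ + hessTest 1 1 φ = - toLTwo φ := by
  refine Lp.ext ?_
  filter_upwards [Lp.coeFn_add (hessTest 0 0 φ) (hessTest 1 1 φ), coeFn_hessTest 0 0 φ,
    coeFn_hessTest 1 1 φ, Lp.coeFn_neg (toLTwo φ), coeFn_toLTwo φ] with x h1 h2 h3 h4 h5
  rw [h1, h4, Pi.add_apply, h2, h3, Pi.neg_apply, h5, ← laplacian_pot φ.2 x, pd_pd_pot φ.2,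
    pd_pd_pot φ.2]

lemma norm_hessTest_le (i j : Fin 2) (φ : TestSpace) : ‖hessTest i j φ‖ ≤ 1 * ‖toLTwo φ‖ := by
  have h1 : ∀ i j, ‖hessTest i j φ‖ ^ 2 = (inner ℂ (hessTest j j φ) (hessTest i i φ)).re := by
    intro i j
    rw [← hessTest_swap i j j i φ φ, hessTest_symm j i, ← inner_self_eq_norm_sq (𝕜 := ℂ)]
    rfl
  have h2 : ‖toLTwo φ‖ ^ 2 = ‖hessTest 0 0 φ‖ ^ 2 + ‖hessTest 0 1 φ‖ ^ 2 +
      ‖hessTest 1 0 φ‖ ^ 2 + ‖hessTest 1 1 φ‖ ^ 2 := by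
    rw [h1, h1, h1, h1, ← norm_neg, ← hessTest_trace, ← inner_self_eq_norm_sq (𝕜 := ℂ),
      inner_add_left, inner_add_right, inner_add_right]
    simp only [map_add]
    simp only [RCLike.re_eq_complex_re]
    ring
  rw [one_mul]
  refine le_of_sq_le_sq ?_ (norm_nonneg _)
  rw [h2]
  have p : ∀ i j, 0 ≤ ‖hessTest i j φ‖ ^ 2 := fun i j => sq_nonneg _
  have p00 := p 0 0
  have p01 := p 0 1
  have p10 := p 1 0
  have p11 := p 1 1
  revert i j
  simp only [Fin.forall_fin_two]
  refine ⟨⟨?_, ?_⟩, ?_, ?_⟩ <;> linarith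

/-- The second partial derivatives `∂ᵢ∂ⱼ` of the logarithmic potential, as bounded operators on
`L²`. -/
def hess (i j : Fin 2) : LTwo →L[ℂ] LTwo := (hessTest i j).extendOfNorm toLTwo

lemma hess_toLTwo (i j : Fin 2) (φ : TestSpace) : hess i j (toLTwo φ) = hessTest i j φ :=
  LinearMap.extendOfNorm_eq denseRange_toLTwo ⟨1, norm_hessTest_le i j⟩ φ

lemma hess_symm (i j : Fin 2) : hess i j = hess j i := by rw [hess, hessTest_symm, ← hess]

lemma hess_trace (F : LTwo) : hess 0 0 F + hess 1 1 F = - F := by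
  refine denseRange_toLTwo.induction_on (p := fun F => hess 0 0 F + hess 1 1 F = - F) F
    (isClosed_eq (by fun_prop) (by fun_prop)) fun φ => ?_
  rw [hess_toLTwo, hess_toLTwo, hessTest_trace]

lemma hess_swap (i j k l : Fin 2) (F G : LTwo) :
    inner ℂ (hess i j F) (hess k l G) = inner ℂ (hess k j F) (hess i l G) := by
  refine denseRange_toLTwo.induction_on₂
    (p := fun F G => inner ℂ (hess i j F) (hess k l G) = inner ℂ (hess k j F) (hess i l G))
    (isClosed_eq (by fun_prop) (by fun_prop)) (fun φ ψ => ?_) F G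
  simp only [hess_toLTwo]
  exact hessTest_swap i j k l φ ψ

/-- The `k`-th partial derivative of `∂₂p₁ + ∂₁p₂`, where `p₁, p₂` are the logarithmic potentials
of `F₀, F₁`. -/
def shear (k : Fin 2) (F : Fin 2 → LTwo) : LTwo := hess 1 k (F 0) + hess 0 k (F 1)

/-- The non-local part of the form `𝔟` is the Dirichlet form of `∂₂p₁ + ∂₁p₂`. -/
lemma inner_hess_eq_shear (F G : Fin 2 → LTwo) :
    - (inner ℂ (G 0) (hess 1 1 (F 0) + hess 1 0 (F 1))
      + inner ℂ (G 1) (hess 0 1 (F 0) + hess 0 0 (F 1)))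
      = inner ℂ (shear 0 G) (shear 0 F) + inner ℂ (shear 1 G) (shear 1 F) := by
  have hG : ∀ i, G i = - (hess 0 0 (G i) + hess 1 1 (G i)) := fun i => by rw [hess_trace, neg_neg]
  have e : ∀ i k l H, inner ℂ (G i) (hess k l H)
      = - (inner ℂ (hess k 0 (G i)) (hess 0 l H) + inner ℂ (hess k 1 (G i)) (hess 1 l H)) := by
    intro i k l H
    conv_lhs => rw [hG i]
    rw [inner_neg_left, inner_add_left, hess_swap 0 0 k l, hess_swap 1 1 k l]
  simp only [shear, inner_add_left, inner_add_right, e]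
  rw [hess_symm 1 0]
  ring

/-- `hess i j F` is the second distributional derivative of the logarithmic potential of `F`,
expressed by duality. -/
lemma integral_hess_mul (i j : Fin 2) (F : LTwo) {φ : Plane → ℂ} (hφ : CTest φ) :
    ∫ x, hess i j F x * φ x = ∫ x, F x * pot (pd i (pd j φ)) x := by
  have hconj : ∀ {g : Plane → ℂ} (hg : MemLp g 2), ∀ H : LTwo,
      ∫ x, H x * g x = inner ℂ (hg.star.toLp) H := by
    intro g hg H
    rw [inner_eq_of_ae hg.star.coeFn_toLp (ae_eq_refl _)]
    refine integral_congr_ae (ae_of_all _ fun x => ?_)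
    simp [mul_comm]
  rw [hconj hφ.memLp, hconj (memLp_hess hφ i j)]
  refine denseRange_toLTwo.induction_on (p := fun F => inner ℂ (hφ.memLp.star.toLp) (hess i j F)
    = inner ℂ ((memLp_hess hφ i j).star.toLp) F) F
    (isClosed_eq (by fun_prop) (by fun_prop)) fun ψ => ?_
  rw [← hconj hφ.memLp, ← hconj (memLp_hess hφ i j), hess_toLTwo]
  have hψ : CTest ψ.1 := ψ.2
  have h1 : ∫ x, hessTest i j ψ x * φ x = ∫ x, pd i (pd j (pot ψ.1)) x * φ x := by
    refine integral_congr_ae ?_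
    filter_upwards [coeFn_hessTest i j ψ] with x hx
    rw [hx, pd_pd_pot hψ]
  have h2 : ∫ x, toLTwo ψ x * pot (pd i (pd j φ)) x = ∫ x, ψ.1 x * pot (pd i (pd j φ)) x := by
    refine integral_congr_ae ?_
    filter_upwards [coeFn_toLTwo ψ] with x hx
    rw [hx]
  have h3 := integral_mul_pd (contDiff_pd (contDiff_pot hψ) j) hφ i
  have h4 := integral_mul_pd (contDiff_pot hψ) (hφ.pd i) j
  rw [h1, h2, ← integral_pot_mul hψ.integrable hψ.bddSupp ((hφ.pd j).pd i).continuous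
    ((hφ.pd j).pd i).2, pd_comm hφ.1 i j, h4, h3, neg_neg]

/-! ### Young's inequality and operators on `L²` -/

/-- The Cauchy–Schwarz inequality `(∫ a b)² ≤ (∫ a) (∫ a b²)` for non-negative functions. -/
lemma sq_lintegral_mul_le {α : Type*} [MeasurableSpace α] {μ : Measure α} {a b : α → ENNReal}
    (ha : AEMeasurable a μ) (hb : AEMeasurable b μ) :
    (∫⁻ x, a x * b x ∂μ) ^ 2 ≤ (∫⁻ x, a x ∂μ) * ∫⁻ x, a x * b x ^ 2 ∂μ := by
  have h := ENNReal.lintegral_mul_le_Lp_mul_Lq μ (p := 2) (q := 2)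
    (by constructor <;> norm_num) (f := fun x => a x ^ (1 / 2 : ℝ))
    (g := fun x => a x ^ (1 / 2 : ℝ) * b x) (ha.pow_const _) ((ha.pow_const _).mul hb)
  have h1 : ∀ t : ENNReal, t ^ (1 / 2 : ℝ) * t ^ (1 / 2 : ℝ) = t := by
    intro t
    rw [← ENNReal.rpow_add_of_nonneg _ _ (by norm_num) (by norm_num)]; norm_num
  have h2 : ∀ t : ENNReal, (t ^ (1 / 2 : ℝ)) ^ (2 : ℝ) = t := by
    intro t; rw [← ENNReal.rpow_mul]; norm_num
  simp only [Pi.mul_apply, ← mul_assoc, h1, h2, ENNReal.mul_rpow_of_nonneg _ _ zero_le_two] at h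
  calc _ ≤ ((∫⁻ x, a x ∂μ) ^ (1 / 2 : ℝ) * (∫⁻ x, a x * b x ^ (2 : ℝ) ∂μ) ^ (1 / 2 : ℝ)) ^ 2 := by
        gcongr
    _ = _ := by
        rw [mul_pow, ← ENNReal.rpow_natCast, ← ENNReal.rpow_natCast]
        push_cast
        rw [h2, h2]
        simp

section Young

variable {k f : Plane → ℂ}

lemma aestronglyMeasurable_conv_prod (hk : Integrable k) (hf : AEStronglyMeasurable f volume) :
    AEStronglyMeasurable (fun p : Plane × Plane => k (p.1 - p.2) * f p.2)
      (volume.prod volume) := by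
  have := hf.convolution_integrand (ContinuousLinearMap.mul ℝ ℂ) hk.aestronglyMeasurable
  simpa [mul_comm] using this

lemma lintegral_sq_conv_le (hk : Integrable k) (hf : AEStronglyMeasurable f volume) :
    ∫⁻ x, (∫⁻ y, ‖k (x - y)‖ₑ * ‖f y‖ₑ) ^ 2
      ≤ (∫⁻ x, ‖k x‖ₑ) ^ 2 * ∫⁻ x, ‖f x‖ₑ ^ 2 := by
  have hkx : ∀ x, AEMeasurable (fun y => ‖k (x - y)‖ₑ) volume := fun x =>
    (hk.comp_sub_left x).aestronglyMeasurable.enorm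
  have hki : ∀ x, ∫⁻ y, ‖k (x - y)‖ₑ = ∫⁻ y, ‖k y‖ₑ := fun x =>
    lintegral_sub_left_eq_self (fun y => ‖k y‖ₑ) x
  have hm : AEMeasurable (fun p : Plane × Plane => ‖k (p.1 - p.2)‖ₑ * ‖f p.2‖ₑ ^ 2)
      (volume.prod volume) := by
    have h1 : AEMeasurable (fun p : Plane × Plane => ‖k (p.1 - p.2)‖ₑ) (volume.prod volume) :=
      (hk.aestronglyMeasurable.comp_quasiMeasurePreserving
        (quasiMeasurePreserving_sub_of_right_invariant volume volume)).enorm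
    have h2 : AEMeasurable (fun p : Plane × Plane => ‖f p.2‖ₑ) (volume.prod volume) :=
      (hf.comp_quasiMeasurePreserving Measure.quasiMeasurePreserving_snd).enorm
    exact h1.mul (h2.pow_const 2)
  calc _ ≤ ∫⁻ x, (∫⁻ y, ‖k y‖ₑ) * ∫⁻ y, ‖k (x - y)‖ₑ * ‖f y‖ₑ ^ 2 := by
        refine lintegral_mono fun x => ?_
        rw [← hki x]
        exact sq_lintegral_mul_le (hkx x) hf.enorm
    _ = (∫⁻ y, ‖k y‖ₑ) * ∫⁻ x, ∫⁻ y, ‖k (x - y)‖ₑ * ‖f y‖ₑ ^ 2 :=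
        lintegral_const_mul' _ _ hk.2.ne
    _ = (∫⁻ y, ‖k y‖ₑ) * ∫⁻ y, ∫⁻ x, ‖k (x - y)‖ₑ * ‖f y‖ₑ ^ 2 := by
        rw [lintegral_lintegral_swap hm]
    _ = (∫⁻ y, ‖k y‖ₑ) * ∫⁻ y, (∫⁻ x, ‖k x‖ₑ) * ‖f y‖ₑ ^ 2 := by
        congr 2
        ext y
        rw [lintegral_mul_const'' _ (hk.comp_sub_right y).aestronglyMeasurable.enorm,
          lintegral_sub_right_eq_self (fun x => ‖k x‖ₑ)]
    _ = _ := by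
        rw [lintegral_const_mul' _ _ hk.2.ne, ← mul_assoc, sq]

lemma eLpNorm_two_sq {α : Type*} [MeasurableSpace α] {μ : Measure α} (u : α → ℂ) :
    eLpNorm u 2 μ = (∫⁻ x, ‖u x‖ₑ ^ 2 ∂μ) ^ (1 / 2 : ℝ) := by
  rw [eLpNorm_eq_lintegral_rpow_enorm_toReal (by simp) (by simp)]
  simp

lemma ae_integrable_conv (hk : Integrable k) (hf : MemLp f 2) :
    ∀ᵐ x, Integrable (fun y => k (x - y) * f y) := by
  have h1 := lintegral_sq_conv_le hk hf.aestronglyMeasurable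
  have hf2 : ∫⁻ x, ‖f x‖ₑ ^ 2 ≠ ⊤ := by
    have := hf.2
    rw [eLpNorm_two_sq] at this
    intro h
    rw [h] at this
    simp at this
  have h2 : ∫⁻ x, (∫⁻ y, ‖k (x - y)‖ₑ * ‖f y‖ₑ) ^ 2 ≠ ⊤ :=
    ne_top_of_le_ne_top (ENNReal.mul_ne_top (ENNReal.pow_ne_top hk.2.ne) hf2) h1
  have hm := aestronglyMeasurable_conv_prod hk hf.aestronglyMeasurable
  have h3 : AEMeasurable (fun x => ∫⁻ y, ‖k (x - y)‖ₑ * ‖f y‖ₑ) volume := by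
    have := hm.enorm.lintegral_prod_right'
    simpa [enorm_mul] using this
  filter_upwards [ae_lt_top' (h3.pow_const 2) h2, hm.prodMk_left] with x hx hx2
  refine ⟨hx2, ?_⟩
  simp only [HasFiniteIntegral, enorm_mul]
  by_contra hcon
  rw [not_lt, top_le_iff] at hcon
  rw [hcon] at hx
  simp at hx

/-- Young's inequality `‖k ⋆ f‖₂ ≤ ‖k‖₁ ‖f‖₂`. -/
lemma eLpNorm_convK_le (hk : Integrable k) (hf : AEStronglyMeasurable f volume) :
    eLpNorm (convK k f) 2 ≤ (∫⁻ x, ‖k x‖ₑ) * eLpNorm f 2 := by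
  rw [eLpNorm_two_sq, eLpNorm_two_sq]
  calc _ ≤ ((∫⁻ x, ‖k x‖ₑ) ^ 2 * ∫⁻ x, ‖f x‖ₑ ^ 2) ^ (1 / 2 : ℝ) := by
        gcongr
        refine le_trans (lintegral_mono fun x => ?_) (lintegral_sq_conv_le hk hf)
        gcongr
        refine (enorm_integral_le_lintegral_enorm _).trans (le_of_eq ?_)
        simp [enorm_mul]
    _ = _ := by
        rw [ENNReal.mul_rpow_of_nonneg _ _ (by norm_num), ← ENNReal.rpow_natCast,
          ← ENNReal.rpow_mul]
        norm_num

lemma memLp_convK (hk : Integrable k) (hf : MemLp f 2) : MemLp (convK k f) 2 :=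
  ⟨(aestronglyMeasurable_conv_prod hk hf.aestronglyMeasurable).integral_prod_right',
    lt_of_le_of_lt (eLpNorm_convK_le hk hf.aestronglyMeasurable)
      (ENNReal.mul_lt_top hk.2 hf.2)⟩

lemma convK_congr {g : Plane → ℂ} (k : Plane → ℂ) (h : f =ᵐ[volume] g) : convK k f = convK k g := by
  ext x
  refine integral_congr_ae ?_
  filter_upwards [h] with y hy
  rw [hy]

/-- Convolution with an integrable kernel as a bounded operator on `L²`. -/
def convL (k : Plane → ℂ) (hk : Integrable k) : LTwo →L[ℂ] LTwo :=
  LinearMap.mkContinuous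
    { toFun := fun f => (memLp_convK hk (Lp.memLp f)).toLp
      map_add' := fun f g => by
        refine Lp.ext ?_
        filter_upwards [MemLp.coeFn_toLp (memLp_convK hk (Lp.memLp (f + g))),
          MemLp.coeFn_toLp (memLp_convK hk (Lp.memLp f)),
          MemLp.coeFn_toLp (memLp_convK hk (Lp.memLp g)),
          Lp.coeFn_add (MemLp.toLp _ (memLp_convK hk (Lp.memLp f)))
            (MemLp.toLp _ (memLp_convK hk (Lp.memLp g))),
          ae_integrable_conv hk (Lp.memLp f), ae_integrable_conv hk (Lp.memLp g)]
          with x h1 h2 h3 h4 h5 h6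
        rw [h4, h1, Pi.add_apply, h2, h3, convK_congr k (Lp.coeFn_add f g)]
        simp only [convK, Pi.add_apply, mul_add]
        exact integral_add h5 h6
      map_smul' := fun c f => by
        refine Lp.ext ?_
        filter_upwards [MemLp.coeFn_toLp (memLp_convK hk (Lp.memLp (c • f))),
          MemLp.coeFn_toLp (memLp_convK hk (Lp.memLp f)),
          Lp.coeFn_smul c (MemLp.toLp _ (memLp_convK hk (Lp.memLp f)))] with x h1 h2 h3
        rw [RingHom.id_apply, h3, h1, Pi.smul_apply, h2, convK_congr k (Lp.coeFn_smul c f)]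
        exact congrFun (convK_const_mul k f c) x }
    (∫⁻ x, ‖k x‖ₑ).toReal fun f => by
      have h := eLpNorm_convK_le hk (Lp.memLp f).aestronglyMeasurable
      simp only [LinearMap.coe_mk, AddHom.coe_mk, Lp.norm_toLp]
      rw [Lp.norm_def, ← ENNReal.toReal_mul]
      exact ENNReal.toReal_mono (ENNReal.mul_ne_top hk.2.ne (Lp.memLp f).2.ne) h

lemma coeFn_convL (hk : Integrable k) (f : LTwo) : convL k hk f =ᵐ[volume] convK k f :=
  MemLp.coeFn_toLp (memLp_convK hk (Lp.memLp f))

end Young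

/-! ### Functions on `Ω` -/

/-- Square integrable functions on `Ω`. -/
abbrev LOm (Ω : Set Plane) : Type := Lp ℂ 2 (volume.restrict Ω)

section Omega

variable {Ω : Set Plane}

lemma memLp_ext (hΩ : MeasurableSet Ω) {f : Plane → ℂ} (hf : MemLp f 2 (volume.restrict Ω)) :
    MemLp (Ω.indicator f) 2 := (memLp_indicator_iff_restrict hΩ).2 hf

lemma finite_restrict (hb : Ω ⊆ Metric.ball 0 1) : IsFiniteMeasure (volume.restrict Ω) :=
  ⟨by
    rw [Measure.restrict_apply_univ]
    exact lt_of_le_of_lt (measure_mono hb) measure_ball_lt_top⟩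

lemma integrable_restrict (hb : Ω ⊆ Metric.ball 0 1) {f : Plane → ℂ}
    (hf : MemLp f 2 (volume.restrict Ω)) : Integrable f (volume.restrict Ω) := by
  have := finite_restrict hb
  exact hf.integrable (by norm_num)

lemma integrable_ext (hΩ : MeasurableSet Ω) (hb : Ω ⊆ Metric.ball 0 1) {f : Plane → ℂ}
    (hf : MemLp f 2 (volume.restrict Ω)) : Integrable (Ω.indicator f) :=
  (integrable_indicator_iff hΩ).2 (integrable_restrict hb hf)

lemma ext_support (hb : Ω ⊆ Metric.ball 0 1) (f : Plane → ℂ) :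
    ∀ x, (1 : ℝ) < ‖x‖ → Ω.indicator f x = 0 := by
  intro x hx
  refine indicator_of_notMem (fun h => ?_) _
  have := hb h
  simp at this
  linarith

lemma indicator_ae_eq {f g : Plane → ℂ} (hΩ : MeasurableSet Ω) (h : f =ᵐ[volume.restrict Ω] g) :
    Ω.indicator f =ᵐ[volume] Ω.indicator g := by
  rw [EventuallyEq, ae_restrict_iff' hΩ] at h
  filter_upwards [h] with x hx
  by_cases hxΩ : x ∈ Ω
  · simp [hxΩ, hx hxΩ]
  · simp [hxΩ]

/-- Extension by zero. -/
def extL (hΩ : MeasurableSet Ω) : LOm Ω →L[ℂ] LTwo :=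
  LinearMap.mkContinuous
    { toFun := fun f => (memLp_ext hΩ (Lp.memLp f)).toLp
      map_add' := fun f g => by
        rw [← MemLp.toLp_add, MemLp.toLp_eq_toLp_iff, ← indicator_add']
        exact indicator_ae_eq hΩ (Lp.coeFn_add f g)
      map_smul' := fun c f => by
        rw [RingHom.id_apply, ← MemLp.toLp_const_smul, MemLp.toLp_eq_toLp_iff]
        have h : Ω.indicator (c • (f : Plane → ℂ)) = c • Ω.indicator f := by
          ext x; by_cases hx : x ∈ Ω <;> simp [hx]
        rw [← h]
        exact indicator_ae_eq hΩ (Lp.coeFn_smul c f) }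
    1 fun f => by
      simp only [LinearMap.coe_mk, AddHom.coe_mk, Lp.norm_toLp, one_mul]
      rw [eLpNorm_indicator_eq_eLpNorm_restrict hΩ, Lp.norm_def]

lemma coeFn_extL (hΩ : MeasurableSet Ω) (f : LOm Ω) : extL hΩ f =ᵐ[volume] Ω.indicator f :=
  MemLp.coeFn_toLp (memLp_ext hΩ (Lp.memLp f))

lemma norm_extL (hΩ : MeasurableSet Ω) (f : LOm Ω) : ‖extL hΩ f‖ = ‖f‖ := by
  have : extL hΩ f = (memLp_ext hΩ (Lp.memLp f)).toLp := rfl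
  rw [this, Lp.norm_toLp, eLpNorm_indicator_eq_eLpNorm_restrict hΩ, Lp.norm_def]

/-- Convolution with a locally integrable kernel as a bounded operator on `L²(Ω)`. Since `Ω` lies
in the unit ball, only the values of the kernel in the ball of radius `2` matter. -/
def opK (hΩ : MeasurableSet Ω) (k : Plane → ℂ) (hk : LocallyIntegrable k) : LOm Ω →L[ℂ] LOm Ω :=
  (LpToLpRestrictCLM Plane ℂ ℂ volume 2 Ω).comp
    ((convL (cutK k (1 + 1)) (integrable_cutK hk (1 + 1))).comp (extL hΩ))

lemma coeFn_opK (hΩ : MeasurableSet Ω) (hb : Ω ⊆ Metric.ball 0 1) {k : Plane → ℂ}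
    (hk : LocallyIntegrable k) (f : LOm Ω) :
    opK hΩ k hk f =ᵐ[volume.restrict Ω] convK k (Ω.indicator f) := by
  refine (LpToLpRestrictCLM_coeFn ℂ Ω _).trans ?_
  filter_upwards [ae_restrict_of_ae (coeFn_convL (integrable_cutK hk (1 + 1)) (extL hΩ f)),
    ae_restrict_mem hΩ] with x hx hxΩ
  change convL (cutK k (1 + 1)) (integrable_cutK hk (1 + 1)) (extL hΩ f) x = _
  rw [hx, convK_congr _ (coeFn_extL hΩ f)]
  exact convK_cutK (ext_support hb f) (by simpa using hb hxΩ)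

/-! ### Identification of the operator `A` and of the weak derivatives -/

lemma CTest.re {φ : Plane → ℂ} (h : CTest φ) : IsTest (fun x => (φ x).re) :=
  ⟨Complex.reCLM.contDiff.comp h.1, h.2.comp_left (g := fun z : ℂ => z.re) (by simp)⟩

lemma CTest.im {φ : Plane → ℂ} (h : CTest φ) : IsTest (fun x => (φ x).im) :=
  ⟨Complex.imCLM.contDiff.comp h.1, h.2.comp_left (g := fun z : ℂ => z.im) (by simp)⟩

lemma laplacian_ofReal {φ : Plane → ℝ} (h : IsTest φ) (x : Plane) :
    ((Laplacian.laplacian φ x : ℝ) : ℂ)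
      = pd 0 (pd 0 (fun x => (φ x : ℂ))) x + pd 1 (pd 1 (fun x => (φ x : ℂ))) x := by
  have d : ∀ {f : Plane → ℝ}, ContDiff ℝ ∞ f → Differentiable ℝ f :=
    fun hf => hf.differentiable (by simp)
  rw [laplacian_eq_pd (h.1.of_le (by norm_cast)), pd_ofReal (d h.1), pd_ofReal (d h.1),
    pd_ofReal (d (contDiff_pd h.1 0)), pd_ofReal (d (contDiff_pd h.1 1))]
  push_cast
  rfl

lemma isPotential_pot (hΩ : MeasurableSet Ω) (hb : Ω ⊆ Metric.ball 0 1) {f : Plane → ℂ}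
    (hf : MemLp f 2 (volume.restrict Ω)) : IsPotential Ω f (pot (Ω.indicator f)) := by
  have hF := integrable_ext hΩ hb hf
  have hs : BddSupp (Ω.indicator f) := ⟨1, ext_support hb f⟩
  refine ⟨locallyIntegrable_convK locallyIntegrable_ker hF hs, fun φ hφ => ?_, ?_⟩
  · have hφc := hφ.ofReal
    set φc : Plane → ℂ := fun x => (φ x : ℂ) with hφd
    have hl : CTest (pd 0 (pd 0 φc) + pd 1 (pd 1 φc)) := ((hφc.pd 0).pd 0).add ((hφc.pd 1).pd 1)
    have h1 : ∫ x, Laplacian.laplacian φ x • pot (Ω.indicator f) x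
        = ∫ x, pot (Ω.indicator f) x * (pd 0 (pd 0 φc) + pd 1 (pd 1 φc)) x := by
      refine integral_congr_ae (ae_of_all _ fun x => ?_)
      simp only [Complex.real_smul, laplacian_ofReal hφ, Pi.add_apply, hφd]
      ring
    rw [h1, integral_pot_mul hF hs hl.continuous hl.2, ← integral_neg, ← integral_indicator hΩ]
    refine integral_congr_ae (ae_of_all _ fun x => ?_)
    have h2 := laplacian_pot hφc x
    rw [pd_pd_pot hφc, pd_pd_pot hφc] at h2
    have h3 := congrFun (pot_add ((hφc.pd 0).pd 0) ((hφc.pd 1).pd 1)) x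
    simp only [h3, Pi.add_apply, h2]
    by_cases hx : x ∈ Ω
    · simp [hx, hφd, mul_comm]
    · simp [hx]
  · have hm : ∫ y in Ω, f y = ∫ y, Ω.indicator f y := (integral_indicator hΩ).symm
    rw [tendsto_zero_iff_norm_tendsto_zero]
    have hlim : Tendsto (fun x : Plane => 3 * 1 * (∫ y, ‖Ω.indicator f y‖) / ‖x‖)
        (cocompact Plane) (𝓝 0) :=
      tendsto_const_nhds.div_atTop tendsto_norm_cocompact_atTop
    refine squeeze_zero' (Eventually.of_forall fun _ => norm_nonneg _) ?_ hlim
    filter_upwards [tendsto_norm_cocompact_atTop.eventually_ge_atTop (4 * 1)] with x hx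
    have := norm_pot_sub_le hF (ext_support hb f) (x := x)
      (by rintro rfl; simp at hx; linarith) hx
    refine le_trans (le_of_eq ?_) this
    congr 1
    rw [hm, ker]
    push_cast
    have : (Real.pi : ℂ) ≠ 0 := by exact_mod_cast Real.pi_ne_zero
    field_simp
    ring

lemma isPotential_unique {f p q : Plane → ℂ} (hp : IsPotential Ω f p) (hq : IsPotential Ω f q) :
    p =ᵐ[volume] q := by
  have hv : LocallyIntegrable (fun x => p x - q x) := hp.1.sub hq.1
  have hlapl : ∀ φ, IsTest φ → ∫ x, (p x - q x) * (pd 0 (pd 0 (fun x => (φ x : ℂ))) x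
      + pd 1 (pd 1 (fun x => (φ x : ℂ))) x) = 0 := by
    intro φ hφ
    have hc := hφ.ofReal
    have hl := ((hc.pd 0).pd 0).add ((hc.pd 1).pd 1)
    have h1 : ∀ r : Plane → ℂ, ∫ x, Laplacian.laplacian φ x • r x
        = ∫ x, r x * (pd 0 (pd 0 (fun x => (φ x : ℂ))) + pd 1 (pd 1 (fun x => (φ x : ℂ)))) x := by
      intro r
      refine integral_congr_ae (ae_of_all _ fun x => ?_)
      simp only [Complex.real_smul, laplacian_ofReal hφ, Pi.add_apply]
      ring
    have h2 := (hp.2.1 φ hφ).trans (hq.2.1 φ hφ).symm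
    rw [neg_inj, h1, h1] at h2
    simp only [sub_mul]
    rw [← sub_eq_zero] at h2
    rw [← h2]
    exact integral_sub (integrable_locInt_mul hp.1 hl.continuous hl.2)
      (integrable_locInt_mul hq.1 hl.continuous hl.2)
  have h := ae_eq_zero_of_harmonic hv (fun φ hφ => ?_) ?_
  · filter_upwards [h] with x hx
    exact sub_eq_zero.1 hx
  · have e1 := hlapl _ hφ.re
    have e2 := hlapl _ hφ.im
    have i1 := ((hφ.re.ofReal.pd 0).pd 0).add ((hφ.re.ofReal.pd 1).pd 1)
    have i2 := ((hφ.im.ofReal.pd 0).pd 0).add ((hφ.im.ofReal.pd 1).pd 1)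
    have hd : ∀ i x, pd i (pd i φ) x = pd i (pd i (fun x => ((φ x).re : ℂ))) x
        + Complex.I * pd i (pd i (fun x => ((φ x).im : ℂ))) x := by
      intro i x
      have : φ = fun x => ((φ x).re : ℂ) + Complex.I * ((φ x).im : ℂ) := by
        ext x; rw [mul_comm, Complex.re_add_im]
      conv_lhs => rw [this]
      have hI : CTest (fun x => Complex.I * ((φ x).im : ℂ)) := hφ.im.ofReal.const_mul _
      have hI2 : CTest (fun x => Complex.I * pd i (fun x => ((φ x).im : ℂ)) x) :=
        (hφ.im.ofReal.pd i).const_mul _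
      rw [pd_add hφ.re.ofReal.differentiable hI.differentiable,
        pd_const_mul hφ.im.ofReal.differentiable,
        pd_add (hφ.re.ofReal.pd i).differentiable hI2.differentiable,
        pd_const_mul (hφ.im.ofReal.pd i).differentiable]
    have e3 : ∀ x, (p x - q x) * (pd 0 (pd 0 φ) x + pd 1 (pd 1 φ) x)
        = (p x - q x) * (pd 0 (pd 0 (fun x => ((φ x).re : ℂ))) x
            + pd 1 (pd 1 (fun x => ((φ x).re : ℂ))) x)
          + Complex.I * ((p x - q x) * (pd 0 (pd 0 (fun x => ((φ x).im : ℂ))) x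
            + pd 1 (pd 1 (fun x => ((φ x).im : ℂ))) x)) := by
      intro x
      rw [hd, hd]; ring
    simp only [e3]
    have j1 := integrable_locInt_mul hv i1.continuous i1.2
    have j2 := integrable_locInt_mul hv i2.continuous i2.2
    simp only [Pi.add_apply] at j1 j2
    rw [integral_add j1 (j2.const_mul _), integral_const_mul, e1, e2]
    simp
  · have := hp.2.2.sub hq.2.2
    simpa using this

lemma A_ae_eq (hΩ : MeasurableSet Ω) (hb : Ω ⊆ Metric.ball 0 1) {f : Plane → ℂ}
    (hf : MemLp f 2 (volume.restrict Ω)) : A Ω f =ᵐ[volume] pot (Ω.indicator f) :=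
  isPotential_unique (Classical.epsilon_spec ⟨_, isPotential_pot hΩ hb hf⟩)
    (isPotential_pot hΩ hb hf)

lemma A_congr {f g : Plane → ℂ} (h : f =ᵐ[volume.restrict Ω] g) : A Ω f = A Ω g := by
  have : IsPotential Ω f = IsPotential Ω g := by
    ext p
    have h1 : ∫ y in Ω, f y = ∫ y in Ω, g y := integral_congr_ae h
    have h2 : ∀ φ : Plane → ℝ, ∫ x in Ω, φ x • f x = ∫ x in Ω, φ x • g x := fun φ =>
      integral_congr_ae (by filter_upwards [h] with x hx; rw [hx])
    simp only [IsPotential, h1, h2]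
  rw [A, A, this]

lemma weakPartial_ae_eq {i : Fin 2} {p q g : Plane → ℂ} (hpq : p =ᵐ[volume] q)
    (h : IsWeakPartial i q g) : weakPartial i p =ᵐ[volume] g := by
  have hp : IsWeakPartial i p g := by
    refine ⟨h.1.congr hpq.symm, h.2.1, fun φ hφ => ?_⟩
    rw [← h.2.2 φ hφ]
    refine integral_congr_ae ?_
    filter_upwards [hpq] with x hx
    rw [hx]
  have hs : IsWeakPartial i p (weakPartial i p) := Classical.epsilon_spec ⟨g, hp⟩
  refine ae_eq_of_integral_contDiff_smul_eq hs.2.1 hp.2.1 fun φ h1 h2 => ?_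
  have a := hs.2.2 φ ⟨h1, h2⟩
  have b := hp.2.2 φ ⟨h1, h2⟩
  rw [a, neg_inj] at b
  exact b

lemma isWeakPartial_pot {F : Plane → ℂ} (hF : Integrable F) (hs : BddSupp F) (i : Fin 2) :
    IsWeakPartial i (pot F) (convK (kerD i) F) := by
  refine ⟨locallyIntegrable_convK locallyIntegrable_ker hF hs,
    locallyIntegrable_convK (locallyIntegrable_kerD i) hF hs, fun φ hφ => ?_⟩
  have hc := hφ.ofReal
  have hpd := pd_ofReal (hφ.1.differentiable (by simp)) i
  have h1 : ∫ x, fderiv ℝ φ x (e i) • pot F x = ∫ x, pot F x * pd i (fun x => (φ x : ℂ)) x := by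
    refine integral_congr_ae (ae_of_all _ fun x => ?_)
    simp only [hpd, Complex.real_smul]
    simp only [pd]
    ring
  have h2 : ∫ x, φ x • convK (kerD i) F x = ∫ x, convK (kerD i) F x * (φ x : ℂ) := by
    refine integral_congr_ae (ae_of_all _ fun x => ?_)
    simp only [Complex.real_smul]
    ring
  rw [h1, h2, pot, integral_convK_mul locallyIntegrable_ker hF hs (hc.pd i).continuous (hc.pd i).2,
    integral_convK_mul (locallyIntegrable_kerD i) hF hs hc.continuous hc.2, ← integral_neg]
  refine integral_congr_ae (ae_of_all _ fun y => ?_)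
  simp only
  rw [← mul_neg]
  congr 1
  -- translate so that the singularity of the kernel sits at the origin
  have hψ : CTest (fun x => ((φ (x + y) : ℝ) : ℂ)) := by
    have := hc.comp_sub (-y); simpa using this
  have h3 := integral_ker_mul_pd hψ i
  have h4 := pd_comp_sub (φ := fun x => (φ x : ℂ)) (-y) i
  simp only [sub_neg_eq_add] at h4
  rw [h4] at h3
  rw [← integral_add_right_eq_self _ y, ← integral_add_right_eq_self
    (fun x => kerD i (x - y) * (φ x : ℂ)) y]
  simpa using h3

lemma isWeakPartial_hess (hΩ : MeasurableSet Ω) (hb : Ω ⊆ Metric.ball 0 1) (f : LOm Ω)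
    (i j : Fin 2) :
    IsWeakPartial i (convK (kerD j) (Ω.indicator f)) (hess i j (extL hΩ f)) := by
  have hF := integrable_ext hΩ hb (Lp.memLp f)
  have hs : BddSupp (Ω.indicator f) := ⟨1, ext_support hb f⟩
  have hw := isWeakPartial_pot hF hs j
  refine ⟨hw.2.1, (Lp.memLp _).locallyIntegrable (by norm_num), fun φ hφ => ?_⟩
  have hc := hφ.ofReal
  have hpd := pd_ofReal (hφ.1.differentiable (by simp)) i
  have h1 := hw.2.2 (pd i φ) ⟨contDiff_pd hφ.1 i, hasCompactSupport_pd hφ.2 i⟩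
  change ∫ x, pd i φ x • _ = _
  rw [eq_comm, neg_eq_iff_eq_neg, ← h1]
  have h2 : ∫ x, φ x • hess i j (extL hΩ f) x = ∫ x, hess i j (extL hΩ f) x * (φ x : ℂ) := by
    refine integral_congr_ae (ae_of_all _ fun x => ?_)
    simp only [Complex.real_smul]
    ring
  rw [h2, hess_symm i j, integral_hess_mul j i _ hc]
  have h3 : ∫ x, fderiv ℝ (pd i φ) x (e j) • pot (Ω.indicator f) x
      = ∫ x, pot (Ω.indicator f) x * pd j (pd i (fun x => (φ x : ℂ))) x := by
    refine integral_congr_ae (ae_of_all _ fun x => ?_)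
    simp only [hpd]
    rw [pd_ofReal ((contDiff_pd hφ.1 i).differentiable (by simp))]
    simp only [pd, Complex.real_smul]
    ring
  rw [h3, integral_pot_mul hF hs ((hc.pd i).pd j).continuous ((hc.pd i).pd j).2]
  refine integral_congr_ae ?_
  filter_upwards [coeFn_extL hΩ f] with x hx
  rw [hx]

lemma weakPartial_A (hΩ : MeasurableSet Ω) (hb : Ω ⊆ Metric.ball 0 1) (f : LOm Ω) (i : Fin 2) :
    weakPartial i (A Ω f) =ᵐ[volume] convK (kerD i) (Ω.indicator f) :=
  weakPartial_ae_eq (A_ae_eq hΩ hb (Lp.memLp f))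
    (isWeakPartial_pot (integrable_ext hΩ hb (Lp.memLp f)) ⟨1, ext_support hb f⟩ i)

lemma weakPartial_weakPartial_A (hΩ : MeasurableSet Ω) (hb : Ω ⊆ Metric.ball 0 1) (f : LOm Ω)
    (i j : Fin 2) :
    weakPartial i (weakPartial j (A Ω f)) =ᵐ[volume] hess i j (extL hΩ f) :=
  weakPartial_ae_eq (weakPartial_A hΩ hb f j) (isWeakPartial_hess hΩ hb f i j)

end Omega

/-! ### Potentials of radial densities -/

lemma integral_log_norm_sub_pt (x : Plane) {r : ℝ} (hr : 0 < r) :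
    ∫ t in Ioo (-Real.pi) Real.pi, Real.log ‖x - pt r t‖
      = 2 * Real.pi * Real.log (max ‖x‖ r) := by
  set a : ℂ := planeEquiv.symm x with ha
  have hax : planeEquiv a = x := by simp [ha]
  have hn : ∀ t, ‖x - pt r t‖ = ‖circleMap 0 r t - a‖ := by
    intro t
    have h1 : pt r t = planeEquiv (circleMap 0 r t) := by
      have := planeEquiv_polar (r, t)
      simp only [Complex.polarCoord_symm_apply] at this
      rw [← this, circleMap_zero, Complex.exp_mul_I, Complex.ofReal_cos, Complex.ofReal_sin]
    rw [h1, ← hax, ← map_sub, LinearIsometryEquiv.norm_map, norm_sub_rev]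
  have h := circleAverage_log_norm_sub_const_eq_log_radius_add_posLog (a := a) (c := 0) hr.ne'
  rw [Real.circleAverage] at h
  have hper : Function.Periodic (fun t => Real.log ‖circleMap 0 r t - a‖) (2 * Real.pi) := by
    intro t
    simp only [(periodic_circleMap 0 r) t]
  have h2 := hper.intervalIntegral_add_eq (-Real.pi) 0
  rw [zero_add, show -Real.pi + 2 * Real.pi = Real.pi by ring] at h2
  rw [← integral_Ioc_eq_integral_Ioo,
    ← intervalIntegral.integral_of_le (by linarith [Real.pi_pos])]
  simp only [hn]
  rw [h2]
  have hna : ‖a‖ = ‖x‖ := (LinearIsometryEquiv.norm_map planeEquiv a).symm.trans (by rw [hax])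
  rw [zero_sub, norm_neg, hna, smul_eq_mul] at h
  have h3 : Real.log r + Real.posLog (r⁻¹ * ‖x‖) = Real.log (max ‖x‖ r) := by
    rcases le_total ‖x‖ r with hx | hx
    · rw [max_eq_right hx, (Real.posLog_eq_zero_iff _).2, add_zero]
      rw [abs_of_nonneg (by positivity), inv_mul_le_iff₀ hr]
      simpa using hx
    · rw [max_eq_left hx, Real.posLog_eq_log, ← Real.log_mul hr.ne', mul_inv_cancel_left₀ hr.ne']
      · exact (mul_pos (inv_pos.2 hr) (hr.trans_le hx)).ne'
      · rw [abs_of_nonneg (by positivity), le_inv_mul_iff₀ hr]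
        simpa using hx
  rw [h3] at h
  rw [← h]
  field_simp

/-- The logarithmic kernel with `‖x - y‖` replaced by `max ‖x‖ ‖y‖`, its average over rotations
of `y`. -/
def kerMax (x y : Plane) : ℂ := ((-(1 / (2 * Real.pi)) * Real.log (max ‖x‖ ‖y‖) : ℝ) : ℂ)

lemma measurable_kerMax (x : Plane) : Measurable (kerMax x) := by
  unfold kerMax
  fun_prop

lemma integrable_kerMax_mul (x : Plane) {φ : Plane → ℂ} (hc : Continuous φ)
    (hs : HasCompactSupport φ) : Integrable (fun y => kerMax x y * φ y) := by
  have h1 := (integrable_locInt_mul locallyIntegrable_ker hc hs).norm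
  have h2 := ((hc.integrable_of_hasCompactSupport (μ := volume) hs).norm).const_mul ‖ker x‖
  refine (h2.add h1).mono' ((measurable_kerMax x).aestronglyMeasurable.mul hc.aestronglyMeasurable)
    (ae_of_all _ fun y => ?_)
  simp only [Pi.add_apply, norm_mul, ← add_mul]
  gcongr
  rcases le_total ‖x‖ ‖y‖ with h | h
  · rw [kerMax, max_eq_right h]; exact le_add_of_nonneg_left (norm_nonneg _)
  · rw [kerMax, max_eq_left h]; exact le_add_of_nonneg_right (norm_nonneg _)

/-- Newton's theorem. -/
lemma pot_radial {φ : Plane → ℂ} (hc : Continuous φ) (hs : HasCompactSupport φ)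
    {F : ℝ → ℂ} (hF : ∀ x, φ x = F ‖x‖) (x : Plane) :
    pot φ x = ∫ y, kerMax x y * φ y := by
  have hi : Integrable (fun y => ker (x - y) * φ y) := by
    have hk : LocallyIntegrable (fun y => ker (x - y)) := by
      refine locallyIntegrable_of_ball fun R => ?_
      have := ((locallyIntegrable_ker.integrableOn_isCompact
        (isCompact_closedBall (0 : Plane) (‖x‖ + R))).integrable_indicator
          measurableSet_closedBall).comp_sub_left x
      refine IntegrableOn.congr_fun this.integrableOn (fun y hy => ?_) measurableSet_ball
      refine indicator_of_mem ?_ _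
      simp only [Metric.mem_ball, dist_zero_right, Metric.mem_closedBall] at hy ⊢
      exact (norm_sub_le _ _).trans (by linarith)
    exact integrable_locInt_mul hk hc hs
  have hm : Measurable (fun y => ker (x - y) * φ y) :=
    (measurable_ker.comp (measurable_const.sub measurable_id)).mul hc.measurable
  have hm' : Measurable (fun y => kerMax x y * φ y) := (measurable_kerMax x).mul hc.measurable
  rw [pot, convK, integral_polar hm hi, integral_polar hm' (integrable_kerMax_mul x hc hs)]
  refine setIntegral_congr_fun measurableSet_Ioi fun r (hr : 0 < r) => ?_
  simp only [hF, norm_pt, abs_of_pos hr, ker, kerMax, setIntegral_const]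
  have h := integral_log_norm_sub_pt x hr
  have h1 : ∀ t, (r : ℂ) * (((-(1 / (2 * Real.pi)) * Real.log ‖x - pt r t‖ : ℝ) : ℂ) * F r)
      = ((Real.log ‖x - pt r t‖ : ℝ) : ℂ) * (r * (-(1 / (2 * Real.pi)) : ℝ) * F r) := by
    intro t; push_cast; ring
  simp only [h1]
  rw [integral_mul_const, integral_complex_ofReal, h]
  have hv : (volume.real (Ioo (-Real.pi) Real.pi)) = 2 * Real.pi := by
    rw [Real.volume_real_Ioo_of_le (by linarith [Real.pi_pos])]; ring
  rw [hv, Complex.real_smul]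
  push_cast
  ring

/-- A smooth radial probability density supported in the annulus `a ≤ ‖x‖ ≤ b`. -/
structure IsRing (a b : ℝ) (ρ : Plane → ℝ) : Prop where
  test : IsTest ρ
  nonneg : ∀ x, 0 ≤ ρ x
  radial : ∃ F : ℝ → ℝ, ∀ x, ρ x = F ‖x‖
  support : ∀ x, ρ x ≠ 0 → a ≤ ‖x‖ ∧ ‖x‖ ≤ b
  integral : ∫ x, ρ x = 1

lemma exists_isRing {a b : ℝ} (ha : 0 < a) (hab : a < b) : ∃ ρ, IsRing a b ρ := by
  have hsq : a ^ 2 < b ^ 2 := by gcongr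
  let η : ContDiffBump ((a ^ 2 + b ^ 2) / 2) :=
    ⟨(b ^ 2 - a ^ 2) / 4, (b ^ 2 - a ^ 2) / 2, by linarith, by linarith⟩
  set f : Plane → ℝ := fun x => η (‖x‖ ^ 2) with hf
  have hsupp : ∀ x, f x ≠ 0 → a ≤ ‖x‖ ∧ ‖x‖ ≤ b := by
    intro x hx
    have : ‖x‖ ^ 2 ∈ Function.support η := hx
    rw [η.support_eq, Metric.mem_ball, Real.dist_eq, abs_lt] at this
    have h1 : η.rOut = (b ^ 2 - a ^ 2) / 2 := rfl
    rw [h1] at this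
    constructor
    · exact le_of_lt (lt_of_pow_lt_pow_left₀ 2 (norm_nonneg _) (by linarith [this.1]))
    · exact le_of_lt (lt_of_pow_lt_pow_left₀ 2 (by linarith) (by linarith [this.2]))
  have hsm : ContDiff ℝ ∞ f := η.contDiff.comp (contDiff_norm_sq ℝ)
  have hcs : HasCompactSupport f := by
    refine HasCompactSupport.of_support_subset_isCompact (isCompact_closedBall 0 b) fun x hx => ?_
    simpa using (hsupp x hx).2
  have hpos : 0 < ∫ x, f x := by
    refine hsm.continuous.integral_pos_of_hasCompactSupport_nonneg_nonzero hcs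
      (fun x => η.nonneg) (x := (Real.sqrt ((a ^ 2 + b ^ 2) / 2)) • e 0) ?_
    have : ‖(Real.sqrt ((a ^ 2 + b ^ 2) / 2)) • e 0‖ ^ 2 = (a ^ 2 + b ^ 2) / 2 := by
      rw [norm_smul, mul_pow, Real.norm_eq_abs, sq_abs, Real.sq_sqrt (by positivity)]
      simp [e]
    simp only [hf, this]
    exact (η.pos_of_mem_ball (Metric.mem_ball_self η.rOut_pos)).ne'
  refine ⟨fun x => (∫ y, f y)⁻¹ * f x, ⟨contDiff_const.mul hsm, hcs.mul_left⟩,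
    fun x => mul_nonneg (inv_nonneg.2 hpos.le) η.nonneg,
    ⟨fun t => (∫ y, f y)⁻¹ * η (t ^ 2), fun x => rfl⟩,
    fun x hx => hsupp x (right_ne_zero_of_mul hx), ?_⟩
  rw [integral_const_mul, inv_mul_cancel₀ hpos.ne']

section Ring

variable {a b : ℝ} {ρ : Plane → ℝ}

lemma IsRing.integral_ofReal (h : IsRing a b ρ) : ∫ x, (ρ x : ℂ) = 1 := by
  rw [integral_complex_ofReal, h.integral]; simp

lemma IsRing.pot_eq (h : IsRing a b ρ) (x : Plane) :
    pot (fun y => (ρ y : ℂ)) x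
      = ((∫ y, -(1 / (2 * Real.pi)) * Real.log (max ‖x‖ ‖y‖) * ρ y : ℝ) : ℂ) := by
  obtain ⟨F, hF⟩ := h.radial
  rw [pot_radial h.test.ofReal.continuous h.test.ofReal.2 (F := fun t => (F t : ℂ))
    (fun y => by rw [hF]), ← integral_complex_ofReal]
  simp [kerMax]

lemma IsRing.integrable_log_max_mul (h : IsRing a b ρ) (x : Plane) :
    Integrable (fun y => -(1 / (2 * Real.pi)) * Real.log (max ‖x‖ ‖y‖) * ρ y) := by
  have := (integrable_kerMax_mul x h.test.ofReal.continuous h.test.ofReal.2).re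
  refine this.congr (ae_of_all _ fun y => ?_)
  simp only [kerMax, ← Complex.ofReal_mul]
  rfl

lemma IsRing.pot_of_ge (h : IsRing a b ρ) {x : Plane} (hx : b ≤ ‖x‖) :
    pot (fun y => (ρ y : ℂ)) x = ker x := by
  rw [h.pot_eq, ker]
  have : ∀ y, -(1 / (2 * Real.pi)) * Real.log (max ‖x‖ ‖y‖) * ρ y
      = -(1 / (2 * Real.pi)) * Real.log ‖x‖ * ρ y := by
    intro y
    by_cases hy : ρ y = 0
    · simp [hy]
    · rw [max_eq_left ((h.support y hy).2.trans hx)]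
  simp only [this]
  rw [integral_const_mul, h.integral, mul_one]

lemma IsRing.pot_of_le (h : IsRing a b ρ) {x : Plane} (hx : ‖x‖ ≤ a) :
    pot (fun y => (ρ y : ℂ)) x = pot (fun y => (ρ y : ℂ)) 0 := by
  rw [h.pot_eq, h.pot_eq]
  congr 1
  refine integral_congr_ae (ae_of_all _ fun y => ?_)
  by_cases hy : ρ y = 0
  · simp [hy]
  · simp only
    rw [max_eq_right (hx.trans (h.support y hy).1), norm_zero, max_eq_right (norm_nonneg _)]

lemma IsRing.re_pot_le (h : IsRing a b ρ) (ha : 0 < a) (x : Plane) :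
    (pot (fun y => (ρ y : ℂ)) x).re ≤ -(1 / (2 * Real.pi)) * Real.log a := by
  rw [h.pot_eq, Complex.ofReal_re]
  calc _ ≤ ∫ y, -(1 / (2 * Real.pi)) * Real.log a * ρ y := by
        refine integral_mono (h.integrable_log_max_mul x)
          ((h.test.1.continuous.integrable_of_hasCompactSupport h.test.2).const_mul _) fun y => ?_
        by_cases hy : ρ y = 0
        · simp [hy]
        · have h1 : Real.log a ≤ Real.log (max ‖x‖ ‖y‖) :=
            Real.log_le_log ha ((h.support y hy).1.trans (le_max_right _ _))
          have h2 : 0 < 1 / (2 * Real.pi) := by positivity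
          refine mul_le_mul_of_nonneg_right ?_ (h.nonneg y)
          nlinarith
    _ = _ := by rw [integral_const_mul, h.integral, mul_one]

lemma IsRing.le_re_pot_zero (h : IsRing a b ρ) (ha : 0 < a) :
    -(1 / (2 * Real.pi)) * Real.log b ≤ (pot (fun y => (ρ y : ℂ)) 0).re := by
  rw [h.pot_eq, Complex.ofReal_re]
  calc _ = ∫ y, -(1 / (2 * Real.pi)) * Real.log b * ρ y := by
        rw [integral_const_mul, h.integral, mul_one]
    _ ≤ _ := by
        refine integral_mono
          ((h.test.1.continuous.integrable_of_hasCompactSupport h.test.2).const_mul _)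
          (h.integrable_log_max_mul 0) fun y => ?_
        by_cases hy : ρ y = 0
        · simp [hy]
        · have h3 := h.support y hy
          have h1 : Real.log (max ‖(0 : Plane)‖ ‖y‖) ≤ Real.log b := by
            rw [norm_zero, max_eq_right (norm_nonneg _)]
            exact Real.log_le_log (ha.trans_le h3.1) h3.2
          have h2 : 0 < 1 / (2 * Real.pi) := by positivity
          refine mul_le_mul_of_nonneg_right ?_ (h.nonneg y)
          nlinarith

lemma IsRing.conj_pot (h : IsRing a b ρ) (x : Plane) :
    conj (pot (fun y => (ρ y : ℂ)) x) = pot (fun y => (ρ y : ℂ)) x := by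
  rw [h.pot_eq, Complex.conj_ofReal]

end Ring

/-! ### Positivity of the logarithmic energy -/

lemma re_energy_nonneg {f : Plane → ℂ} (hf : CTest f) (h0 : ∫ x, f x = 0) :
    0 ≤ (∫ x, f x * conj (pot f x)).re := by
  set u := pot f with hu
  have hus : ContDiff ℝ ∞ u := contDiff_pot hf
  have hcs : ContDiff ℝ ∞ (fun x => conj (u x)) := Complex.conjCLE.contDiff.comp hus
  have d1 : Dec 1 u := dec_one_pot hf h0
  have d2 : ∀ i, Dec 2 (pd i u) := fun i => by rw [hu, pd_pot hf]; exact dec_two_pot_pd hf h0 i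
  have d3 : ∀ i, Dec 2 (pd i (pd i u)) := fun i => by
    rw [hu, pd_pd_pot hf]; exact dec_two_pot_pd_pd hf i i
  have hc : ∀ i, pd i (fun x => conj (u x)) = fun x => conj (pd i u x) :=
    pd_conj (hus.differentiable (by simp))
  have key : ∀ i, ∫ x, conj (u x) * pd i (pd i u) x = -∫ x, conj (pd i u x) * pd i u x := by
    intro i
    have := integral_mul_pd_of_dec (a := 1) (b := 2) hcs (contDiff_pd hus i) (by norm_num) i
      d1.conj (d2 i) (by rw [hc]; exact ((d2 i).mono (by norm_num)).conj) (d3 i)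
    rw [this, hc]
  have hint : ∀ i, Integrable (fun x => conj (u x) * pd i (pd i u) x) := fun i =>
    Dec.integrable (n := 1 + 2) le_rfl
      (hcs.continuous.mul (contDiff_pd (contDiff_pd hus i) i).continuous) (d1.conj.mul (d3 i))
  have h1 : ∀ x, f x * conj (u x)
      = -(conj (u x) * pd 0 (pd 0 u) x + conj (u x) * pd 1 (pd 1 u) x) := by
    intro x
    have := laplacian_pot hf x
    rw [← hu] at this
    rw [← mul_add, this]; ring
  simp only [h1]
  rw [integral_neg, integral_add (hint 0) (hint 1), key, key]
  have hn : ∀ i, 0 ≤ (∫ x, conj (pd i u x) * pd i u x).re := by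
    intro i
    have : ∀ x, conj (pd i u x) * pd i u x = ((‖pd i u x‖ ^ 2 : ℝ) : ℂ) := by
      intro x; rw [mul_comm, Complex.mul_conj, Complex.normSq_eq_norm_sq]
    simp only [this]
    rw [integral_complex_ofReal, Complex.ofReal_re]
    exact integral_nonneg fun x => by positivity
  have a := hn 0
  have b := hn 1
  simp only [Complex.neg_re, Complex.add_re]
  linarith

/-- On a function supported in the ball of radius `a ≥ 1` the energy is bounded below by the
square of its mean: subtracting a multiple of an annular density whose potential is constant on
that ball reduces to mean zero. -/
lemma re_energy_ge {f : Plane → ℂ} (hf : CTest f) {a b : ℝ} (ha : 1 ≤ a) (hab : a < b)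
    (hs : ∀ x, f x ≠ 0 → ‖x‖ ≤ a) :
    -(1 / Real.pi * Real.log b) * ‖∫ x, f x‖ ^ 2 ≤ (∫ x, f x * conj (pot f x)).re := by
  have ha0 : 0 < a := by linarith
  obtain ⟨ρ, hρ⟩ := exists_isRing ha0 hab
  set m := ∫ x, f x with hm
  set R : Plane → ℂ := fun x => (ρ x : ℂ) with hR
  have hRt : CTest R := hρ.test.ofReal
  set l := pot R 0 with hl
  have hmR : CTest (m • R) := hRt.const_mul m
  have hg : CTest (f - m • R) := hf.sub hmR
  have hg0 : ∫ x, (f - m • R) x = 0 := by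
    simp only [Pi.sub_apply, Pi.smul_apply, smul_eq_mul]
    rw [integral_sub hf.integrable (hRt.const_mul m).integrable, integral_const_mul, hρ.integral_ofReal]
    simp [hm]
  have hE := re_energy_nonneg hg hg0
  have hpg : pot (f - m • R) = pot f - m • pot R := by
    have : f - m • R = f + (-m) • R := by rw [neg_smul, sub_eq_add_neg]
    have hmR' : CTest ((-m) • R) := hRt.const_mul (-m)
    rw [this, pot_add hf hmR', pot_smul, neg_smul, sub_eq_add_neg]
  have hcf : Continuous (pot f) := (contDiff_pot hf).continuous
  have hcR : Continuous (pot R) := (contDiff_pot hRt).continuous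
  have hcj := Complex.continuous_conj
  have i1 : Integrable (fun x => f x * conj (pot f x)) := by
    have := (hf.continuous.mul (hcj.comp hcf)).integrable_of_hasCompactSupport hf.2.mul_right
      (μ := volume)
    exact this
  have i2 : Integrable (fun x => f x * conj (pot R x)) := by
    have := (hf.continuous.mul (hcj.comp hcR)).integrable_of_hasCompactSupport hf.2.mul_right
      (μ := volume)
    exact this
  have i3 : Integrable (fun x => R x * conj (pot f x)) := by
    have := (hRt.continuous.mul (hcj.comp hcf)).integrable_of_hasCompactSupport hRt.2.mul_right
      (μ := volume)
    exact this
  have i4 : Integrable (fun x => R x * conj (pot R x)) := by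
    have := (hRt.continuous.mul (hcj.comp hcR)).integrable_of_hasCompactSupport hRt.2.mul_right
      (μ := volume)
    exact this
  have hexp : ∫ x, (f - m • R) x * conj (pot (f - m • R) x)
      = (∫ x, f x * conj (pot f x)) - conj m * (∫ x, f x * conj (pot R x))
        - m * (∫ x, R x * conj (pot f x)) + m * conj m * ∫ x, R x * conj (pot R x) := by
    rw [hpg, ← integral_const_mul, ← integral_const_mul, ← integral_const_mul,
      ← integral_sub i1 (i2.const_mul _), ← integral_sub _ (i3.const_mul _),
      ← integral_add _ (i4.const_mul _)]
    · refine integral_congr_ae (ae_of_all _ fun x => ?_)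
      simp only [Pi.sub_apply, Pi.smul_apply, smul_eq_mul, map_sub, map_mul]
      ring
    · exact (i1.sub (i2.const_mul _)).sub (i3.const_mul _)
    · exact i1.sub (i2.const_mul _)
  have hfl : ∀ x, f x * pot R x = f x * l := by
    intro x
    by_cases hx : f x = 0
    · simp [hx]
    · rw [hρ.pot_of_le (hs x hx)]
  have e2 : ∫ x, f x * conj (pot R x) = m * l := by
    simp only [hR, hρ.conj_pot]
    rw [← hR]
    simp only [hfl]
    rw [integral_mul_const]
  have e3 : ∫ x, R x * conj (pot f x) = conj (m * l) := by
    have h1 : ∀ x, R x * conj (pot f x) = conj (pot f x * R x) := by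
      intro x; simp only [hR, map_mul, Complex.conj_ofReal]; ring
    simp only [h1]
    rw [integral_conj, integral_pot_mul hf.integrable hf.bddSupp hRt.continuous hRt.2]
    simp only [hfl]
    rw [integral_mul_const]
  have hlr : l = ((l.re : ℝ) : ℂ) := (Complex.conj_eq_iff_re.1 (hρ.conj_pot 0)).symm
  -- this is where `a ≥ 1` enters: the potential of the density is non-positive
  have e4 : (∫ x, R x * conj (pot R x)).re ≤ 0 := by
    have h1 : ∀ x, R x * conj (pot R x) = ((ρ x * (pot R x).re : ℝ) : ℂ) := by
      intro x
      have := Complex.conj_eq_iff_re.1 (hρ.conj_pot x)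
      rw [hρ.conj_pot x, Complex.ofReal_mul, this]
    simp only [h1]
    rw [integral_complex_ofReal, Complex.ofReal_re]
    refine integral_nonpos fun x => mul_nonpos_of_nonneg_of_nonpos (hρ.nonneg x) ?_
    refine (hρ.re_pot_le ha0 x).trans ?_
    have := Real.log_nonneg ha
    have : 0 ≤ 1 / (2 * Real.pi) * Real.log a := by positivity
    linarith
  have hll := hρ.le_re_pot_zero ha0
  rw [← hR, ← hl] at hll
  have hmm : m * conj m = ((‖m‖ ^ 2 : ℝ) : ℂ) := by
    rw [Complex.mul_conj, Complex.normSq_eq_norm_sq]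
  rw [hexp, e2, e3, hlr, map_mul, Complex.conj_ofReal,
    show conj m * (m * (l.re : ℂ)) = m * conj m * (l.re : ℂ) by ring,
    show m * (conj m * (l.re : ℂ)) = m * conj m * (l.re : ℂ) by ring, hmm,
    ← Complex.ofReal_mul] at hE
  simp only [Complex.add_re, Complex.sub_re, Complex.re_ofReal_mul, Complex.ofReal_re] at hE
  have h5 : ‖m‖ ^ 2 * (∫ x, R x * conj (pot R x)).re ≤ 0 :=
    mul_nonpos_of_nonneg_of_nonpos (by positivity) e4
  have h6 : 1 / Real.pi * Real.log b = 2 * (1 / (2 * Real.pi) * Real.log b) := by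
    field_simp
  rw [h6]
  nlinarith [sq_nonneg ‖m‖]

section OmegaForms

variable {Ω : Set Plane}

/-- A cutoff function for the unit ball. -/
def chi (x : Plane) : ℂ := (((⟨1, 33 / 32, by norm_num, by norm_num⟩ :
  ContDiffBump (0 : Plane)) x : ℝ) : ℂ)

lemma cTest_chi : CTest chi :=
  IsTest.ofReal ⟨ContDiffBump.contDiff _, ContDiffBump.hasCompactSupport _⟩

lemma chi_eq_one {x : Plane} (hx : ‖x‖ ≤ 1) : chi x = 1 := by
  rw [chi, ContDiffBump.one_of_mem_closedBall]
  · simp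
  · simpa using hx

lemma chi_eq_zero {x : Plane} (hx : 33 / 32 ≤ ‖x‖) : chi x = 0 := by
  rw [chi, ContDiffBump.zero_of_le_dist]
  · simp
  · simpa using hx

/-- Multiplication by the cutoff function on `L²`. -/
def mulChi : LTwo →L[ℂ] LTwo :=
  (ContinuousLinearMap.mul ℂ ℂ).holderL volume ⊤ 2 2
    ((cTest_chi.continuous.memLp_top_of_hasCompactSupport cTest_chi.2 volume).toLp)

lemma coeFn_mulChi (F : LTwo) : mulChi F =ᵐ[volume] fun x => chi x * F x := by
  have h1 := (ContinuousLinearMap.mul ℂ ℂ).coeFn_holder (r := 2)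
    ((cTest_chi.continuous.memLp_top_of_hasCompactSupport cTest_chi.2 volume).toLp) F
  have h2 := MemLp.coeFn_toLp
    (cTest_chi.continuous.memLp_top_of_hasCompactSupport cTest_chi.2 volume)
  filter_upwards [h1, h2] with x h1 h2
  change (ContinuousLinearMap.mul ℂ ℂ).holder 2 _ F x = _
  rw [h1, h2]
  rfl

lemma conj_cutK_ker_conv {F : Plane → ℂ} (hs : ∀ x, F x ≠ 0 → ‖x‖ ≤ 33 / 32) (x : Plane) :
    conj (convK (cutK ker (2 + 2)) F x) * F x = F x * conj (pot F x) := by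
  by_cases hx : F x = 0
  · simp [hx]
  · have h : ∀ y, (2 : ℝ) < ‖y‖ → F y = 0 := fun y hy => by
      by_contra hF
      have := hs y hF
      linarith
    rw [convK_cutK h (by linarith [hs x hx]), mul_comm]
    rfl

/-- The constant in the lower bound for the logarithmic energy on the unit disc. -/
def kappa : ℝ := 1 / Real.pi * Real.log (17 / 16)

lemma kappa_nonneg : 0 ≤ kappa :=
  mul_nonneg (by positivity) (Real.log_nonneg (by norm_num))

lemma re_inner_conv_ge (F : LTwo) :
    0 ≤ (inner ℂ (convL (cutK ker (2 + 2)) (integrable_cutK locallyIntegrable_ker _) (mulChi F))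
        (mulChi F)).re
      + kappa * ‖inner ℂ (toLTwo ⟨fun x => cutoff ((1 / 2 : ℝ) • x),
          cTest_cutoff.comp_smul (by norm_num)⟩) (mulChi F)‖ ^ 2 := by
  refine denseRange_toLTwo.induction_on F ?_ ?_
  · exact isClosed_le continuous_const (by fun_prop)
  · intro φ
    set f : Plane → ℂ := chi * φ.1 with hf
    have hft : CTest f := CTest.mul_left cTest_chi.1 φ.2
    have hM : mulChi (toLTwo φ) =ᵐ[volume] f := by
      filter_upwards [coeFn_mulChi (toLTwo φ), coeFn_toLTwo φ] with x h1 h2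
      rw [h1, h2]; rfl
    have hs : ∀ x, f x ≠ 0 → ‖x‖ ≤ 33 / 32 := by
      intro x hx
      by_contra hcon
      exact hx (by simp [hf, chi_eq_zero (le_of_not_ge hcon)])
    have h1 : inner ℂ (convL (cutK ker (2 + 2)) (integrable_cutK locallyIntegrable_ker _)
        (mulChi (toLTwo φ))) (mulChi (toLTwo φ)) = ∫ x, f x * conj (pot f x) := by
      rw [inner_eq_of_ae (coeFn_convL _ _) hM, convK_congr _ hM]
      exact integral_congr_ae (ae_of_all _ (conj_cutK_ker_conv hs))
    have h2 : inner ℂ (toLTwo ⟨fun x => cutoff ((1 / 2 : ℝ) • x),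
          cTest_cutoff.comp_smul (by norm_num)⟩) (mulChi (toLTwo φ)) = ∫ x, f x := by
      rw [inner_eq_of_ae (coeFn_toLTwo _) hM]
      refine integral_congr_ae (ae_of_all _ fun x => ?_)
      by_cases hx : f x = 0
      · simp [hx]
      · simp only
        rw [cutoff_eq_one]
        · simp
        · rw [norm_smul]
          have := hs x hx
          norm_num
          linarith
    have h3 := re_energy_ge hft (a := 33 / 32) (b := 17 / 16) (by norm_num) (by norm_num) hs
    rw [h1, h2, kappa]
    linarith

/-- The function `1` in `L²(Ω)`. -/
def oneL (hb : Ω ⊆ Metric.ball 0 1) : LOm Ω :=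
  have := finite_restrict hb
  (memLp_const (1 : ℂ)).toLp

lemma coeFn_oneL (hb : Ω ⊆ Metric.ball 0 1) : oneL hb =ᵐ[volume.restrict Ω] fun _ => (1 : ℂ) :=
  have := finite_restrict hb
  MemLp.coeFn_toLp (memLp_const (1 : ℂ))

lemma inner_eq_of_ae' {F G : LOm Ω} {f g : Plane → ℂ} (hF : F =ᵐ[volume.restrict Ω] f)
    (hG : G =ᵐ[volume.restrict Ω] g) : inner ℂ F G = ∫ x in Ω, conj (f x) * g x := by
  rw [L2.inner_def]
  refine integral_congr_ae ?_
  filter_upwards [hF, hG] with x h1 h2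
  rw [h1, h2, RCLike.inner_apply, mul_comm]

lemma inner_oneL (hb : Ω ⊆ Metric.ball 0 1) (f : LOm Ω) : inner ℂ (oneL hb) f = ∫ x in Ω, f x := by
  rw [inner_eq_of_ae' (coeFn_oneL hb) EventuallyEq.rfl]
  simp

lemma re_inner_opK_ker_ge (hΩ : MeasurableSet Ω) (hb : Ω ⊆ Metric.ball 0 1) (f : LOm Ω) :
    0 ≤ (inner ℂ (opK hΩ ker locallyIntegrable_ker f) f).re
      + kappa * ‖inner ℂ (oneL hb) f‖ ^ 2 := by
  have hE := re_inner_conv_ge (extL hΩ f)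
  have hs : ∀ x, Ω.indicator f x ≠ 0 → ‖x‖ ≤ 1 := by
    intro x hx
    by_contra hcon
    exact hx (ext_support hb f x (lt_of_not_ge hcon))
  have hM : mulChi (extL hΩ f) =ᵐ[volume] Ω.indicator f := by
    filter_upwards [coeFn_mulChi (extL hΩ f), coeFn_extL hΩ f] with x h1 h2
    rw [h1, h2]
    by_cases hx : Ω.indicator f x = 0
    · simp [hx]
    · rw [chi_eq_one (hs x hx), one_mul]
  rw [inner_eq_of_ae (coeFn_convL _ _) hM, convK_congr _ hM,
    inner_eq_of_ae (coeFn_toLTwo _) hM] at hE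
  rw [inner_oneL, inner_eq_of_ae' (coeFn_opK hΩ hb _ f) EventuallyEq.rfl]
  have h1 : ∫ x in Ω, conj (convK ker (Ω.indicator f) x) * f x
      = ∫ x, conj (convK (cutK ker (2 + 2)) (Ω.indicator f) x) * Ω.indicator f x := by
    rw [← integral_indicator hΩ]
    refine integral_congr_ae (ae_of_all _ fun x => ?_)
    simp only
    rw [conj_cutK_ker_conv (fun x hx => (hs x hx).trans (by norm_num))]
    by_cases hx : x ∈ Ω <;> simp [hx, pot, mul_comm]
  have h2 : ∫ x in Ω, f x = ∫ x, conj (cutoff ((1 / 2 : ℝ) • x)) * Ω.indicator f x := by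
    rw [← integral_indicator hΩ]
    refine integral_congr_ae (ae_of_all _ fun x => ?_)
    by_cases hx : Ω.indicator f x = 0
    · simp [hx]
    · simp only
      rw [cutoff_eq_one, map_one, one_mul]
      rw [norm_smul]
      have := hs x hx
      norm_num
      linarith
  rw [h1, h2]
  exact hE

/-! ### The forms on `L²(Ω; ℂ²)` -/

/-- The map `f ↦ (γ^{-1/2} f₁, γ^{-1/2} f₂, ∂₁ σ, ∂₂ σ)` with `σ = ∂₂ A f₁ + ∂₁ A f₂`, which
represents `𝔟` as a pull-back of the inner product. -/
def jmap (γ : ℝ) (hΩ : MeasurableSet Ω) : L2 Ω →L[ℂ] PiLp 2 (fun _ : Fin 4 => LTwo) :=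
  (PiLp.continuousLinearEquiv 2 ℂ (fun _ : Fin 4 => LTwo)).symm.toContinuousLinearMap.comp
    (ContinuousLinearMap.pi
      ![((Real.sqrt γ)⁻¹ : ℂ) • (extL hΩ).comp (ContinuousLinearMap.proj 0),
        ((Real.sqrt γ)⁻¹ : ℂ) • (extL hΩ).comp (ContinuousLinearMap.proj 1),
        (hess 1 0).comp ((extL hΩ).comp (ContinuousLinearMap.proj 0))
          + (hess 0 0).comp ((extL hΩ).comp (ContinuousLinearMap.proj 1)),
        (hess 1 1).comp ((extL hΩ).comp (ContinuousLinearMap.proj 0))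
          + (hess 0 1).comp ((extL hΩ).comp (ContinuousLinearMap.proj 1))])

lemma inner_jmap {γ : ℝ} (hγ : 0 < γ) (hΩ : MeasurableSet Ω) (f h : L2 Ω) :
    inner ℂ (jmap γ hΩ h) (jmap γ hΩ f)
      = (γ : ℂ)⁻¹ * (inner ℂ (extL hΩ (h 0)) (extL hΩ (f 0))
          + inner ℂ (extL hΩ (h 1)) (extL hΩ (f 1)))
        + (inner ℂ (shear 0 fun i => extL hΩ (h i)) (shear 0 fun i => extL hΩ (f i))
          + inner ℂ (shear 1 fun i => extL hΩ (h i)) (shear 1 fun i => extL hΩ (f i))) := by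
  have hs : ((Real.sqrt γ : ℂ))⁻¹ * ((Real.sqrt γ : ℂ))⁻¹ = (γ : ℂ)⁻¹ := by
    rw [← mul_inv, ← Complex.ofReal_mul, Real.mul_self_sqrt hγ.le]
  simp [jmap, PiLp.inner_apply, Fin.sum_univ_four, shear, inner_smul_left, inner_smul_right,
    ← mul_assoc, hs]
  ring

lemma norm_le_jmap {γ : ℝ} (hγ : 0 < γ) (hΩ : MeasurableSet Ω) (f : L2 Ω) :
    ‖f‖ ≤ Real.sqrt γ * ‖jmap γ hΩ f‖ := by
  have hs := Real.sqrt_pos.2 hγ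
  refine (pi_norm_le_iff_of_nonneg (by positivity)).2 fun i => ?_
  have key : ∀ j : Fin 4, ‖jmap γ hΩ f j‖ ≤ ‖jmap γ hΩ f‖ := fun j => PiLp.norm_apply_le _ j
  rw [← norm_extL hΩ, ← inv_mul_le_iff₀ hs]
  fin_cases i
  · refine le_trans (le_of_eq ?_) (key 0)
    simp [jmap, norm_smul, abs_of_pos hs]
  · refine le_trans (le_of_eq ?_) (key 1)
    simp [jmap, norm_smul, abs_of_pos hs]

lemma integral_mul_conj_ext (hΩ : MeasurableSet Ω) (a b : LTwo) {u v : Plane → ℂ}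
    (hu : u =ᵐ[volume] a) (hv : v =ᵐ[volume] b) (h : L2 Ω) :
    ∫ x in Ω, (u x * conj (fn h 0 x) + v x * conj (fn h 1 x))
      = inner ℂ (extL hΩ (h 0)) a + inner ℂ (extL hΩ (h 1)) b := by
  rw [L2.inner_def, L2.inner_def,
    ← integral_add (L2.integrable_inner _ _) (L2.integrable_inner _ _), ← integral_indicator hΩ]
  refine integral_congr_ae ?_
  filter_upwards [coeFn_extL hΩ (h 0), coeFn_extL hΩ (h 1), hu, hv] with x h0 h1 hu hv
  simp only [RCLike.inner_apply]
  rw [h0, h1]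
  by_cases hx : x ∈ Ω <;> simp [hx, fn, hu, hv]

lemma formB_eq {γ : ℝ} (hγ : 0 < γ) (hΩ : MeasurableSet Ω) (hb : Ω ⊆ Metric.ball 0 1)
    (f h : L2 Ω) : formB γ Ω (fn f) (fn h) = inner ℂ (jmap γ hΩ h) (jmap γ hΩ f) := by
  rw [inner_jmap hγ hΩ, formB, ← inner_hess_eq_shear, sub_eq_add_neg]
  congr 2
  · have := integral_mul_conj_ext hΩ (extL hΩ (f 0)) (extL hΩ (f 1)) EventuallyEq.rfl
      EventuallyEq.rfl h
    rw [← this]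
    refine integral_congr_ae ?_
    filter_upwards [ae_restrict_of_ae (coeFn_extL hΩ (f 0)),
      ae_restrict_of_ae (coeFn_extL hΩ (f 1)), ae_restrict_mem hΩ] with x h0 h1 hx
    rw [h0, h1]
    simp [hx, fn]
  · refine integral_mul_conj_ext hΩ _ _ ?_ ?_ h
    · filter_upwards [weakPartial_weakPartial_A hΩ hb (f 0) 1 1,
        weakPartial_weakPartial_A hΩ hb (f 1) 1 0,
        Lp.coeFn_add (hess 1 1 (extL hΩ (f 0))) (hess 1 0 (extL hΩ (f 1)))] with x h0 h1 h2
      rw [h2, Pi.add_apply, ← h0, ← h1]; rfl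
    · filter_upwards [weakPartial_weakPartial_A hΩ hb (f 0) 0 1,
        weakPartial_weakPartial_A hΩ hb (f 1) 0 0,
        Lp.coeFn_add (hess 0 1 (extL hΩ (f 0))) (hess 0 0 (extL hΩ (f 1)))] with x h0 h1 h2
      rw [h2, Pi.add_apply, ← h0, ← h1]; rfl

lemma formB_congr {γ : ℝ} {f f' h h' : Fin 2 → Plane → ℂ}
    (hf : ∀ i, f i =ᵐ[volume.restrict Ω] f' i) (hh : ∀ i, h i =ᵐ[volume.restrict Ω] h' i) :
    formB γ Ω f h = formB γ Ω f' h' := by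
  simp only [formB, A_congr (hf 0), A_congr (hf 1)]
  congr 1
  · congr 1
    refine integral_congr_ae ?_
    filter_upwards [hf 0, hf 1, hh 0, hh 1] with x h1 h2 h3 h4
    rw [h1, h2, h3, h4]
  · refine integral_congr_ae ?_
    filter_upwards [hh 0, hh 1] with x h3 h4
    rw [h3, h4]

lemma quadC1_congr {f f' : Fin 2 → Plane → ℂ} (hf : ∀ i, f i =ᵐ[volume.restrict Ω] f' i) :
    quadC1 Ω f = quadC1 Ω f' := by
  simp only [quadC1, formC1, integral_congr_ae (hf 0), integral_congr_ae (hf 1)]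

lemma quadC1_eq (hb : Ω ⊆ Metric.ball 0 1) (f : L2 Ω) :
    quadC1 Ω (fn f) = ‖inner ℂ (oneL hb) (f 0)‖ ^ 2 + ‖inner ℂ (oneL hb) (f 1)‖ ^ 2 := by
  simp only [quadC1, formC1, fn, ← inner_oneL hb, Complex.mul_conj, Complex.normSq_eq_norm_sq,
    ← Complex.ofReal_add, Complex.ofReal_re]

lemma quadB_eq {γ : ℝ} (hγ : 0 < γ) (hΩ : MeasurableSet Ω) (hb : Ω ⊆ Metric.ball 0 1)
    (f : L2 Ω) : quadB γ Ω (fn f) = ‖jmap γ hΩ f‖ ^ 2 := by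
  rw [quadB, formB_eq hγ hΩ hb, inner_self_eq_norm_sq_to_K]
  norm_cast

/-- The operator `f ↦ ∂₂ A f₁ + ∂₁ A f₂` on `Ω`. -/
def gradL (hΩ : MeasurableSet Ω) : L2 Ω →ₗ[ℂ] LOm Ω :=
  (opK hΩ (kerD 1) (locallyIntegrable_kerD 1)).toLinearMap ∘ₗ LinearMap.proj 0
    + (opK hΩ (kerD 0) (locallyIntegrable_kerD 0)).toLinearMap ∘ₗ LinearMap.proj 1

lemma quadC2_eq {γ : ℝ} (hΩ : MeasurableSet Ω) (hb : Ω ⊆ Metric.ball 0 1) (f : L2 Ω) :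
    quadC2 γ Ω (fn f) = (inner ℂ (opK hΩ ker locallyIntegrable_ker (f 0)) (f 0)).re
      + (inner ℂ (opK hΩ ker locallyIntegrable_ker (f 1)) (f 1)).re
      + γ * ‖gradL hΩ f‖ ^ 2 := by
  have hA : ∀ i, A Ω (f i) =ᵐ[volume.restrict Ω] opK hΩ ker locallyIntegrable_ker (f i) :=
    fun i => EventuallyEq.trans (ae_restrict_of_ae (A_ae_eq hΩ hb (Lp.memLp (f i))))
      (coeFn_opK hΩ hb _ _).symm
  have hD : ∀ i j, weakPartial j (A Ω (f i)) =ᵐ[volume.restrict Ω]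
      opK hΩ (kerD j) (locallyIntegrable_kerD j) (f i) :=
    fun i j => EventuallyEq.trans (ae_restrict_of_ae (weakPartial_A hΩ hb (f i) j))
      (coeFn_opK hΩ hb _ _).symm
  have hG : gradL hΩ f =ᵐ[volume.restrict Ω]
      fun x => weakPartial 1 (A Ω (f 0)) x + weakPartial 0 (A Ω (f 1)) x := by
    refine (Lp.coeFn_add _ _).trans ?_
    filter_upwards [hD 0 1, hD 1 0] with x h1 h2
    rw [h1, h2]
    rfl
  have h1 : ∫ x in Ω, (fn f 0 x * conj (A Ω (fn f 0) x) + fn f 1 x * conj (A Ω (fn f 1) x))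
      = inner ℂ (opK hΩ ker locallyIntegrable_ker (f 0)) (f 0)
        + inner ℂ (opK hΩ ker locallyIntegrable_ker (f 1)) (f 1) := by
    rw [L2.inner_def, L2.inner_def,
      ← integral_add (L2.integrable_inner _ _) (L2.integrable_inner _ _)]
    refine integral_congr_ae ?_
    filter_upwards [hA 0, hA 1] with x h0 h1
    simp only [fn]
    rw [h0, h1]
    rfl
  have h2 : ∫ x in Ω, (weakPartial 1 (A Ω (fn f 0)) x + weakPartial 0 (A Ω (fn f 1)) x)
        * conj (weakPartial 1 (A Ω (fn f 0)) x + weakPartial 0 (A Ω (fn f 1)) x)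
      = ((‖gradL hΩ f‖ ^ 2 : ℝ) : ℂ) := by
    have h3 := inner_self_eq_norm_sq_to_K (𝕜 := ℂ) (gradL hΩ f)
    rw [inner_eq_of_ae' hG hG] at h3
    rw [Complex.ofReal_pow]
    refine Eq.trans ?_ h3
    refine integral_congr_ae (ae_of_all _ fun x => ?_)
    exact mul_comm _ _
  rw [quadC2, formC2, h1, h2, ← Complex.ofReal_mul, Complex.add_re, Complex.add_re,
    Complex.ofReal_re]

/-- `𝔠₂ + κ 𝔠₁` is positive semidefinite. -/
lemma quadC2_add_kappa_nonneg {γ : ℝ} (hγ : 0 < γ) (hΩ : MeasurableSet Ω)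
    (hb : Ω ⊆ Metric.ball 0 1) (f : L2 Ω) :
    0 ≤ quadC2 γ Ω (fn f) + kappa * quadC1 Ω (fn f) := by
  rw [quadC2_eq hΩ hb, quadC1_eq hb]
  have h0 := re_inner_opK_ker_ge hΩ hb (f 0)
  have h1 := re_inner_opK_ker_ge hΩ hb (f 1)
  have h2 : 0 ≤ γ * ‖gradL hΩ f‖ ^ 2 := by positivity
  linarith

lemma exists_polar_of_inner {X H : Type*} [AddCommGroup X] [Module ℂ X] [NormedAddCommGroup H]
    [InnerProductSpace ℂ H] (P Q : X →ₗ[ℂ] H) (g u : X) :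
    ∃ p : ℝ, ∀ t : ℝ, (inner ℂ (P ((t : ℂ) • g + u)) (Q ((t : ℂ) • g + u))).re
      = t ^ 2 * (inner ℂ (P g) (Q g)).re + t * p + (inner ℂ (P u) (Q u)).re := by
  refine ⟨(inner ℂ (P g) (Q u)).re + (inner ℂ (P u) (Q g)).re, fun t => ?_⟩
  simp only [map_add, map_smul, inner_add_left, inner_add_right, inner_smul_left,
    inner_smul_right, Complex.conj_ofReal, Complex.add_re, Complex.re_ofReal_mul]
  ring

/-- The form `𝔠₂ + κ 𝔠₁` is quadratic along real lines. -/
lemma exists_polar_quadC {γ : ℝ} (hΩ : MeasurableSet Ω) (hb : Ω ⊆ Metric.ball 0 1) (κ : ℝ)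
    (g u : L2 Ω) : ∃ p : ℝ, ∀ t : ℝ,
      quadC2 γ Ω (fn ((t : ℂ) • g + u)) + κ * quadC1 Ω (fn ((t : ℂ) • g + u))
        = t ^ 2 * (quadC2 γ Ω (fn g) + κ * quadC1 Ω (fn g)) + t * p
          + (quadC2 γ Ω (fn u) + κ * quadC1 Ω (fn u)) := by
  let pr : Fin 2 → L2 Ω →ₗ[ℂ] LOm Ω := fun i => LinearMap.proj i
  let K := (opK hΩ ker locallyIntegrable_ker).toLinearMap
  let m := (innerSL ℂ (oneL hb)).toLinearMap
  obtain ⟨p0, h0⟩ := exists_polar_of_inner (K ∘ₗ pr 0) (pr 0) g u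
  obtain ⟨p1, h1⟩ := exists_polar_of_inner (K ∘ₗ pr 1) (pr 1) g u
  obtain ⟨p2, h2⟩ := exists_polar_of_inner (gradL hΩ) (gradL hΩ) g u
  obtain ⟨p3, h3⟩ := exists_polar_of_inner (m ∘ₗ pr 0) (m ∘ₗ pr 0) g u
  obtain ⟨p4, h4⟩ := exists_polar_of_inner (m ∘ₗ pr 1) (m ∘ₗ pr 1) g u
  have hn : ∀ {H : Type} [NormedAddCommGroup H] [InnerProductSpace ℂ H] (w : H),
      (inner ℂ w w).re = ‖w‖ ^ 2 := by
    intro H _ _ w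
    rw [inner_self_eq_norm_sq_to_K]; norm_cast
  refine ⟨p0 + p1 + γ * p2 + κ * (p3 + p4), fun t => ?_⟩
  have h0 := h0 t
  have h1 := h1 t
  have h2 := h2 t
  have h3 := h3 t
  have h4 := h4 t
  simp only [hn] at h2 h3 h4
  simp only [quadC2_eq hΩ hb, quadC1_eq hb]
  simp only [LinearMap.comp_apply, pr, K, m, LinearMap.proj_apply,
    ContinuousLinearMap.coe_coe, innerSL_apply_apply] at h0 h1 h3 h4
  rw [h0, h1, h2, h3, h4]
  ring

end OmegaForms

/-! ### Comparison of min-max values -/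

lemma abs_iSup_sub_iSup_le {ι : Type*} {r₁ r₂ : ι → ℝ} {ε C : ℝ} (hε : 0 ≤ ε) (hC : 0 ≤ C)
    (h₁ : ∀ i, 0 ≤ r₁ i) (h₂ : ∀ i, 0 ≤ r₂ i) (h : ∀ i, |r₁ i - r₂ i| ≤ ε * r₁ i)
    (h' : ∀ i, r₁ i ≤ C * r₂ i) : |(⨆ i, r₁ i) - ⨆ i, r₂ i| ≤ ε * ⨆ i, r₁ i := by
  by_cases hb : BddAbove (range r₁)
  · have hub : ∀ i, r₂ i ≤ (1 + ε) * ⨆ i, r₁ i := fun i => by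
      have a := (abs_le.1 (h i)).1
      have b := mul_le_mul_of_nonneg_left (le_ciSup hb i) (by linarith : 0 ≤ 1 + ε)
      linarith
    have hb2 : BddAbove (range r₂) := ⟨_, by rintro _ ⟨i, rfl⟩; exact hub i⟩
    have hs1 : 0 ≤ ⨆ i, r₁ i := Real.iSup_nonneg h₁
    have hs2 : 0 ≤ ⨆ i, r₂ i := Real.iSup_nonneg h₂
    rw [abs_le]
    constructor
    · have := Real.iSup_le hub (by positivity)
      linarith
    · have : ⨆ i, r₁ i ≤ (⨆ i, r₂ i) + ε * ⨆ i, r₁ i := by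
        refine Real.iSup_le (fun i => ?_) (by positivity)
        have a := (abs_le.1 (h i)).2
        have b := mul_le_mul_of_nonneg_left (le_ciSup hb i) hε
        have c := le_ciSup hb2 i
        linarith
      linarith
  · have hb2 : ¬ BddAbove (range r₂) := by
      rintro ⟨M, hM⟩
      refine hb ⟨C * M, ?_⟩
      rintro _ ⟨i, rfl⟩
      exact (h' i).trans (mul_le_mul_of_nonneg_left (hM ⟨i, rfl⟩) hC)
    rw [Real.iSup_of_not_bddAbove hb, Real.iSup_of_not_bddAbove hb2]
    simp

lemma abs_iInf_sub_iInf_le {ι : Type*} {a b : ι → ℝ} {ε : ℝ} (hε : 0 ≤ ε)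
    (ha : ∀ i, 0 ≤ a i) (hb : ∀ i, 0 ≤ b i) (h : ∀ i, |a i - b i| ≤ ε * a i) :
    |(⨅ i, a i) - ⨅ i, b i| ≤ ε * ⨅ i, a i := by
  rcases isEmpty_or_nonempty ι with hι | hι
  · simp [Real.iInf_of_isEmpty]
  have hba : BddBelow (range a) := ⟨0, by rintro _ ⟨i, rfl⟩; exact ha i⟩
  have hbb : BddBelow (range b) := ⟨0, by rintro _ ⟨i, rfl⟩; exact hb i⟩
  have hia : 0 ≤ ⨅ i, a i := Real.iInf_nonneg ha
  have hib : 0 ≤ ⨅ i, b i := Real.iInf_nonneg hb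
  rw [abs_le]
  constructor
  · have h1 : (⨅ i, b i) / (1 + ε) ≤ ⨅ i, a i := by
      refine le_ciInf fun i => ?_
      rw [div_le_iff₀ (by linarith)]
      have := (abs_le.1 (h i)).1
      have := ciInf_le hbb i
      linarith
    rw [div_le_iff₀ (by linarith)] at h1
    linarith
  · rcases le_or_gt 1 ε with h1 | h1
    · nlinarith
    · have : (1 - ε) * (⨅ i, a i) ≤ ⨅ i, b i := by
        refine le_ciInf fun i => ?_
        have h2 := (abs_le.1 (h i)).2
        have h3 := mul_le_mul_of_nonneg_left (ciInf_le hba i) (by linarith : 0 ≤ 1 - ε)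
        linarith
      linarith

lemma div_compare {n d₁ d₂ ε C : ℝ} (hn : 0 ≤ n) (h₁ : 0 ≤ d₁) (h₂ : 0 ≤ d₂)
    (h : |d₁ - d₂| ≤ ε * d₂) (h' : d₂ ≤ C * d₁) :
    |n / d₁ - n / d₂| ≤ ε * (n / d₁) ∧ n / d₁ ≤ C * (n / d₂) := by
  rcases h₂.eq_or_lt with h0 | h0
  · have : d₁ = 0 := by
      rw [← h0] at h
      simpa using h
    rw [this, ← h0]; simp
  · have h10 : 0 < d₁ := by
      rcases h₁.eq_or_lt with h1 | h1
      · rw [← h1] at h'; simp at h'; linarith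
      · exact h1
    constructor
    · have e1 : n / d₁ - n / d₂ = n / d₁ * ((d₂ - d₁) / d₂) := by field_simp
      rw [e1, abs_mul, abs_of_nonneg (by positivity : 0 ≤ n / d₁), abs_div, abs_of_pos h0,
        mul_comm, abs_sub_comm]
      refine mul_le_mul_of_nonneg_right ?_ (by positivity)
      rw [div_le_iff₀ h0]
      exact h
    · rw [div_le_iff₀ h10, mul_assoc, div_mul_eq_mul_div, mul_div_assoc', le_div_iff₀ h0]
      nlinarith

lemma abs_minMax_sub_le {X : Type*} [AddCommGroup X] [Module ℂ X] (S : Set X)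
    {num d₁ d₂ : X → ℝ} {ε C : ℝ} (hε : 0 ≤ ε) (hC : 0 ≤ C) (hn : ∀ f, 0 ≤ num f)
    (h₁ : ∀ f, 0 ≤ d₁ f) (h₂ : ∀ f, 0 ≤ d₂ f) (h : ∀ f, |d₁ f - d₂ f| ≤ ε * d₂ f)
    (h' : ∀ f, d₂ f ≤ C * d₁ f) (n : ℕ) :
    |minMax S num d₁ n - minMax S num d₂ n| ≤ ε * minMax S num d₁ n := by
  have hd := fun f => div_compare (hn f) (h₁ f) (h₂ f) (h f) (h' f)
  refine abs_iInf_sub_iInf_le hε (fun V => Real.iSup_nonneg fun f => div_nonneg (hn _) (h₁ _))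
    (fun V => Real.iSup_nonneg fun f => div_nonneg (hn _) (h₂ _)) fun V => ?_
  exact abs_iSup_sub_iSup_le hε hC (fun f => div_nonneg (hn _) (h₁ _))
    (fun f => div_nonneg (hn _) (h₂ _)) (fun f => (hd f.1).1) (fun f => (hd f.1).2)

/-- Min-max values are transported by a linear bijection onto the admissible set. -/
lemma minMax_range {X Y : Type*} [AddCommGroup X] [Module ℂ X] [AddCommGroup Y] [Module ℂ Y]
    (Ψ : X →ₗ[ℂ] Y) (hΨ : Function.Injective Ψ) {S : Set Y} (hS : range Ψ = S)
    (num den : Y → ℝ) (n : ℕ) :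
    minMax S num den n = minMax univ (num ∘ Ψ) (den ∘ Ψ) n := by
  symm
  refine Function.Surjective.iInf_congr
    (fun V => ⟨V.1.map Ψ, ?_, ?_⟩) ?_ ?_
  · rw [← hS]
    rintro _ ⟨x, -, rfl⟩
    exact ⟨x, rfl⟩
  · exact (LinearEquiv.finrank_eq (Submodule.equivMapOfInjective Ψ hΨ V.1)).symm.trans V.2.2
  · rintro ⟨W, hW, hWn⟩
    have hmap : (W.comap Ψ).map Ψ = W := by
      refine Submodule.map_comap_eq_of_le fun y hy => ?_
      have := hW hy
      rw [← hS] at this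
      exact this
    refine ⟨⟨W.comap Ψ, subset_univ _, ?_⟩, Subtype.ext hmap⟩
    rw [← hWn]
    conv_rhs => rw [← hmap]
    exact LinearEquiv.finrank_eq (Submodule.equivMapOfInjective Ψ hΨ _)
  · intro V
    symm
    refine Function.Surjective.iSup_congr
      (fun f => ⟨Ψ f.1, ⟨f.1, f.2.1, rfl⟩, fun h => f.2.2 (hΨ (h.trans (map_zero Ψ).symm))⟩)
      ?_ (fun f => rfl)
    rintro ⟨_, ⟨x, hx, rfl⟩, hne⟩
    exact ⟨⟨x, hx, fun h => hne (by rw [h, map_zero])⟩, rfl⟩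

/-- The elementary estimate behind the comparison of the denominators. In the application `sg`,
`su`, `sf` are the values of `𝔠₂ + κ 𝔠₁` at `g`, `u`, `g + u`, and `p = 𝔠₁[u]`. -/
lemma denominators_compare {L ν κ c₀ p sg su sf X K : ℝ} (hL : 1 ≤ L) (hc₀ : 0 < c₀)
    (hν : κ + c₀ * L ≤ ν) (hκ : 0 ≤ κ) (hK : 0 ≤ K) (hp : 0 ≤ p) (hsg : 0 ≤ sg) (hsu : 0 ≤ su)
    (hsf : 0 ≤ sf) (hup : su ≤ K * p) (hX : ∀ t : ℝ, 0 ≤ t ^ 2 * sg + t * X + su)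
    (hf : sf = sg + X + su) :
    0 ≤ ν * p + (sf - κ * p) ∧ 0 ≤ ν * p + sg ∧
    |(ν * p + (sf - κ * p)) - (ν * p + sg)|
      ≤ (1 + K / c₀ + (K + κ) / c₀) * L ^ (-(1 / 2) : ℝ) * (ν * p + sg) ∧
    ν * p + sg ≤ (3 + κ / c₀ + 2 * K / c₀) * (ν * p + (sf - κ * p)) := by
  have hL0 : 0 < L := by linarith
  set τ := L ^ (-(1 / 2) : ℝ) with hτ
  have hτ0 : 0 < τ := Real.rpow_pos_of_pos hL0 _
  have hτ1 : τ ≤ 1 := Real.rpow_le_one_of_one_le_of_nonpos hL (by norm_num)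
  have hτL : τ ^ 2 * L = 1 := by
    rw [hτ, ← Real.rpow_natCast, ← Real.rpow_mul hL0.le]
    norm_num
    rw [Real.rpow_neg_one]; field_simp
  have hcL : c₀ ≤ c₀ * L := by nlinarith
  have hνκ : c₀ * p ≤ (ν - κ) * p := mul_le_mul_of_nonneg_right (by linarith) hp
  have hνp : c₀ * L * p ≤ ν * p := mul_le_mul_of_nonneg_right (by linarith) hp
  have hd2 : 0 ≤ ν * p + sg := by
    have : 0 ≤ c₀ * L * p := by positivity
    linarith
  have hc0p : 0 ≤ c₀ * p := by positivity
  refine ⟨by linarith, hd2, ?_, ?_⟩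
  · have hpd : p ≤ τ ^ 2 / c₀ * (ν * p + sg) := by
      have : p = τ ^ 2 / c₀ * (c₀ * L * p) := by
        field_simp
        linear_combination -p * hτL
      calc p = τ ^ 2 / c₀ * (c₀ * L * p) := this
        _ ≤ _ := by gcongr; linarith
    have hpd1 : p ≤ τ / c₀ * (ν * p + sg) := hpd.trans (by gcongr; nlinarith)
    have hsgd : sg ≤ ν * p + sg := by
      have : 0 ≤ c₀ * L * p := by positivity
      linarith
    set d := ν * p + sg
    have hsud : su / τ ≤ K / c₀ * τ * d := by
      rw [div_le_iff₀ hτ0]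
      calc su ≤ K * (τ ^ 2 / c₀ * d) := hup.trans (by gcongr)
        _ = _ := by ring
    have hsud1 : su ≤ K / c₀ * τ * d := hup.trans (by
      calc K * p ≤ K * (τ / c₀ * d) := by gcongr
        _ = _ := by ring)
    have hkpd : κ * p ≤ κ / c₀ * τ * d := by
      calc κ * p ≤ κ * (τ / c₀ * d) := by gcongr
        _ = _ := by ring
    -- the weights of `sg` and `su` balance at `t = ∓τ`, since `su ≤ K p = O(τ² d)`
    have hXu : X ≤ τ * sg + su / τ := by
      have := hX (-τ)
      rw [show τ * sg + su / τ = (τ ^ 2 * sg + su) / τ by field_simp, le_div_iff₀ hτ0]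
      nlinarith
    have hXl : -(τ * sg + su / τ) ≤ X := by
      have := hX τ
      rw [neg_le, show τ * sg + su / τ = (τ ^ 2 * sg + su) / τ by field_simp, le_div_iff₀ hτ0]
      nlinarith
    have hτsg : τ * sg ≤ τ * d := by gcongr
    have hkp : 0 ≤ κ * p := by positivity
    rw [add_div]
    have e : ν * p + (sf - κ * p) - d = X + su - κ * p := by
      simp only [d]; rw [hf]; ring
    rw [e, abs_le]
    constructor <;> linarith
  -- `t = 1/2` gives `sg ≤ 2 sf + 2 su`, so that the denominators are comparable
  · have hXh := hX (1 / 2)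
    have hpd : p ≤ 1 / c₀ * (ν * p + (sf - κ * p)) := by
      rw [one_div, ← div_eq_inv_mul, le_div_iff₀ hc₀]
      linarith
    have hd1 : 0 ≤ ν * p + (sf - κ * p) := by linarith
    set d := ν * p + (sf - κ * p)
    have h1 : κ * p ≤ κ / c₀ * d := by
      calc κ * p ≤ κ * (1 / c₀ * d) := by gcongr
        _ = _ := by ring
    have h2 : K * p ≤ K / c₀ * d := by
      calc K * p ≤ K * (1 / c₀ * d) := by gcongr
        _ = _ := by ring
    have h3 : ν * p + 2 * sf ≤ 3 * d + κ * p := by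
      simp only [d]; nlinarith
    rw [mul_div_assoc]
    nlinarith

/-! ### The operator `N` -/

section OperatorN

variable {Ω : Set Plane}

/-- The subspace `L²₀(Ω; ℂ²)`. -/
def meanZero (hb : Ω ⊆ Metric.ball 0 1) : Submodule ℂ (L2 Ω) where
  carrier := {f | ∀ i, inner ℂ (oneL hb) (f i) = 0}
  add_mem' h h' i := by rw [Pi.add_apply, inner_add_right, h i, h' i, add_zero]
  zero_mem' i := by simp
  smul_mem' c f h i := by rw [Pi.smul_apply, inner_smul_right, h i, mul_zero]

lemma mem_meanZero (hb : Ω ⊆ Metric.ball 0 1) {f : L2 Ω} : f ∈ meanZero hb ↔ MeanZero f := by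
  refine forall_congr' fun i => ?_
  rw [inner_oneL, fn]

lemma isClosed_meanZero (hb : Ω ⊆ Metric.ball 0 1) :
    IsClosed (meanZero hb : Set (L2 Ω)) := by
  have : (meanZero hb : Set (L2 Ω)) = ⋂ i, {f : L2 Ω | inner ℂ (oneL hb) (f i) = 0} := by
    ext f; simp [meanZero]
  rw [this]
  exact isClosed_iInter fun i => isClosed_eq (by fun_prop) continuous_const

/-- Constant functions as elements of `L²(Ω; ℂ²)`. -/
def constL (hb : Ω ⊆ Metric.ball 0 1) : (Fin 2 → ℂ) →ₗ[ℂ] L2 Ω where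
  toFun c i := c i • oneL hb
  map_add' c d := by ext1 i; simp [add_smul]
  map_smul' c d := by ext1 i; simp [mul_smul]

lemma const_ae_eq (hb : Ω ⊆ Metric.ball 0 1) (c : Fin 2 → ℂ) (i : Fin 2) :
    const c i =ᵐ[volume.restrict Ω] fn (constL hb c) i := by
  filter_upwards [Lp.coeFn_smul (c i) (oneL hb), coeFn_oneL hb] with x h1 h2
  change _ = (c i • oneL hb : LOm Ω) x
  rw [h1, Pi.smul_apply, h2, const]
  simp

variable {γ : ℝ}

lemma eq_zero_of_orthogonal (hγ : 0 < γ) (hΩ : MeasurableSet Ω) (hb : Ω ⊆ Metric.ball 0 1)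
    {d : L2 Ω} (hd : d ∈ meanZero hb)
    (h : ∀ g ∈ meanZero hb, inner ℂ (jmap γ hΩ g) (jmap γ hΩ d) = 0) : d = 0 := by
  have h1 := inner_self_eq_zero.1 (h d hd)
  have h2 := norm_le_jmap hγ hΩ d
  rw [h1, norm_zero, mul_zero] at h2
  exact norm_le_zero_iff.1 h2

/-- The orthogonal projection onto the image of `L²₀(Ω; ℂ²)` under `jmap` yields `N`. -/
lemma exists_N (hγ : 0 < γ) (hΩ : MeasurableSet Ω) (hb : Ω ⊆ Metric.ball 0 1)
    (c : Fin 2 → ℂ) : ∃ h ∈ meanZero hb, ∀ g ∈ meanZero hb,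
    inner ℂ (jmap γ hΩ g) (jmap γ hΩ (constL hb c + h)) = 0 := by
  have hanti : AntilipschitzWith (Real.toNNReal (Real.sqrt γ)) (jmap γ hΩ) :=
    AddMonoidHomClass.antilipschitz_of_bound _ fun f => by
      rw [Real.coe_toNNReal _ (Real.sqrt_nonneg _)]
      exact norm_le_jmap hγ hΩ f
  have hcl := (hanti.isClosedEmbedding (jmap γ hΩ).uniformContinuous).isClosedMap _
    (isClosed_meanZero hb)
  let W : Submodule ℂ (PiLp 2 (fun _ : Fin 4 => LTwo)) :=
    (meanZero hb).map (jmap γ hΩ).toLinearMap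
  have hW : IsClosed (W : Set (PiLp 2 (fun _ : Fin 4 => LTwo))) := by
    rw [Submodule.map_coe]; exact hcl
  have : CompleteSpace W := hW.completeSpace_coe
  obtain ⟨w, hw, hwe⟩ := W.starProjection_apply_mem (jmap γ hΩ (constL hb c))
  refine ⟨-w, neg_mem hw, fun g hg => ?_⟩
  have h1 := W.starProjection_inner_eq_zero (jmap γ hΩ (constL hb c)) (jmap γ hΩ g) ⟨g, hg, rfl⟩
  rw [← hwe] at h1
  rw [← inner_conj_symm, map_add, map_neg, ← sub_eq_add_neg]
  exact (map_eq_zero _).2 h1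

lemma N_spec (hγ : 0 < γ) (hΩ : MeasurableSet Ω) (hb : Ω ⊆ Metric.ball 0 1) (c : Fin 2 → ℂ) :
    N γ Ω c ∈ meanZero hb ∧ ∀ g ∈ meanZero hb,
      inner ℂ (jmap γ hΩ g) (jmap γ hΩ (constL hb c + N γ Ω c)) = 0 := by
  have key : ∀ h g : L2 Ω, (formB γ Ω (fn h) (fn g) = -formB γ Ω (const c) (fn g) ↔
      inner ℂ (jmap γ hΩ g) (jmap γ hΩ (constL hb c + h)) = 0) := by
    intro h g
    rw [formB_congr (const_ae_eq hb c) (fun i => EventuallyEq.rfl), formB_eq hγ hΩ hb,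
      formB_eq hγ hΩ hb, map_add, inner_add_right, eq_neg_iff_add_eq_zero, add_comm]
  have hex : ∃ h : L2 Ω, MeanZero h ∧ ∀ g : L2 Ω, MeanZero g →
      formB γ Ω (fn h) (fn g) = - formB γ Ω (const c) (fn g) := by
    obtain ⟨h, hm, hh⟩ := exists_N hγ hΩ hb c
    exact ⟨h, (mem_meanZero hb).1 hm, fun g hg => (key h g).2 (hh g ((mem_meanZero hb).2 hg))⟩
  have hs : MeanZero (N γ Ω c) ∧ ∀ g : L2 Ω, MeanZero g →
      formB γ Ω (fn (N γ Ω c)) (fn g) = - formB γ Ω (const c) (fn g) :=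
    Classical.epsilon_spec hex
  exact ⟨(mem_meanZero hb).2 hs.1, fun g hg => (key _ g).1 (hs.2 g ((mem_meanZero hb).1 hg))⟩

lemma N_unique (hγ : 0 < γ) (hΩ : MeasurableSet Ω) (hb : Ω ⊆ Metric.ball 0 1) (c : Fin 2 → ℂ)
    {h : L2 Ω} (hm : h ∈ meanZero hb)
    (hh : ∀ g ∈ meanZero hb, inner ℂ (jmap γ hΩ g) (jmap γ hΩ (constL hb c + h)) = 0) :
    N γ Ω c = h := by
  have hs := N_spec hγ hΩ hb c
  rw [← sub_eq_zero]
  refine eq_zero_of_orthogonal hγ hΩ hb (sub_mem hs.1 hm) fun g hg => ?_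
  have h1 := hs.2 g hg
  have h2 := hh g hg
  rw [map_add, inner_add_right] at h1 h2
  rw [map_sub, inner_sub_right]
  linear_combination h1 - h2

/-- The linear map `c ↦ (I + N) c` into `L²(Ω; ℂ²)`. -/
def liftN (hγ : 0 < γ) (hΩ : MeasurableSet Ω) (hb : Ω ⊆ Metric.ball 0 1) :
    (Fin 2 → ℂ) →ₗ[ℂ] L2 Ω where
  toFun c := constL hb c + N γ Ω c
  map_add' c d := by
    have h : N γ Ω (c + d) = N γ Ω c + N γ Ω d := by
      have hc := N_spec hγ hΩ hb c
      have hd := N_spec hγ hΩ hb d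
      refine N_unique hγ hΩ hb _ (add_mem hc.1 hd.1) fun g hg => ?_
      rw [map_add (constL hb), add_add_add_comm, map_add, inner_add_right, hc.2 g hg, hd.2 g hg, add_zero]
    rw [h, map_add]; abel
  map_smul' a c := by
    have h : N γ Ω (a • c) = a • N γ Ω c := by
      have hc := N_spec hγ hΩ hb c
      refine N_unique hγ hΩ hb _ (Submodule.smul_mem _ _ hc.1) fun g hg => ?_
      rw [map_smul, ← smul_add, map_smul, inner_smul_right, hc.2 g hg, mul_zero]
    rw [h, map_smul, smul_add, RingHom.id_apply]

lemma quadB_IN (hγ : 0 < γ) (hΩ : MeasurableSet Ω) (hb : Ω ⊆ Metric.ball 0 1) (c : Fin 2 → ℂ) :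
    quadB γ Ω (IN γ Ω c) = ‖jmap γ hΩ (liftN hγ hΩ hb c)‖ ^ 2 := by
  have h : ∀ i, IN γ Ω c i =ᵐ[volume.restrict Ω] fn (liftN hγ hΩ hb c) i := by
    intro i
    filter_upwards [const_ae_eq hb c i, Lp.coeFn_add (constL hb c i) (N γ Ω c i)] with x h1 h2
    change _ = (constL hb c i + N γ Ω c i : LOm Ω) x
    rw [h2]
    simp only [IN, Pi.add_apply, h1, fn]
  rw [← quadB_eq hγ hΩ hb, quadB, quadB, formB_congr h h]

/-- The area of `Ω`. -/
def area (hb : Ω ⊆ Metric.ball 0 1) : ℂ := inner ℂ (oneL hb) (oneL hb)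

lemma area_ne_zero (hΩ : IsOpen Ω) (hne : Ω.Nonempty) (hb : Ω ⊆ Metric.ball 0 1) :
    area hb ≠ 0 := by
  rw [area, inner_oneL, integral_congr_ae (coeFn_oneL hb)]
  simp only [integral_const, MeasurableSet.univ, measureReal_restrict_apply, univ_inter,
    Complex.real_smul, mul_one]
  rw [Complex.ofReal_ne_zero, Measure.real, ENNReal.toReal_ne_zero]
  exact ⟨(hΩ.measure_pos volume hne).ne',
    ((measure_mono hb).trans_lt measure_ball_lt_top).ne⟩

lemma inner_oneL_liftN (hγ : 0 < γ) (hΩ : MeasurableSet Ω) (hb : Ω ⊆ Metric.ball 0 1)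
    (c : Fin 2 → ℂ) (i : Fin 2) :
    inner ℂ (oneL hb) (liftN hγ hΩ hb c i) = area hb * c i := by
  have h := (N_spec hγ hΩ hb c).1 i
  change inner ℂ (oneL hb) (c i • oneL hb + N γ Ω c i) = _
  rw [inner_add_right, h, inner_smul_right, area, add_zero, mul_comm]

/-- The decomposition `f = g + (I + N) c` with `g` of mean zero, as a linear map
`f ↦ (g, c)`. -/
def split (hγ : 0 < γ) (hΩ : MeasurableSet Ω) (hb : Ω ⊆ Metric.ball 0 1) :
    L2 Ω →ₗ[ℂ] L2 Ω × (Fin 2 → ℂ) :=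
  let m : L2 Ω →ₗ[ℂ] (Fin 2 → ℂ) := LinearMap.pi fun i =>
    (area hb)⁻¹ • ((innerSL ℂ (oneL hb)).toLinearMap ∘ₗ LinearMap.proj i)
  (LinearMap.id - liftN hγ hΩ hb ∘ₗ m).prod m

lemma split_fst_add (hγ : 0 < γ) (hΩ : MeasurableSet Ω) (hb : Ω ⊆ Metric.ball 0 1) (f : L2 Ω) :
    (split hγ hΩ hb f).1 + liftN hγ hΩ hb (split hγ hΩ hb f).2 = f :=
  sub_add_cancel _ _

lemma split_snd (hγ : 0 < γ) (hΩ : MeasurableSet Ω) (hb : Ω ⊆ Metric.ball 0 1) (f : L2 Ω)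
    (i : Fin 2) : (split hγ hΩ hb f).2 i = (area hb)⁻¹ * inner ℂ (oneL hb) (f i) := rfl

lemma split_fst_mem (hγ : 0 < γ) (hΩ : IsOpen Ω) (hne : Ω.Nonempty)
    (hb : Ω ⊆ Metric.ball 0 1) (f : L2 Ω) :
    (split hγ hΩ.measurableSet hb f).1 ∈ meanZero hb := by
  intro i
  have h := congrArg (fun u => inner ℂ (oneL hb) (u i)) (split_fst_add hγ hΩ.measurableSet hb f)
  simp only [Pi.add_apply, inner_add_right] at h
  rw [inner_oneL_liftN, split_snd, mul_inv_cancel_left₀ (area_ne_zero hΩ hne hb)] at h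
  simpa using h

lemma injective_split (hγ : 0 < γ) (hΩ : MeasurableSet Ω) (hb : Ω ⊆ Metric.ball 0 1) :
    Function.Injective (split hγ hΩ hb) := by
  intro f f' h
  rw [← split_fst_add hγ hΩ hb f, h, split_fst_add]

lemma range_split (hγ : 0 < γ) (hΩ : IsOpen Ω) (hne : Ω.Nonempty) (hb : Ω ⊆ Metric.ball 0 1) :
    range (split hγ hΩ.measurableSet hb) = {v : L2 Ω × (Fin 2 → ℂ) | MeanZero v.1} := by
  ext v
  constructor
  · rintro ⟨f, rfl⟩
    exact (mem_meanZero hb).1 (split_fst_mem hγ hΩ hne hb f)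
  · intro hv
    have hv := (mem_meanZero hb).2 hv
    set f := v.1 + liftN hγ hΩ.measurableSet hb v.2 with hf
    have h2 : (split hγ hΩ.measurableSet hb f).2 = v.2 := by
      ext i
      rw [split_snd, hf, Pi.add_apply, inner_add_right, hv i, zero_add, inner_oneL_liftN,
        inv_mul_cancel_left₀ (area_ne_zero hΩ hne hb)]
    have h1 := split_fst_add hγ hΩ.measurableSet hb f
    rw [h2, hf] at h1
    exact ⟨f, Prod.ext (add_right_cancel h1) h2⟩

lemma quadC1_const (hb : Ω ⊆ Metric.ball 0 1) (c : Fin 2 → ℂ) :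
    quadC1 Ω (const c) = ‖area hb‖ ^ 2 * (‖c 0‖ ^ 2 + ‖c 1‖ ^ 2) := by
  have h : ∀ i, constL hb c i = c i • oneL hb := fun i => rfl
  rw [quadC1_congr (const_ae_eq hb c), quadC1_eq hb]
  simp only [h, inner_smul_right, norm_mul, mul_pow]
  rw [area]
  ring

lemma quadC1_split (hγ : 0 < γ) (hΩ : IsOpen Ω) (hne : Ω.Nonempty) (hb : Ω ⊆ Metric.ball 0 1)
    (f : L2 Ω) : quadC1 Ω (fn f) = quadC1 Ω (const (split hγ hΩ.measurableSet hb f).2) := by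
  have h := norm_ne_zero_iff.2 (area_ne_zero hΩ hne hb)
  rw [quadC1_const hb, quadC1_eq hb, split_snd, split_snd]
  simp only [norm_mul, norm_inv]
  field_simp

lemma quadB_split (hγ : 0 < γ) (hΩ : IsOpen Ω) (hne : Ω.Nonempty) (hb : Ω ⊆ Metric.ball 0 1)
    (f : L2 Ω) : quadB γ Ω (fn f) = quadB γ Ω (IN γ Ω (split hγ hΩ.measurableSet hb f).2)
      + quadB γ Ω (fn (split hγ hΩ.measurableSet hb f).1) := by
  rw [quadB_IN hγ hΩ.measurableSet hb, quadB_eq hγ hΩ.measurableSet hb,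
    quadB_eq hγ hΩ.measurableSet hb]
  conv_lhs => rw [← split_fst_add hγ hΩ.measurableSet hb f, map_add]
  have h : inner ℂ (jmap γ hΩ.measurableSet (split hγ hΩ.measurableSet hb f).1)
      (jmap γ hΩ.measurableSet
        (liftN hγ hΩ.measurableSet hb (split hγ hΩ.measurableSet hb f).2)) = 0 :=
    (N_spec hγ hΩ.measurableSet hb _).2 _ (split_fst_mem hγ hΩ hne hb f)
  rw [sq, norm_add_mul_self (𝕜 := ℂ), h]
  simp only [map_zero, mul_zero, add_zero]
  ring

/-- On the finite-dimensional space of the functions `(I + N) c`, the form `𝔠₂ + κ 𝔠₁` is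
controlled by `𝔠₁`. -/
lemma exists_bound_liftN (hγ : 0 < γ) (hΩ : IsOpen Ω) (hne : Ω.Nonempty)
    (hb : Ω ⊆ Metric.ball 0 1) : ∃ K : ℝ, 0 ≤ K ∧ ∀ c : Fin 2 → ℂ,
      quadC2 γ Ω (fn (liftN hγ hΩ.measurableSet hb c))
        + kappa * quadC1 Ω (fn (liftN hγ hΩ.measurableSet hb c)) ≤ K * quadC1 Ω (const c) := by
  set U := liftN hγ hΩ.measurableSet hb
  set s : L2 Ω → ℝ := fun f => quadC2 γ Ω (fn f) + kappa * quadC1 Ω (fn f) with hs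
  have hs0 : ∀ f, 0 ≤ s f := quadC2_add_kappa_nonneg hγ hΩ.measurableSet hb
  -- the parallelogram law
  have hadd : ∀ f g, s (f + g) ≤ 2 * s f + 2 * s g := by
    intro f g
    obtain ⟨p, hp⟩ := exists_polar_quadC (γ := γ) hΩ.measurableSet hb kappa f g
    have h1 := hp 1
    have h2 := hp (-1)
    have h3 := hs0 (((-1 : ℝ) : ℂ) • f + g)
    simp only [hs] at h3 ⊢
    rw [Complex.ofReal_one, one_smul] at h1
    linarith
  have hsmul : ∀ (c : ℂ) f, s (c • f) = ‖c‖ ^ 2 * s f := by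
    intro c f
    simp only [hs]
    rw [quadC2_eq hΩ.measurableSet hb, quadC2_eq hΩ.measurableSet hb, quadC1_eq hb, quadC1_eq hb]
    have hc : ∀ z : ℂ, (conj c * (c * z)).re = ‖c‖ ^ 2 * z.re := by
      intro z
      rw [← mul_assoc, mul_comm (conj c), Complex.mul_conj, Complex.normSq_eq_norm_sq,
        Complex.re_ofReal_mul]
    simp only [Pi.smul_apply, map_smul, inner_smul_left, inner_smul_right, norm_smul, norm_mul,
      mul_pow]
    rw [mul_left_comm c, hc, mul_left_comm c, hc]
    ring
  have hA : 0 < ‖area hb‖ := norm_pos_iff.2 (area_ne_zero hΩ hne hb)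
  refine ⟨2 * (s (U (Pi.single 0 1)) + s (U (Pi.single 1 1))) / ‖area hb‖ ^ 2, ?_, fun c => ?_⟩
  · have := hs0 (U (Pi.single 0 1))
    have := hs0 (U (Pi.single 1 1))
    positivity
  · have hc : c = c 0 • Pi.single 0 1 + c 1 • Pi.single 1 1 := by
      ext i; fin_cases i <;> simp
    have h1 : s (U c) ≤ 2 * (‖c 0‖ ^ 2 * s (U (Pi.single 0 1)))
        + 2 * (‖c 1‖ ^ 2 * s (U (Pi.single 1 1))) := by
      conv_lhs => rw [hc, map_add, map_smul, map_smul]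
      refine (hadd _ _).trans ?_
      rw [hsmul, hsmul]
    refine h1.trans ?_
    rw [quadC1_const hb]
    have h2 := hs0 (U (Pi.single 0 1))
    have h3 := hs0 (U (Pi.single 1 1))
    have e : 2 * (s (U (Pi.single 0 1)) + s (U (Pi.single 1 1))) / ‖area hb‖ ^ 2
        * (‖area hb‖ ^ 2 * (‖c 0‖ ^ 2 + ‖c 1‖ ^ 2))
        = 2 * (s (U (Pi.single 0 1)) + s (U (Pi.single 1 1))) * (‖c 0‖ ^ 2 + ‖c 1‖ ^ 2) := by
      field_simp
    rw [e]
    nlinarith [mul_nonneg (sq_nonneg ‖c 0‖) h3, mul_nonneg (sq_nonneg ‖c 1‖) h2]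

/-- The comparison of the two families of min-max values, given a lower bound for `ν`. -/
lemma abs_mu_sub_Lam_le (hγ : 0 < γ) (hΩ : IsOpen Ω) (hne : Ω.Nonempty)
    (hb : Ω ⊆ Metric.ball 0 1) {c₀ : ℝ} (hc₀ : 0 < c₀) :
    ∃ C₂ : ℝ, 0 < C₂ ∧ ∀ (δ : ℝ) (θ : Plane) (L : ℝ), 1 ≤ L → kappa + c₀ * L ≤ nu θ δ →
      ∀ n : ℕ, |mu γ Ω δ θ n - Lam γ Ω δ θ n| ≤ C₂ * L ^ (-(1 / 2) : ℝ) * mu γ Ω δ θ n := by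
  obtain ⟨K, hK, hU⟩ := exists_bound_liftN hγ hΩ hne hb
  have hκ := kappa_nonneg
  refine ⟨1 + K / c₀ + (K + kappa) / c₀, by positivity, fun δ θ L hL hν n => ?_⟩
  have hm := hΩ.measurableSet
  have hs0 := quadC2_add_kappa_nonneg hγ hm hb
  have key : ∀ f : L2 Ω, ∃ X, ∀ t : ℝ,
      0 ≤ t ^ 2 * quadC2 γ Ω (fn (split hγ hm hb f).1) + t * X
        + (quadC2 γ Ω (fn (liftN hγ hm hb (split hγ hm hb f).2))
          + kappa * quadC1 Ω (fn (liftN hγ hm hb (split hγ hm hb f).2))) ∧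
      quadC2 γ Ω (fn f) + kappa * quadC1 Ω (fn f)
        = quadC2 γ Ω (fn (split hγ hm hb f).1) + X
          + (quadC2 γ Ω (fn (liftN hγ hm hb (split hγ hm hb f).2))
            + kappa * quadC1 Ω (fn (liftN hγ hm hb (split hγ hm hb f).2))) := fun f => by
    obtain ⟨X, hX⟩ := exists_polar_quadC (γ := γ) hm hb kappa (split hγ hm hb f).1
      (liftN hγ hm hb (split hγ hm hb f).2)
    have h2 : quadC1 Ω (fn (split hγ hm hb f).1) = 0 := by
      rw [quadC1_eq hb, split_fst_mem hγ hΩ hne hb f 0, split_fst_mem hγ hΩ hne hb f 1]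
      simp
    simp only [h2, mul_zero, add_zero] at hX
    refine ⟨X, fun t => ⟨by rw [← hX]; exact hs0 _, ?_⟩⟩
    have hf := hX 1
    rw [Complex.ofReal_one, one_smul, split_fst_add] at hf
    linarith
  have hsg : ∀ f : L2 Ω, 0 ≤ quadC2 γ Ω (fn (split hγ hm hb f).1) := fun f => by
    have h1 := hs0 (split hγ hm hb f).1
    have h2 : quadC1 Ω (fn (split hγ hm hb f).1) = 0 := by
      rw [quadC1_eq hb, split_fst_mem hγ hΩ hne hb f 0, split_fst_mem hγ hΩ hne hb f 1]
      simp
    rwa [h2, mul_zero, add_zero] at h1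
  have hp0 : ∀ c : Fin 2 → ℂ, 0 ≤ quadC1 Ω (const c) := fun c => by
    rw [quadC1_const hb]; positivity
  have hp : ∀ f : L2 Ω, nu θ δ * quadC1 Ω (const (split hγ hm hb f).2)
      + (quadC2 γ Ω (fn f) + kappa * quadC1 Ω (fn f)
        - kappa * quadC1 Ω (const (split hγ hm hb f).2))
      = nu θ δ * quadC1 Ω (fn f) + quadC2 γ Ω (fn f) := by
    intro f
    rw [quadC1_split hγ hΩ hne hb f]
    ring
  -- the change of variables `f = g + (I + N) c` in the second min-max problem
  have hLam : Lam γ Ω δ θ n = minMax univ (fun f : L2 Ω => quadB γ Ω (fn f))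
      (fun f => nu θ δ * quadC1 Ω (const (split hγ hm hb f).2)
        + quadC2 γ Ω (fn (split hγ hm hb f).1)) n := by
    rw [Lam, minMax_range (split hγ hm hb) (injective_split hγ hm hb)
      (range_split hγ hΩ hne hb)]
    congr 1
    ext f
    exact (quadB_split hγ hΩ hne hb f).symm
  rw [hLam, mu]
  have key := fun f => (key f).elim fun X hX =>
    denominators_compare hL hc₀ hν hκ hK (hp0 _) (hsg f) (hs0 _) (hs0 f) (hU _)
      (fun t => (hX t).1) (hX 1).2
  simp only [hp] at key
  refine abs_minMax_sub_le univ (by positivity)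
    (by positivity : (0 : ℝ) ≤ 3 + kappa / c₀ + 2 * K / c₀) (fun f => ?_)
    (fun f => (key f).1) (fun f => (key f).2.1) (fun f => (key f).2.2.1)
    (fun f => (key f).2.2.2) n
  rw [quadB_eq hγ hm hb]
  positivity

end OperatorN

/-! ### Plane waves and Fourier coefficients -/

/-- The plane wave `e^{iξ·x}`. -/
def wave (ξ x : Plane) : ℂ := Complex.exp (Complex.I * ((ξ 0 * x 0 + ξ 1 * x 1 : ℝ) : ℂ))

lemma norm_wave (ξ x : Plane) : ‖wave ξ x‖ = 1 := by
  rw [wave, mul_comm, Complex.norm_exp_ofReal_mul_I]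

lemma wave_mul_conj (ξ x : Plane) : wave ξ x * conj (wave ξ x) = 1 := by
  rw [Complex.mul_conj, Complex.normSq_eq_norm_sq, norm_wave]; simp

lemma wave_add_left (ξ η x : Plane) : wave (ξ + η) x = wave ξ x * wave η x := by
  rw [wave, wave, wave, ← Complex.exp_add]
  congr 1
  simp only [PiLp.add_apply]
  push_cast
  ring

lemma wave_add_right (ξ x y : Plane) : wave ξ (x + y) = wave ξ x * wave ξ y := by
  rw [wave, wave, wave, ← Complex.exp_add]
  congr 1
  simp only [PiLp.add_apply]
  push_cast
  ring

lemma wave_zero (ξ : Plane) : wave ξ 0 = 1 := by simp [wave]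

lemma wave_neg (ξ x : Plane) : wave ξ (-x) = conj (wave ξ x) := by
  rw [wave, wave, ← Complex.exp_conj]
  congr 1
  simp only [PiLp.neg_apply, map_mul, Complex.conj_I, Complex.conj_ofReal]
  push_cast
  ring

lemma contDiff_wave (ξ : Plane) : ContDiff ℝ ∞ (wave ξ) := by
  unfold wave
  have h : ∀ i, ContDiff ℝ ∞ (fun x : Plane => x i) := fun i =>
    (EuclideanSpace.proj i : Plane →L[ℝ] ℝ).contDiff
  exact (contDiff_const.mul (Complex.ofRealCLM.contDiff.comp
    ((contDiff_const.mul (h 0)).add (contDiff_const.mul (h 1))))).cexp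

lemma pd_wave (i : Fin 2) (ξ : Plane) : pd i (wave ξ) = fun x => Complex.I * ξ i * wave ξ x := by
  ext x
  have h : ∀ j, HasFDerivAt (fun x : Plane => x j) (EuclideanSpace.proj j : Plane →L[ℝ] ℝ) x :=
    fun j => (EuclideanSpace.proj j : Plane →L[ℝ] ℝ).hasFDerivAt
  have h2 := (Complex.ofRealCLM.hasFDerivAt.comp x
    (((h 0).const_mul (ξ 0)).add ((h 1).const_mul (ξ 1)))).const_mul Complex.I
  have h3 := h2.cexp.fderiv
  have h4 : pd i (wave ξ) x = fderiv ℝ (fun x => Complex.exp (Complex.I *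
    (Complex.ofRealCLM ∘ ((fun x : Plane => ξ 0 * x 0) + fun x : Plane => ξ 1 * x 1)) x)) x
      (e i) := rfl
  rw [h4, h3]
  fin_cases i <;> simp [e, wave] <;> ring

/-- The Fourier coefficient of `ψ` at the frequency `ξ`, normalised for the cell `□`. -/
def coef (ψ : Plane → ℂ) (ξ : Plane) : ℂ :=
  (((2 * Real.pi) ^ 2 : ℝ) : ℂ)⁻¹ * ∫ y, ψ y * conj (wave ξ y)

lemma CTest.mul_conj_wave {ψ : Plane → ℂ} (hψ : CTest ψ) (ξ : Plane) :
    CTest (fun x => ψ x * conj (wave ξ x)) :=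
  ⟨hψ.1.mul (Complex.conjCLE.contDiff.comp (contDiff_wave ξ)), hψ.2.mul_right⟩

lemma coef_pd {ψ : Plane → ℂ} (hψ : CTest ψ) (ξ : Plane) (i : Fin 2) :
    coef (pd i ψ) ξ = Complex.I * ξ i * coef ψ ξ := by
  have hs : ContDiff ℝ ∞ (fun x => conj (wave ξ x)) :=
    Complex.conjCLE.contDiff.comp (contDiff_wave ξ)
  have h := integral_mul_pd hs hψ i
  rw [pd_conj ((contDiff_wave ξ).differentiable (by simp)), pd_wave] at h
  have h1 : ∫ x, pd i ψ x * conj (wave ξ x) = Complex.I * ξ i * ∫ x, ψ x * conj (wave ξ x) := by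
    rw [← integral_const_mul]
    simp only [mul_comm (pd i ψ _)]
    rw [h, ← integral_neg]
    refine integral_congr_ae (ae_of_all _ fun x => ?_)
    simp only [map_mul, Complex.conj_I, Complex.conj_ofReal]
    ring
  rw [coef, h1, coef]
  ring

lemma coef_sub {ψ φ : Plane → ℂ} (hψ : CTest ψ) (hφ : CTest φ) (ξ : Plane) :
    coef (ψ - φ) ξ = coef ψ ξ - coef φ ξ := by
  rw [coef, coef, coef, ← mul_sub,
    ← integral_sub (hψ.mul_conj_wave ξ).integrable (hφ.mul_conj_wave ξ).integrable]
  simp only [Pi.sub_apply, sub_mul]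

lemma norm_coef_le (ψ : Plane → ℂ) (ξ : Plane) :
    ‖coef ψ ξ‖ ≤ ((2 * Real.pi) ^ 2)⁻¹ * ∫ y, ‖ψ y‖ := by
  rw [coef, norm_mul, norm_inv, Complex.norm_real, Real.norm_of_nonneg (by positivity)]
  gcongr
  refine (norm_integral_le_integral_norm _).trans (le_of_eq ?_)
  simp [norm_wave]

lemma exists_coef_bound {ψ : Plane → ℂ} (hψ : CTest ψ) :
    ∃ C : ℝ, 0 ≤ C ∧ ∀ ξ : Plane, ‖coef ψ ξ‖ ≤ C * ((1 + ξ 0 ^ 2)⁻¹ * (1 + ξ 1 ^ 2)⁻¹) := by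
  have step : ∀ (i : Fin 2) {φ : Plane → ℂ}, CTest φ → ∀ ξ : Plane,
      coef (φ - pd i (pd i φ)) ξ = ((1 + ξ i ^ 2 : ℝ) : ℂ) * coef φ ξ := by
    intro i φ hφ ξ
    rw [coef_sub hφ ((hφ.pd i).pd i), coef_pd (hφ.pd i), coef_pd hφ]
    push_cast
    linear_combination -(ξ i : ℂ) ^ 2 * coef φ ξ * Complex.I_sq
  have h0 : CTest (ψ - pd 0 (pd 0 ψ)) := hψ.sub ((hψ.pd 0).pd 0)
  set φ := (ψ - pd 0 (pd 0 ψ)) - pd 1 (pd 1 (ψ - pd 0 (pd 0 ψ))) with hφ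
  refine ⟨((2 * Real.pi) ^ 2)⁻¹ * ∫ y, ‖φ y‖, by positivity, fun ξ => ?_⟩
  have h := norm_coef_le φ ξ
  rw [hφ, step 1 h0, step 0 hψ, norm_mul, norm_mul, Complex.norm_real, Complex.norm_real,
    Real.norm_of_nonneg (by positivity), Real.norm_of_nonneg (by positivity), ← hφ] at h
  rw [← mul_inv, ← div_eq_mul_inv, le_div_iff₀ (by positivity)]
  linarith

/-- The frequencies `θ + k`, `k ∈ ℤ²`, of the `θ`-quasi-periodic plane waves. -/
def freq (θ : Plane) (k : Fin 2 → ℤ) : Plane := WithLp.toLp 2 fun i => θ i + k i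

lemma freq_apply (θ : Plane) (k : Fin 2 → ℤ) (i : Fin 2) : freq θ k i = θ i + k i := rfl

lemma abs_le_half_of_mem_dualCell {θ : Plane} (hθ : θ ∈ dualCell) (i : Fin 2) :
    |θ i| ≤ 1 / 2 := by
  have := hθ i
  rw [abs_le]
  exact ⟨this.1, this.2.le⟩

lemma summable_inv_one_add_sq_int : Summable (fun n : ℤ => (1 + (n : ℝ) ^ 2)⁻¹) := by
  refine Summable.of_norm_bounded_eventually (Real.summable_one_div_int_pow.2 one_lt_two) ?_
  rw [Filter.eventually_cofinite]
  refine (finite_singleton (0 : ℤ)).subset fun n hn => ?_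
  by_contra h0
  apply hn
  have h1 : (n : ℝ) ≠ 0 := by exact_mod_cast h0
  rw [Real.norm_of_nonneg (by positivity), one_div]
  gcongr
  linarith

lemma summable_coef {ψ : Plane → ℂ} (hψ : CTest ψ) {θ : Plane} (hθ : θ ∈ dualCell) :
    Summable (fun k => ‖coef ψ (freq θ k)‖) := by
  obtain ⟨C, hC, hb⟩ := exists_coef_bound hψ
  have h1 : ∀ (i : Fin 2) (n : ℤ), (1 + (θ i + n) ^ 2)⁻¹ ≤ 4 * (1 + (n : ℝ) ^ 2)⁻¹ := by
    intro i n
    have := abs_le.1 (abs_le_half_of_mem_dualCell hθ i)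
    rw [inv_le_comm₀ (by positivity) (by positivity), mul_inv, inv_inv]
    nlinarith [sq_nonneg ((n : ℝ) + 2 * θ i)]
  have hs := summable_inv_one_add_sq_int.mul_of_nonneg summable_inv_one_add_sq_int
    (fun n => by positivity) (fun n => by positivity)
  have hs2 := ((finTwoArrowEquiv ℤ).summable_iff.2 hs).mul_left (C * 16)
  refine Summable.of_nonneg_of_le (fun k => norm_nonneg _) (fun k => (hb _).trans ?_) hs2
  have e : C * 16 * ((fun x : ℤ × ℤ => (1 + (x.1 : ℝ) ^ 2)⁻¹ * (1 + (x.2 : ℝ) ^ 2)⁻¹)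
      ∘ finTwoArrowEquiv ℤ) k
      = C * ((4 * (1 + (k 0 : ℝ) ^ 2)⁻¹) * (4 * (1 + (k 1 : ℝ) ^ 2)⁻¹)) := by
    have h2 : finTwoArrowEquiv ℤ k = (k 0, k 1) := rfl
    simp only [Function.comp, h2]; ring
  rw [e]
  gcongr
  · exact h1 0 (k 0)
  · exact h1 1 (k 1)

/-! ### Quasi-periodic extension from the cell -/

/-- The points of the lattice `2πℤ²`. -/
def lat (k : Fin 2 → ℤ) : Plane := WithLp.toLp 2 fun i => 2 * Real.pi * k i

lemma lat_apply (k : Fin 2 → ℤ) (i : Fin 2) : lat k i = 2 * Real.pi * k i := rfl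

/-- The index of the translate of the cell that contains a given point. -/
def idx (x : Plane) : Fin 2 → ℤ := fun i => ⌊(x i + Real.pi) / (2 * Real.pi)⌋

lemma idx_eq_iff {x : Plane} {k : Fin 2 → ℤ} : idx x = k ↔ x - lat k ∈ cell := by
  rw [funext_iff]
  refine forall_congr' fun i => ?_
  have hpi := Real.pi_pos
  rw [idx, Int.floor_eq_iff, le_div_iff₀ (by positivity), div_lt_iff₀ (by positivity), mem_Ico,
    PiLp.sub_apply, lat_apply]
  constructor <;> rintro ⟨h1, h2⟩ <;> constructor <;> linarith

lemma mem_cell_of_norm_lt {x : Plane} (hx : ‖x‖ < Real.pi) : x ∈ cell := fun i => by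
  have := abs_lt.1 ((abs_apply_le_norm x i).trans_lt hx)
  exact ⟨this.1.le, this.2⟩

lemma idx_eq_zero {x : Plane} (hx : x ∈ cell) : idx x = 0 := by
  rw [idx_eq_iff]
  have : lat 0 = 0 := by ext i; simp [lat_apply]
  rwa [this, sub_zero]

/-- The `θ`-quasi-periodic extension of the restriction of `φ` to the cell. -/
def per (θ : Plane) (φ : Plane → ℂ) (x : Plane) : ℂ :=
  wave θ (lat (idx x)) * φ (x - lat (idx x))

lemma per_eq {θ x : Plane} (φ : Plane → ℂ) (hx : x ∈ cell) : per θ φ x = φ x := by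
  have : lat 0 = 0 := by ext i; simp [lat_apply]
  rw [per, idx_eq_zero hx, this, wave_zero, sub_zero, one_mul]

lemma idx_add_lat (x : Plane) (k : Fin 2 → ℤ) : idx (x + lat k) = idx x + k := by
  rw [idx_eq_iff]
  have : x + lat k - lat (idx x + k) = x - lat (idx x) := by
    ext i; simp [lat_apply]; ring
  rw [this, ← idx_eq_iff]

lemma lat_add (k l : Fin 2 → ℤ) : lat (k + l) = lat k + lat l := by
  ext i; simp [lat_apply]; ring

lemma per_add_lat (θ : Plane) (φ : Plane → ℂ) (x : Plane) (k : Fin 2 → ℤ) :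
    per θ φ (x + lat k) = wave θ (lat k) * per θ φ x := by
  rw [per, idx_add_lat, lat_add, wave_add_right, add_sub_add_right_eq_sub, per]
  ring

lemma smul_e_eq_lat (j : Fin 2) : (2 * Real.pi) • e j = lat (Pi.single j 1) := by
  ext i
  by_cases h : i = j
  · subst h; simp [e, lat_apply]
  · simp [e, lat_apply, h]

lemma wave_lat_single (θ : Plane) (j : Fin 2) :
    wave θ (lat (Pi.single j 1)) = Complex.exp (2 * Real.pi * θ j * Complex.I) := by
  rw [wave, lat_apply, lat_apply]
  congr 1
  fin_cases j <;> simp <;> ring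

lemma isQuasiPeriodic_per (θ : Plane) (φ : Plane → ℂ) : IsQuasiPeriodic θ (per θ φ) := by
  intro x j
  rw [smul_e_eq_lat, per_add_lat, wave_lat_single]

lemma wave_intCast_lat (k l : Fin 2 → ℤ) : wave (freq 0 k) (lat l) = 1 := by
  rw [wave, Complex.exp_eq_one_iff]
  refine ⟨k 0 * l 0 + k 1 * l 1, ?_⟩
  simp only [freq_apply, lat_apply, PiLp.zero_apply]
  push_cast
  ring

lemma freq_eq_add (θ : Plane) (k : Fin 2 → ℤ) : freq θ k = θ + freq 0 k := by
  ext i; simp [freq_apply]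

lemma isQuasiPeriodic_wave (θ : Plane) (k : Fin 2 → ℤ) : IsQuasiPeriodic θ (wave (freq θ k)) := by
  intro x j
  rw [smul_e_eq_lat, wave_add_right, freq_eq_add, wave_add_left, wave_add_left, wave_intCast_lat, ← wave_lat_single]
  ring

section Support

variable {φ : Plane → ℂ} {r : ℝ}

lemma per_eventuallyEq (hr : r < Real.pi) (hs : ∀ x, φ x ≠ 0 → ‖x‖ ≤ r) (θ x : Plane) :
    per θ φ =ᶠ[𝓝 x] fun y => wave θ (lat (idx x)) * φ (y - lat (idx x)) := by
  filter_upwards [Metric.ball_mem_nhds x (sub_pos.2 hr)] with y hy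
  by_cases h : idx y = idx x
  · rw [per, h]
  · have h1 : φ (y - lat (idx y)) = 0 := by
      by_contra hne
      refine h (Eq.symm (idx_eq_iff.2 (mem_cell_of_norm_lt ?_)))
      have e1 : x - lat (idx y) = (x - y) + (y - lat (idx y)) := by abel
      rw [e1]
      have h2 := hs _ hne
      rw [Metric.mem_ball, dist_comm, dist_eq_norm] at hy
      linarith [norm_add_le (x - y) (y - lat (idx y))]
    have h2 : φ (y - lat (idx x)) = 0 := by
      by_contra hne
      exact h (idx_eq_iff.2 (mem_cell_of_norm_lt ((hs _ hne).trans_lt hr)))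
    rw [per, h1, h2, mul_zero, mul_zero]

lemma contDiff_per (hφ : ContDiff ℝ ∞ φ) (hr : r < Real.pi) (hs : ∀ x, φ x ≠ 0 → ‖x‖ ≤ r)
    (θ : Plane) : ContDiff ℝ ∞ (per θ φ) := by
  rw [contDiff_iff_contDiffAt]
  intro x
  have h : ContDiff ℝ ∞ (fun y => wave θ (lat (idx x)) * φ (y - lat (idx x))) :=
    contDiff_const.mul (hφ.comp (contDiff_id.sub contDiff_const))
  exact h.contDiffAt.congr_of_eventuallyEq (per_eventuallyEq hr hs θ x)

lemma per_eventuallyEq_self (hr : r < Real.pi) (hs : ∀ x, φ x ≠ 0 → ‖x‖ ≤ r) (θ : Plane)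
    {x : Plane} (hx : x ∈ cell) : per θ φ =ᶠ[𝓝 x] φ := by
  have h := per_eventuallyEq hr hs θ x
  have h0 : lat 0 = 0 := by ext i; simp [lat_apply]
  rw [idx_eq_zero hx, h0, wave_zero] at h
  simpa using h

end Support

/-! ### Fourier inversion on the cell -/

section Inversion

variable {ψ : Plane → ℂ} {r : ℝ}

/-- The quotient map `ℝ² → (ℝ/ℤ)²`. -/
def torusMk : C(Fin 2 → ℝ, UnitAddTorus (Fin 2)) where
  toFun s i := (s i : UnitAddCircle)
  continuous_toFun := by fun_prop

lemma isQuotientMap_torusMk : Topology.IsQuotientMap torusMk :=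
  (IsOpenQuotientMap.piMap (fun _ : Fin 2 =>
    (QuotientAddGroup.isOpenQuotientMap_mk : IsOpenQuotientMap
      (fun s : ℝ => (s : UnitAddCircle))))).isQuotientMap

/-- Rescaling of the unit square to the cell. -/
def scale (s : Fin 2 → ℝ) : Plane := (2 * Real.pi) • WithLp.toLp 2 s

lemma scale_apply (s : Fin 2 → ℝ) (i : Fin 2) : scale s i = 2 * Real.pi * s i := rfl

lemma continuous_scale : Continuous scale := by
  unfold scale
  fun_prop

lemma exists_torus_function (hψ : CTest ψ) (hr : r < Real.pi) (hs : ∀ x, ψ x ≠ 0 → ‖x‖ ≤ r) :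
    ∃ F : C(UnitAddTorus (Fin 2), ℂ), ∀ s, F (torusMk s) = per 0 ψ (scale s) := by
  let g : C(Fin 2 → ℝ, ℂ) :=
    ⟨fun s => per 0 ψ (scale s), (contDiff_per hψ.1 hr hs 0).continuous.comp continuous_scale⟩
  have hg : Function.FactorsThrough g torusMk := by
    intro s s' h
    have h1 : ∀ i, ∃ n : ℤ, n • (1 : ℝ) = s i - s' i := fun i => by
      rw [← AddCircle.coe_eq_zero_iff, AddCircle.coe_sub, sub_eq_zero]
      exact congrFun h i
    choose n hn using h1
    have h2 : scale s = scale s' + lat n := by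
      ext i
      have := hn i
      rw [zsmul_eq_mul, mul_one] at this
      simp only [PiLp.add_apply, scale_apply, lat_apply, this]
      ring
    have h3 : wave 0 (lat n) = 1 := by simp [wave]
    change per 0 ψ (scale s) = per 0 ψ (scale s')
    rw [h2, per_add_lat, h3, one_mul]
  exact ⟨isQuotientMap_torusMk.lift g hg, fun s =>
    congrFun (congrArg DFunLike.coe (isQuotientMap_torusMk.lift_comp g hg)) s⟩

lemma mFourier_torusMk (n : Fin 2 → ℤ) (s : Fin 2 → ℝ) :
    UnitAddTorus.mFourier n (torusMk s) = wave (freq 0 n) (scale s) := by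
  have h : UnitAddTorus.mFourier n (torusMk s)
      = ∏ i, fourier (n i) ((s i : ℝ) : UnitAddCircle) := rfl
  rw [h, Fin.prod_univ_two, fourier_coe_apply, fourier_coe_apply, ← Complex.exp_add, wave]
  congr 1
  simp only [freq_apply, scale_apply, PiLp.zero_apply]
  push_cast
  ring

lemma mFourierCoeff_eq_coef (hr : r < Real.pi) (hs : ∀ x, ψ x ≠ 0 → ‖x‖ ≤ r)
    {F : C(UnitAddTorus (Fin 2), ℂ)} (hF : ∀ s, F (torusMk s) = per 0 ψ (scale s))
    (n : Fin 2 → ℤ) : UnitAddTorus.mFourierCoeff F n = coef ψ (freq 0 n) := by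
  have hpi := Real.pi_pos
  rw [UnitAddTorus.mFourierCoeff_eq_integral F n (fun _ => -(1 / 2))]
  -- the fundamental domain of `UnitAddTorus` is half-open on the left, the cell on the right;
  -- `ψ` vanishes near the boundary, where they differ
  have h0 : ∀ s : Fin 2 → ℝ, (∀ i, s i ∈ Ioc (-(1 / 2) : ℝ) (-(1 / 2) + 1)) →
      per 0 ψ (scale s) = ψ (scale s) := by
    intro s hsI
    by_cases hc : scale s ∈ cell
    · exact per_eq ψ hc
    · have h1 : ψ (scale s) = 0 := by
        by_contra hne
        exact hc (mem_cell_of_norm_lt ((hs _ hne).trans_lt hr))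
      rw [h1, per]
      by_contra hne
      have h2 := hs _ (right_ne_zero_of_mul hne)
      apply hc
      have h3 : idx (scale s) = 0 := by
        ext i
        have h4 := abs_le.1 ((abs_apply_le_norm _ i).trans h2)
        rw [PiLp.sub_apply, lat_apply, scale_apply] at h4
        have h5 := hsI i
        have h6 : (idx (scale s) i : ℝ) < 1 := by
          by_contra hcon
          nlinarith [h5.2]
        have h7 : (-1 : ℝ) < idx (scale s) i := by
          by_contra hcon
          nlinarith [h5.1]
        have h8 : idx (scale s) i < 1 := by exact_mod_cast h6
        have h9 : -1 < idx (scale s) i := by exact_mod_cast h7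
        simp only [Pi.zero_apply]
        omega
      have h4 : lat 0 = 0 := by ext i; simp [lat_apply]
      have := idx_eq_iff.1 h3
      rwa [h4, sub_zero] at this
  set H : Plane → ℂ := fun y => ψ y * conj (wave (freq 0 n) y) with hH
  have h1 : ∫ s in {s : Fin 2 → ℝ | ∀ i, s i ∈ Ioc (-(1 / 2) : ℝ) (-(1 / 2) + 1)},
      UnitAddTorus.mFourier (-n) (fun i => (s i : UnitAddCircle)) • F (fun i => s i)
      = ∫ s in {s : Fin 2 → ℝ | ∀ i, s i ∈ Ioc (-(1 / 2) : ℝ) (-(1 / 2) + 1)}, H (scale s) := by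
    refine setIntegral_congr_fun
      (MeasurableSet.univ_pi' fun i => measurableSet_Ioc) fun s hsI => ?_
    have e1 : F (fun i => (s i : UnitAddCircle)) = ψ (scale s) := (hF s).trans (h0 s hsI)
    have e2 : UnitAddTorus.mFourier (-n) (fun i => (s i : UnitAddCircle))
        = conj (wave (freq 0 n) (scale s)) := by
      rw [UnitAddTorus.mFourier_neg]
      exact congrArg _ (mFourier_torusMk n s)
    simp only [e1, e2, hH, smul_eq_mul]
    ring
  rw [h1, setIntegral_eq_integral_of_forall_compl_eq_zero]
  · have h2 : ∫ s : Fin 2 → ℝ, H (scale s) = ∫ y : Plane, H ((2 * Real.pi) • y) :=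
      (PiLp.volume_preserving_toLp (Fin 2)).integral_comp
        (MeasurableEquiv.toLp 2 (Fin 2 → ℝ)).measurableEmbedding
        (fun y : Plane => H ((2 * Real.pi) • y))
    rw [h2, Measure.integral_comp_smul, coef, finrank_euclideanSpace_fin, abs_of_pos (by positivity),
      Complex.real_smul]
    push_cast
    rfl
  · intro s hsI
    have : ψ (scale s) = 0 := by
      by_contra hne
      apply hsI
      intro i
      have h4 := abs_le.1 ((abs_apply_le_norm _ i).trans (hs _ hne))
      rw [scale_apply] at h4
      constructor
      · by_contra hcon
        nlinarith
      · by_contra hcon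
        nlinarith
    simp [hH, this]

lemma zero_mem_dualCell : (0 : Plane) ∈ dualCell := fun i => by simp

lemma hasSum_wave_zero (hψ : CTest ψ) (hr : r < Real.pi) (hs : ∀ x, ψ x ≠ 0 → ‖x‖ ≤ r)
    {x : Plane} (hx : x ∈ cell) :
    HasSum (fun k => coef ψ (freq 0 k) * wave (freq 0 k) x) (ψ x) := by
  obtain ⟨F, hF⟩ := exists_torus_function hψ hr hs
  have hc := mFourierCoeff_eq_coef hr hs hF
  have hsum : Summable (UnitAddTorus.mFourierCoeff F) := by
    refine Summable.of_norm ?_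
    simp only [hc]
    exact summable_coef hψ zero_mem_dualCell
  have hpi := Real.pi_pos
  set s : Fin 2 → ℝ := fun i => (2 * Real.pi)⁻¹ * x i with hsd
  have hsx : scale s = x := by
    ext i
    rw [scale_apply, hsd]
    field_simp
  have h := UnitAddTorus.hasSum_mFourier_series_apply_of_summable hsum (torusMk s)
  simp only [hc, hF, mFourier_torusMk, hsx, smul_eq_mul] at h
  rwa [per_eq ψ hx] at h

/-- Fourier inversion on the cell in terms of `θ`-quasi-periodic plane waves. -/
lemma hasSum_wave (hψ : CTest ψ) (hr : r < Real.pi) (hs : ∀ x, ψ x ≠ 0 → ‖x‖ ≤ r) (θ : Plane)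
    {x : Plane} (hx : x ∈ cell) :
    HasSum (fun k => coef ψ (freq θ k) * wave (freq θ k) x) (ψ x) := by
  have h := (hasSum_wave_zero (hψ.mul_conj_wave θ) hr
    (fun x hx => hs x (left_ne_zero_of_mul hx)) hx).mul_left (wave θ x)
  have e1 : wave θ x * (ψ x * conj (wave θ x)) = ψ x := by
    linear_combination ψ x * wave_mul_conj θ x
  rw [e1] at h
  refine h.congr_fun fun k => ?_
  have e2 : coef (fun x => ψ x * conj (wave θ x)) (freq 0 k) = coef ψ (freq θ k) := by
    rw [coef, coef]
    congr 1
    refine integral_congr_ae (ae_of_all _ fun y => ?_)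
    simp only
    rw [freq_eq_add θ k, wave_add_left, map_mul]
    ring
  rw [e2, freq_eq_add θ k, wave_add_left]
  ring

end Inversion

/-! ### Integration by parts on the cell -/

lemma measurableSet_cell : MeasurableSet cell := by
  have : cell = ⋂ i, (fun x : Plane => x i) ⁻¹' Ico (-Real.pi) Real.pi := by
    ext x; simp [cell]
  rw [this]
  exact MeasurableSet.iInter fun i => measurableSet_Ico.preimage (by fun_prop)

lemma cell_subset_closedBall : cell ⊆ Metric.closedBall 0 (2 * Real.pi) := by
  intro x hx
  have hpi := Real.pi_pos
  have h : ∀ i, x i ^ 2 ≤ Real.pi ^ 2 := fun i =>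
    sq_le_sq' (by linarith [(hx i).1]) (hx i).2.le
  rw [mem_closedBall_zero_iff, ← sq_le_sq₀ (norm_nonneg _) (by positivity),
    EuclideanSpace.real_norm_sq_eq, Fin.sum_univ_two]
  nlinarith [h 0, h 1]

lemma integrableOn_cell_of_locallyIntegrable {u : Plane → ℂ} (hu : LocallyIntegrable u) :
    IntegrableOn u cell :=
  (hu.integrableOn_isCompact (isCompact_closedBall 0 _)).mono_set cell_subset_closedBall

lemma integrableOn_cell {u : Plane → ℂ} (hu : Continuous u) : IntegrableOn u cell :=
  integrableOn_cell_of_locallyIntegrable hu.locallyIntegrable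

lemma setIntegral_cell (u : Plane → ℂ) :
    ∫ x in cell, u x
      = ∫ s in Icc (fun _ : Fin 2 => -Real.pi) (fun _ => Real.pi), u (WithLp.toLp 2 s) := by
  have h := (PiLp.volume_preserving_toLp (Fin 2)).setIntegral_preimage_emb
    (MeasurableEquiv.toLp 2 (Fin 2 → ℝ)).measurableEmbedding u cell
  rw [← h, volume_pi, ← setIntegral_congr_set Measure.univ_pi_Ico_ae_eq_Icc]
  congr 2
  ext s
  simp [cell]

lemma integral_cell_pd {F : Plane → ℂ} (hF : ContDiff ℝ ∞ F)
    (hper : ∀ (x : Plane) (j : Fin 2), F (x + (2 * Real.pi) • e j) = F x) (j : Fin 2) :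
    ∫ x in cell, pd j F x = 0 := by
  have hpi := Real.pi_pos
  let L : (Fin 2 → ℝ) ≃L[ℝ] Plane := (EuclideanSpace.equiv (Fin 2) ℝ).symm
  have hL : ∀ s, L s = WithLp.toLp 2 s := fun s => rfl
  -- the divergence theorem for the vector field `F eⱼ`
  let f : Fin 2 → (Fin 2 → ℝ) → ℂ := fun i s => if i = j then F (L s) else 0
  let f' : Fin 2 → (Fin 2 → ℝ) → (Fin 2 → ℝ) →L[ℝ] ℂ := fun i s =>
    if i = j then (fderiv ℝ F (L s)).comp (L : (Fin 2 → ℝ) →L[ℝ] Plane) else 0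
  have hsum : ∀ s, ∑ i, f' i s (Pi.single i 1) = pd j F (WithLp.toLp 2 s) := by
    intro s
    rw [Finset.sum_eq_single j]
    · simp only [f', if_true, ContinuousLinearMap.comp_apply, pd, hL]
      rfl
    · intro i _ hij
      simp [f', hij]
    · simp
  have h := integral_divergence_of_hasFDerivAt_off_countable' (fun _ : Fin 2 => -Real.pi)
    (fun _ => Real.pi) (fun _ => by linarith) f f' ∅ countable_empty
    (fun i => by
      by_cases hij : i = j
      · simp only [f, hij, if_true]
        exact (hF.continuous.comp L.continuous).continuousOn
      · simp only [f, hij, if_false]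
        exact continuousOn_const)
    (fun s _ i => by
      by_cases hij : i = j
      · simp only [f, f', hij, if_true]
        exact ((hF.differentiable (by simp)).differentiableAt.hasFDerivAt).comp s L.hasFDerivAt
      · simp only [f, f', hij, if_false]
        exact hasFDerivAt_const _ _)
    (by
      simp only [hsum]
      exact ((contDiff_pd hF j).continuous.comp L.continuous).continuousOn.integrableOn_compact
        isCompact_Icc)
  simp only [hsum] at h
  rw [setIntegral_cell, h]
  refine Finset.sum_eq_zero fun i _ => ?_
  by_cases hij : i = j
  · subst hij
    rw [sub_eq_zero]
    refine integral_congr_ae (ae_of_all _ fun y => ?_)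
    simp only [f, if_true]
    rw [← hper (L (i.insertNth (-Real.pi) y)) i]
    congr 1
    ext l
    rw [PiLp.add_apply, hL, hL]
    rcases Fin.eq_self_or_eq_succAbove i l with hl | ⟨k, hl⟩
    · subst hl
      simp [e]
      ring
    · subst hl
      simp [e]
  · simp [f, hij]

lemma pd_congr {f g : Plane → ℂ} {x : Plane} (h : f =ᶠ[𝓝 x] g) (i : Fin 2) :
    pd i f =ᶠ[𝓝 x] pd i g := by
  filter_upwards [h.fderiv (𝕜 := ℝ)] with y hy
  rw [pd, pd, hy]

lemma isQuasiPeriodic_pd {θ : Plane} {φ : Plane → ℂ} (hφ : ContDiff ℝ ∞ φ)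
    (hq : IsQuasiPeriodic θ φ) (i : Fin 2) : IsQuasiPeriodic θ (pd i φ) := by
  intro x j
  have h1 : (fun x => φ (x - -((2 * Real.pi) • e j)))
      = fun x => Complex.exp (2 * Real.pi * θ j * Complex.I) * φ x := by
    ext x
    rw [sub_neg_eq_add, hq]
  have h2 := pd_comp_sub (φ := φ) (-((2 * Real.pi) • e j)) i
  rw [h1, pd_const_mul (hφ.differentiable (by simp))] at h2
  have h3 := congrFun h2 x
  simp only [sub_neg_eq_add] at h3
  exact h3.symm

lemma isPeriodic_mul_conj {θ : Plane} {u v : Plane → ℂ} (hu : IsQuasiPeriodic θ u)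
    (hv : IsQuasiPeriodic θ v) (x : Plane) (j : Fin 2) :
    u (x + (2 * Real.pi) • e j) * conj (v (x + (2 * Real.pi) • e j)) = u x * conj (v x) := by
  rw [hu, hv, map_mul]
  have h : Complex.exp (2 * Real.pi * θ j * Complex.I)
      * conj (Complex.exp (2 * Real.pi * θ j * Complex.I)) = 1 := by
    rw [Complex.mul_conj, Complex.normSq_eq_norm_sq]
    have := Complex.norm_exp_ofReal_mul_I (2 * Real.pi * θ j)
    push_cast at this
    rw [this]
    simp
  linear_combination (u x * conj (v x)) * h

lemma conj_laplacian {φ : Plane → ℂ} (hφ : ContDiff ℝ ∞ φ) (x : Plane) :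
    conj (Laplacian.laplacian φ x)
      = pd 0 (pd 0 fun x => conj (φ x)) x + pd 1 (pd 1 fun x => conj (φ x)) x := by
  rw [laplacian_eq_pd (hφ.of_le (by norm_cast)), map_add,
    pd_conj (hφ.differentiable (by simp)), pd_conj (hφ.differentiable (by simp)),
    pd_conj ((contDiff_pd hφ 0).differentiable (by simp)),
    pd_conj ((contDiff_pd hφ 1).differentiable (by simp))]

lemma integral_cell_wave_mul_pd_pd {θ : Plane} {φ : Plane → ℂ} (hφ : ContDiff ℝ ∞ φ)
    (hq : IsQuasiPeriodic θ φ) (k : Fin 2 → ℤ) (j : Fin 2) :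
    ∫ x in cell, wave (freq θ k) x * conj (pd j (pd j φ) x)
      = -((freq θ k j ^ 2 : ℝ) : ℂ) * ∫ x in cell, wave (freq θ k) x * conj (φ x) := by
  set ξ := freq θ k with hξ
  have hw := contDiff_wave ξ
  have hwq := isQuasiPeriodic_wave θ k
  have hc : ∀ {u : Plane → ℂ}, ContDiff ℝ ∞ u → ContDiff ℝ ∞ (fun x => conj (u x)) :=
    fun h => Complex.conjCLE.contDiff.comp h
  have hd : ∀ {u : Plane → ℂ}, ContDiff ℝ ∞ u → Differentiable ℝ u :=
    fun h => h.differentiable (by simp)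
  have hp := contDiff_pd hφ j
  -- Green's second identity: the boundary terms cancel, the products being periodic
  have h0 := integral_cell_pd (F := fun x => wave ξ x * conj (pd j φ x) - pd j (wave ξ) x
      * conj (φ x)) ((hw.mul (hc hp)).sub ((contDiff_pd hw j).mul (hc hφ)))
    (fun x l => by
      rw [isPeriodic_mul_conj hwq (isQuasiPeriodic_pd hφ hq j),
        isPeriodic_mul_conj (isQuasiPeriodic_pd hw hwq j) hq]) j
  have h1 : pd j (fun x => wave ξ x * conj (pd j φ x) - pd j (wave ξ) x * conj (φ x))
      = fun x => wave ξ x * conj (pd j (pd j φ) x)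
        + ((ξ j ^ 2 : ℝ) : ℂ) * (wave ξ x * conj (φ x)) := by
    have hu : Differentiable ℝ (fun x => wave ξ x * conj (pd j φ x)) := (hd hw).mul (hd (hc hp))
    have hv : Differentiable ℝ (fun x => pd j (wave ξ) x * conj (φ x)) :=
      (hd (contDiff_pd hw j)).mul (hd (hc hφ))
    rw [pd_sub hu hv, pd_mul (hd hw) (hd (hc hp)), pd_mul (hd (contDiff_pd hw j)) (hd (hc hφ)),
      pd_conj (hd hφ), pd_conj (hd hp), pd_wave, pd_const_mul (hd hw), pd_wave]
    ext x
    push_cast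
    linear_combination -(ξ j : ℂ) ^ 2 * wave ξ x * conj (φ x) * Complex.I_sq
  rw [h1, integral_add, integral_const_mul] at h0
  · linear_combination h0
  · exact integrableOn_cell (hw.mul (hc (contDiff_pd hp j))).continuous
  · exact (integrableOn_cell (hw.mul (hc hφ)).continuous).const_mul _

/-- The square of the length of a frequency. -/
def freqSq (ξ : Plane) : ℝ := ξ 0 ^ 2 + ξ 1 ^ 2

lemma integral_cell_wave_mul_laplacian {θ : Plane} {φ : Plane → ℂ} (hφ : ContDiff ℝ ∞ φ)
    (hq : IsQuasiPeriodic θ φ) (k : Fin 2 → ℤ) :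
    ∫ x in cell, wave (freq θ k) x * conj (Laplacian.laplacian φ x)
      = -(freqSq (freq θ k) : ℂ) * ∫ x in cell, wave (freq θ k) x * conj (φ x) := by
  have hl : ∀ x, wave (freq θ k) x * conj (Laplacian.laplacian φ x)
      = wave (freq θ k) x * conj (pd 0 (pd 0 φ) x) + wave (freq θ k) x * conj (pd 1 (pd 1 φ) x) := by
    intro x
    rw [laplacian_eq_pd (hφ.of_le (by norm_cast)), map_add, mul_add]
  have hi : ∀ j, IntegrableOn (fun x => wave (freq θ k) x * conj (pd j (pd j φ) x)) cell :=
    fun j => integrableOn_cell ((contDiff_wave _).continuous.mul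
      (Complex.continuous_conj.comp (contDiff_pd (contDiff_pd hφ j) j).continuous))
  simp only [hl]
  rw [integral_add (hi 0) (hi 1), integral_cell_wave_mul_pd_pd hφ hq,
    integral_cell_wave_mul_pd_pd hφ hq, freqSq]
  push_cast
  ring

lemma laplacian_wave (ξ x : Plane) :
    Laplacian.laplacian (wave ξ) x = -(freqSq ξ : ℂ) * wave ξ x := by
  have hw := contDiff_wave ξ
  have hd : Differentiable ℝ (wave ξ) := hw.differentiable (by simp)
  rw [laplacian_eq_pd (hw.of_le (by norm_cast)), pd_wave, pd_wave, pd_const_mul hd,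
    pd_const_mul hd, pd_wave, pd_wave, freqSq]
  push_cast
  linear_combination ((ξ 0 : ℂ) ^ 2 + (ξ 1 : ℂ) ^ 2) * wave ξ x * Complex.I_sq

lemma exists_freqSq_ge {θ : Plane} (hθ : θ ∈ dualCell) (h0 : θ ≠ 0) :
    ∃ m : ℝ, 0 < m ∧ ∀ k, m ≤ freqSq (freq θ k) := by
  have hpos : 0 < freqSq θ := by
    have h1 : 0 ≤ freqSq θ := by unfold freqSq; positivity
    refine h1.lt_of_ne' fun h => h0 ?_
    unfold freqSq at h
    have a0 : θ 0 = 0 := by nlinarith [sq_nonneg (θ 0), sq_nonneg (θ 1)]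
    have a1 : θ 1 = 0 := by nlinarith [sq_nonneg (θ 0), sq_nonneg (θ 1)]
    ext i
    fin_cases i
    · exact a0
    · exact a1
  refine ⟨min (1 / 4) (freqSq θ), by positivity, fun k => ?_⟩
  by_cases hk : k = 0
  · subst hk
    refine (min_le_right _ _).trans (le_of_eq ?_)
    simp [freqSq, freq_apply]
  · refine (min_le_left _ _).trans ?_
    obtain ⟨i, hi⟩ := Function.ne_iff.1 hk
    have h1 : (1 : ℝ) ≤ |(k i : ℝ)| := by
      rw [← Int.cast_abs]
      exact_mod_cast Int.one_le_abs hi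
    have h2 := abs_le_half_of_mem_dualCell hθ i
    have h3 : 1 / 2 ≤ |θ i + k i| := by
      have := abs_sub_abs_le_abs_sub (k i : ℝ) (-θ i)
      rw [abs_neg, sub_neg_eq_add, add_comm] at this
      linarith
    have h4 : (1 / 4 : ℝ) ≤ (θ i + k i) ^ 2 := by
      rw [← sq_abs]
      nlinarith
    have h5 : (θ i + k i) ^ 2 ≤ freqSq (freq θ k) := by
      unfold freqSq
      simp only [freq_apply]
      fin_cases i
      · exact le_add_of_nonneg_right (sq_nonneg _)
      · exact le_add_of_nonneg_left (sq_nonneg _)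
    exact h4.trans h5

lemma integral_cell_tsum_wave {a : (Fin 2 → ℤ) → ℂ} (ha : Summable fun k => ‖a k‖)
    {u : Plane → ℂ} (hu : IntegrableOn u cell) (θ : Plane) :
    ∫ x in cell, (∑' k, a k * wave (freq θ k) x) * u x
      = ∑' k, a k * ∫ x in cell, wave (freq θ k) x * u x := by
  have hi : ∀ k, IntegrableOn (fun x => a k * (wave (freq θ k) x * u x)) cell := fun k =>
    (Integrable.bdd_mul hu (contDiff_wave _).continuous.aestronglyMeasurable
      (ae_of_all _ fun x => (norm_wave _ x).le)).const_mul _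
  have hn : ∀ k, ∫ x in cell, ‖a k * (wave (freq θ k) x * u x)‖
      = ‖a k‖ * ∫ x in cell, ‖u x‖ := fun k => by
    simp only [norm_mul, norm_wave, one_mul]
    rw [integral_const_mul]
  have h := integral_tsum_of_summable_integral_norm hi
    (by simp only [hn]; exact ha.mul_right _)
  simp only [integral_const_mul] at h
  rw [h]
  refine integral_congr_ae (ae_of_all _ fun x => ?_)
  simp only
  rw [← tsum_mul_right]
  refine tsum_congr fun k => ?_
  ring

/-! ### Existence of the quasi-periodic Green function -/

lemma integral_cell_sub_pot_mul_laplacian {ρ : Plane → ℝ} (hρ : IsRing 1 (3 / 2) ρ)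
    {φ : Plane → ℂ} (hφ : ContDiff ℝ ∞ φ) :
    ∫ x in cell, (ker x - pot (fun y => (ρ y : ℂ)) x) * conj (Laplacian.laplacian φ x)
      = -conj (φ 0) + ∫ x in cell, (ρ x : ℂ) * conj (φ x) := by
  set R : Plane → ℂ := fun y => (ρ y : ℂ) with hR
  have hRt : CTest R := hρ.test.ofReal
  set η : Plane → ℂ := fun x => cutoff ((1 / 2 : ℝ) • x) with hη
  have hηt : CTest η := cTest_cutoff.comp_smul (by norm_num)
  have hη1 : ∀ x : Plane, ‖x‖ ≤ 2 → η x = 1 := fun x hx => by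
    refine cutoff_eq_one ?_
    rw [norm_smul]
    norm_num
    linarith
  -- `ker - pot ρ` vanishes outside the disc of radius `3/2` by Newton's theorem, so `φ` may be
  -- cut off outside the disc of radius `2` and the cell replaced by the plane
  set ζ : Plane → ℂ := (fun x => conj (φ x)) * η with hζ
  have hcφ : ContDiff ℝ ∞ (fun x => conj (φ x)) := Complex.conjCLE.contDiff.comp hφ
  have hζt : CTest ζ := CTest.mul_left hcφ hηt
  have hpi := Real.pi_gt_three
  have hK : ∀ x : Plane, 3 / 2 ≤ ‖x‖ → ker x - pot R x = 0 := fun x hx => by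
    rw [hρ.pot_of_ge hx, sub_self]
  have hl : CTest (pd 0 (pd 0 ζ) + pd 1 (pd 1 ζ)) := ((hζt.pd 0).pd 0).add ((hζt.pd 1).pd 1)
  have h1 : ∫ x in cell, (ker x - pot R x) * conj (Laplacian.laplacian φ x)
      = ∫ x, (ker x - pot R x) * (pd 0 (pd 0 ζ) + pd 1 (pd 1 ζ)) x := by
    rw [setIntegral_eq_integral_of_forall_compl_eq_zero]
    · refine integral_congr_ae (ae_of_all _ fun x => ?_)
      simp only
      rcases lt_or_ge ‖x‖ 2 with hx | hx
      · have he : ζ =ᶠ[𝓝 x] fun x => conj (φ x) := by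
          filter_upwards [(isOpen_lt continuous_norm continuous_const).mem_nhds hx] with y hy
          rw [hζ, Pi.mul_apply, hη1 y (le_of_lt hy), mul_one]
        rw [conj_laplacian hφ, Pi.add_apply, (pd_congr (pd_congr he 0) 0).eq_of_nhds,
          (pd_congr (pd_congr he 1) 1).eq_of_nhds]
      · rw [hK x (by linarith), zero_mul, zero_mul]
    · intro x hx
      have : 3 / 2 ≤ ‖x‖ := by
        by_contra hcon
        exact hx (mem_cell_of_norm_lt (by linarith))
      rw [hK x this, zero_mul]
  rw [h1]
  simp only [sub_mul]
  rw [integral_sub (integrable_locInt_mul locallyIntegrable_ker hl.continuous hl.2)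
    (integrable_locInt_mul (contDiff_pot hRt).continuous.locallyIntegrable hl.continuous hl.2),
    integral_pot_mul hRt.integrable hRt.bddSupp hl.continuous hl.2]
  have h2 : ∀ x, pot (pd 0 (pd 0 ζ) + pd 1 (pd 1 ζ)) x = -ζ x := by
    intro x
    have h := laplacian_pot hζt x
    rw [pd_pd_pot hζt, pd_pd_pot hζt] at h
    rw [pot_add ((hζt.pd 0).pd 0) ((hζt.pd 1).pd 1), Pi.add_apply, h]
  have h3 : ζ 0 = conj (φ 0) := by rw [hζ, Pi.mul_apply, hη1 0 (by simp), mul_one]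
  have h4 : ∫ x in cell, R x * conj (φ x) = ∫ x, R x * ζ x := by
    rw [setIntegral_eq_integral_of_forall_compl_eq_zero]
    · refine integral_congr_ae (ae_of_all _ fun x => ?_)
      by_cases hx : ρ x = 0
      · simp [hR, hx]
      · simp only
        rw [hζ, Pi.mul_apply, hη1 x (by linarith [(hρ.support x hx).2]), mul_one]
    · intro x hx
      by_cases hx0 : ρ x = 0
      · simp [hR, hx0]
      · exact absurd (mem_cell_of_norm_lt (by linarith [(hρ.support x hx0).2])) hx
  simp only [h2, mul_neg]
  rw [h4, integral_neg, sub_neg_eq_add, ← h3, ← integral_ker_mul_laplacian hζt]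
  rfl

/-- The Green function is the periodization of the compactly supported function `ker - pot ρ`, with
`ρ` an annular density, plus the Fourier series that solves `-Δ h = ρ` on the cell. -/
lemma exists_isRegularPart {θ : Plane} (hθ : θ ∈ dualCell) (h0 : θ ≠ 0) :
    ∃ g, IsRegularPart θ g := by
  obtain ⟨ρ, hρ⟩ := exists_isRing (a := 1) (b := 3 / 2) one_pos (by norm_num)
  obtain ⟨m, hm, hmk⟩ := exists_freqSq_ge hθ h0
  set R : Plane → ℂ := fun y => (ρ y : ℂ) with hR
  have hRt : CTest R := hρ.test.ofReal
  have hpi := Real.pi_gt_three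
  set K : Plane → ℂ := fun x => ker x - pot R x with hK
  set a : (Fin 2 → ℤ) → ℂ := fun k => coef R (freq θ k) / (freqSq (freq θ k) : ℂ) with ha
  have has : Summable fun k => ‖a k‖ := by
    refine Summable.of_nonneg_of_le (fun k => norm_nonneg _) (fun k => ?_)
      ((summable_coef hRt hθ).mul_left m⁻¹)
    have h1 := hmk k
    rw [ha, norm_div, Complex.norm_real, Real.norm_of_nonneg (hm.le.trans h1), div_eq_inv_mul]
    gcongr
  set h : Plane → ℂ := fun x => ∑' k, a k * wave (freq θ k) x with hh
  have hhc : Continuous h := by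
    refine continuous_tsum (fun k => continuous_const.mul (contDiff_wave _).continuous) has
      fun k x => ?_
    rw [norm_mul, norm_wave, mul_one]
  have hhq : IsQuasiPeriodic θ h := by
    intro x j
    simp only [hh]
    rw [← tsum_mul_left]
    refine tsum_congr fun k => ?_
    rw [isQuasiPeriodic_wave θ k x j]
    ring
  have hKi : IntegrableOn K cell := integrableOn_cell_of_locallyIntegrable
    (locallyIntegrable_ker.sub (contDiff_pot hRt).continuous.locallyIntegrable)
  set G : Plane → ℂ := fun x => per θ K x + h x with hG
  have hGc : ∀ x ∈ cell, G x = K x + h x := fun x hx => by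
    rw [hG]; simp only [per_eq K hx]
  have hgreen : IsGreen θ G := by
    refine ⟨fun x j => ?_, ?_, fun φ hφ hq => ?_⟩
    · simp only [hG]
      rw [isQuasiPeriodic_per θ K x j, hhq x j, mul_add]
    · exact (hKi.add (integrableOn_cell hhc)).congr_fun (fun x hx => (hGc x hx).symm)
        measurableSet_cell
    · have hlc : Continuous (fun x => conj (Laplacian.laplacian φ x)) := by
        simp only [conj_laplacian hφ]
        have hcφ : ContDiff ℝ ∞ (fun x => conj (φ x)) := Complex.conjCLE.contDiff.comp hφ
        exact (contDiff_pd (contDiff_pd hcφ 0) 0).continuous.add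
          (contDiff_pd (contDiff_pd hcφ 1) 1).continuous
      have e1 : ∫ x in cell, G x * conj (Laplacian.laplacian φ x)
          = (∫ x in cell, K x * conj (Laplacian.laplacian φ x))
            + ∫ x in cell, h x * conj (Laplacian.laplacian φ x) := by
        rw [← integral_add]
        · refine setIntegral_congr_fun measurableSet_cell fun x hx => ?_
          simp only [hGc x hx, add_mul]
        · have hloc := (locallyIntegrable_ker.sub
            (contDiff_pot hRt).continuous.locallyIntegrable).integrableOn_isCompact
              (isCompact_closedBall 0 (2 * Real.pi))
          exact (hloc.mul_continuousOn hlc.continuousOn (isCompact_closedBall _ _)).mono_set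
            cell_subset_closedBall
        · exact integrableOn_cell (hhc.mul hlc)
      have e2 : ∫ x in cell, h x * conj (Laplacian.laplacian φ x)
          = -∫ x in cell, R x * conj (φ x) := by
        have hcc : Continuous (fun x => conj (φ x)) := Complex.continuous_conj.comp hφ.continuous
        have hs : ∀ x ∈ cell, R x = ∑' k, coef R (freq θ k) * wave (freq θ k) x := fun x hx =>
          (hasSum_wave hRt (r := 3 / 2) (by linarith)
            (fun x hx => (hρ.support x (by simpa [hR] using hx)).2) θ hx).tsum_eq.symm
        have e3 : ∫ x in cell, R x * conj (φ x)
            = ∫ x in cell, (∑' k, coef R (freq θ k) * wave (freq θ k) x) * conj (φ x) :=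
          setIntegral_congr_fun measurableSet_cell fun x hx => by simp only [← hs x hx]
        rw [e3, integral_cell_tsum_wave (summable_coef hRt hθ) (integrableOn_cell hcc), hh,
          integral_cell_tsum_wave has (integrableOn_cell hlc), ← tsum_neg]
        refine tsum_congr fun k => ?_
        rw [integral_cell_wave_mul_laplacian hφ hq, ha]
        have : (freqSq (freq θ k) : ℂ) ≠ 0 := by
          exact_mod_cast (hm.trans_le (hmk k)).ne'
        field_simp
      rw [e1, e2, hK, integral_cell_sub_pot_mul_laplacian hρ hφ]
      ring
  refine ⟨fun x => G x + ((1 / (2 * Real.pi) * Real.log ‖x‖ : ℝ) : ℂ), ?_, ?_⟩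
  · simpa only [add_sub_cancel_right] using hgreen
  · refine ContinuousOn.congr (f := fun x => h x - pot R x)
      (hhc.sub (contDiff_pot hRt).continuous).continuousOn fun x hx => ?_
    have hxc : x ∈ cell := fun i => ⟨(hx i).1.le, (hx i).2⟩
    simp only [hGc x hxc, hK, ker]
    push_cast
    ring

/-! ### A lower bound for the regular part at the origin -/

lemma IsRing.neg (a b : ℝ) {ρ : Plane → ℝ} (h : IsRing a b ρ) (x : Plane) : ρ (-x) = ρ x := by
  obtain ⟨F, hF⟩ := h.radial
  rw [hF, hF, norm_neg]

/-- A Green function can be tested against smooth functions supported in a disc in the interior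
of the cell, since these have quasi-periodic extensions. -/
lemma IsGreen.integral_mul_laplacian {θ : Plane} {G φ : Plane → ℂ} (hG : IsGreen θ G)
    (hφ : ContDiff ℝ ∞ φ) {r : ℝ} (hr : r < Real.pi) (hs : ∀ x, φ x ≠ 0 → ‖x‖ ≤ r) :
    ∫ x in cell, G x * conj (pd 0 (pd 0 φ) x + pd 1 (pd 1 φ) x) = -conj (φ 0) := by
  have hp := contDiff_per hφ hr hs θ
  have h := hG.2.2 (per θ φ) hp (isQuasiPeriodic_per θ φ)
  have h0 : (0 : Plane) ∈ cell := mem_cell_of_norm_lt (by simpa using Real.pi_pos)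
  rw [per_eq φ h0] at h
  rw [← h, neg_neg]
  refine setIntegral_congr_fun measurableSet_cell fun x hx => ?_
  have he := per_eventuallyEq_self hr hs θ hx
  rw [laplacian_eq_pd (hp.of_le (by norm_cast)), (pd_congr (pd_congr he 0) 0).eq_of_nhds,
    (pd_congr (pd_congr he 1) 1).eq_of_nhds]

lemma IsGreen.integral_wave_mul_conj {θ : Plane} {G : Plane → ℂ} (hG : IsGreen θ G)
    {k : Fin 2 → ℤ} (hk : freqSq (freq θ k) ≠ 0) :
    ∫ x in cell, wave (freq θ k) x * conj (G x) = ((freqSq (freq θ k))⁻¹ : ℝ) := by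
  have h := hG.2.2 _ (contDiff_wave (freq θ k)) (isQuasiPeriodic_wave θ k)
  rw [wave_zero, map_one] at h
  have h1 : ∀ x, G x * conj (Laplacian.laplacian (wave (freq θ k)) x)
      = -(freqSq (freq θ k) : ℂ) * conj (wave (freq θ k) x * conj (G x)) := by
    intro x
    rw [laplacian_wave]
    simp only [map_mul, map_neg, Complex.conj_ofReal, Complex.conj_conj]
    ring
  simp only [h1] at h
  rw [integral_const_mul, integral_conj, neg_mul, neg_neg] at h
  have hk' : (freqSq (freq θ k) : ℂ) ≠ 0 := by exact_mod_cast hk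
  have h2 := congrArg conj h
  rw [map_mul, Complex.conj_conj, Complex.conj_ofReal, map_one] at h2
  push_cast
  exact eq_inv_of_mul_eq_one_right h2

section Autocorrelation

variable {a b : ℝ} {ρ : Plane → ℝ}

/-- The convolution square of an annular density. -/
def autoconv (ρ : Plane → ℝ) : Plane → ℂ := convK (fun x => (ρ x : ℂ)) fun x => (ρ x : ℂ)

lemma autoconv_support (h : IsRing a b ρ) {x : Plane} (hx : autoconv ρ x ≠ 0) :
    ‖x‖ ≤ 2 * b := by
  by_contra hcon
  refine hx ?_
  rw [autoconv, convK]
  refine integral_eq_zero_of_ae (ae_of_all _ fun y => ?_)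
  by_contra hne
  have h1 : ρ (x - y) ≠ 0 := fun h0 => hne (by simp [h0])
  have h2 : ρ y ≠ 0 := fun h0 => hne (by simp [h0])
  have h3 := norm_add_le (x - y) y
  rw [sub_add_cancel] at h3
  linarith [(h.support _ h1).2, (h.support _ h2).2]

lemma cTest_autoconv (h : IsRing a b ρ) : CTest (autoconv ρ) :=
  ⟨contDiff_convK h.test.ofReal.continuous.locallyIntegrable h.test.ofReal,
    HasCompactSupport.of_support_subset_isCompact (isCompact_closedBall 0 (2 * b)) fun x hx => by
      simpa using autoconv_support h hx⟩

lemma conj_autoconv (ρ : Plane → ℝ) (x : Plane) : conj (autoconv ρ x) = autoconv ρ x := by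
  rw [autoconv, convK, ← integral_conj]
  simp

/-- The Fourier coefficients of a convolution square of an even function are squares of real
numbers. -/
lemma exists_coef_autoconv (h : IsRing a b ρ) (ξ : Plane) :
    ∃ c : ℝ, 0 ≤ c ∧ coef (autoconv ρ) ξ = c := by
  set R : Plane → ℂ := fun x => (ρ x : ℂ) with hR
  have hRt : CTest R := h.test.ofReal
  set u : Plane → ℂ := fun x => R x * conj (wave ξ x) with hu
  have hut : CTest u := hRt.mul_conj_wave ξ
  have h1 : ∀ x, autoconv ρ x * conj (wave ξ x)
      = MeasureTheory.convolution u u (ContinuousLinearMap.mul ℝ ℂ) volume x := by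
    intro x
    rw [← convK_eq_convolution, autoconv, convK, convK, ← integral_mul_const]
    refine integral_congr_ae (ae_of_all _ fun y => ?_)
    have : wave ξ x = wave ξ (x - y) * wave ξ y := by rw [← wave_add_right, sub_add_cancel]
    simp only [hu, hR, this, map_mul]
    ring
  have h2 : ∫ x, autoconv ρ x * conj (wave ξ x) = (∫ x, u x) * ∫ x, u x := by
    simp only [h1]
    rw [integral_convolution (ContinuousLinearMap.mul ℝ ℂ) hut.integrable hut.integrable]
    rfl
  have h3 : conj (∫ x, u x) = ∫ x, u x := by
    rw [← integral_conj, ← integral_neg_eq_self]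
    refine integral_congr_ae (ae_of_all _ fun x => ?_)
    simp only [hu, hR, h.neg, wave_neg, map_mul, Complex.conj_conj, Complex.conj_ofReal]
  obtain ⟨t, ht⟩ := Complex.conj_eq_iff_real.1 h3
  refine ⟨((2 * Real.pi) ^ 2)⁻¹ * (t * t), mul_nonneg (by positivity) (mul_self_nonneg t), ?_⟩
  rw [coef, h2, ht]
  push_cast
  ring

lemma pot_autoconv (h : IsRing a b ρ) (x : Plane) :
    pot (autoconv ρ) x = ∫ y, (ρ y : ℂ) * pot (fun z => (ρ z : ℂ)) (x - y) := by
  set R : Plane → ℂ := fun x => (ρ x : ℂ) with hR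
  have hRt : CTest R := h.test.ofReal
  have hn : Continuous (fun x => ‖R x‖) := hRt.continuous.norm
  have hns : HasCompactSupport (fun x => ‖R x‖) := hRt.2.norm
  have hassoc := convolution_assoc (ContinuousLinearMap.mul ℝ ℂ) (ContinuousLinearMap.mul ℝ ℂ)
    (ContinuousLinearMap.mul ℝ ℂ) (ContinuousLinearMap.mul ℝ ℂ) (f := ker) (g := R) (k := R)
    (μ := volume) (ν := volume) (fun x y z => mul_assoc x y z) (x₀ := x)
    measurable_ker.aestronglyMeasurable hRt.continuous.aestronglyMeasurable
    hRt.continuous.aestronglyMeasurable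
    (ae_of_all _ (hRt.2.convolutionExists_right _ locallyIntegrable_ker hRt.continuous))
    (ae_of_all _ (hns.convolutionExists_right _ hn.locallyIntegrable hn))
    ((hns.convolution _ hns).convolutionExists_right _ (fun y => (locallyIntegrable_ker y).imp fun s hs => ⟨hs.1, hs.2.norm⟩)
      (hns.continuous_convolution_right _ hn.locallyIntegrable hn) x)
  rw [← convK_eq_convolution, ← convK_eq_convolution, ← convK_eq_convolution,
    ← convK_eq_convolution] at hassoc
  rw [pot, autoconv, ← hassoc, convK]
  refine integral_congr_ae (ae_of_all _ fun y => ?_)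
  exact mul_comm _ _

lemma pot_autoconv_of_ge (h : IsRing a b ρ) {x : Plane} (hx : 2 * b ≤ ‖x‖) :
    pot (autoconv ρ) x = ker x := by
  have hb : ∀ y, ρ y ≠ 0 → b ≤ ‖x - y‖ ∧ 0 ≤ b := fun y hy => by
    have h1 := (h.support y hy).2
    have h2 := norm_sub_norm_le x y
    exact ⟨by linarith, (norm_nonneg y).trans h1⟩
  have hb0 : 0 ≤ b := by
    by_contra hcon
    have : ∀ y, ρ y = 0 := fun y => by
      by_contra hy
      exact hcon (hb y hy).2
    have h1 := h.integral
    simp [this] at h1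
  have h1 : ker x = ∫ y, ker (x - y) * (ρ y : ℂ) := (h.pot_of_ge (by linarith)).symm
  rw [h1, pot_autoconv h]
  refine integral_congr_ae (ae_of_all _ fun y => ?_)
  by_cases hy : ρ y = 0
  · simp [hy]
  · simp only
    rw [h.pot_of_ge (hb y hy).1, mul_comm]

lemma re_pot_autoconv_zero_le (h : IsRing a b ρ) (ha : 0 < a) :
    (pot (autoconv ρ) 0).re ≤ -(1 / (2 * Real.pi)) * Real.log a := by
  have h1 : ∀ y, (ρ y : ℂ) * pot (fun z => (ρ z : ℂ)) (0 - y)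
      = ((ρ y * (pot (fun z => (ρ z : ℂ)) (0 - y)).re : ℝ) : ℂ) := by
    intro y
    have := Complex.conj_eq_iff_re.1 (h.conj_pot (0 - y))
    rw [Complex.ofReal_mul, this]
  have hc : Continuous (pot fun z => (ρ z : ℂ)) := (contDiff_pot h.test.ofReal).continuous
  rw [pot_autoconv h]
  simp only [h1]
  rw [integral_complex_ofReal, Complex.ofReal_re]
  calc _ ≤ ∫ y, ρ y * (-(1 / (2 * Real.pi)) * Real.log a) := by
        refine integral_mono ?_ ?_ fun y =>
          mul_le_mul_of_nonneg_left (h.re_pot_le ha _) (h.nonneg y)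
        · refine Continuous.integrable_of_hasCompactSupport ?_ h.test.2.mul_right
          exact h.test.1.continuous.mul
            (Complex.continuous_re.comp (hc.comp (continuous_const.sub continuous_id)))
        · exact (h.test.1.continuous.integrable_of_hasCompactSupport h.test.2).mul_const _
    _ = _ := by rw [integral_mul_const, h.integral, one_mul]

end Autocorrelation

/-- The Fourier coefficients of the convolution square and of the Green function are
non-negative. -/
lemma IsGreen.re_integral_autoconv_nonneg {θ : Plane} (hθ : θ ∈ dualCell) (h0 : θ ≠ 0)
    {G : Plane → ℂ} (hG : IsGreen θ G) {a b : ℝ} (hb : 2 * b < Real.pi) {ρ : Plane → ℝ}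
    (hρ : IsRing a b ρ) : 0 ≤ (∫ x in cell, G x * autoconv ρ x).re := by
  obtain ⟨m, hm, hmk⟩ := exists_freqSq_ge hθ h0
  choose c hc0 hc using fun k => exists_coef_autoconv hρ (freq θ k)
  have hs : ∀ x ∈ cell, autoconv ρ x
      = ∑' k, coef (autoconv ρ) (freq θ k) * wave (freq θ k) x := fun x hx =>
    (hasSum_wave (cTest_autoconv hρ) hb (fun x hx => autoconv_support hρ hx) θ hx).tsum_eq.symm
  have h1 : ∫ x in cell, G x * autoconv ρ x = conj (∫ x in cell, autoconv ρ x * conj (G x)) := by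
    rw [← integral_conj]
    refine integral_congr_ae (ae_of_all _ fun x => ?_)
    simp only [map_mul, Complex.conj_conj, conj_autoconv]
    ring
  have h2 : ∫ x in cell, autoconv ρ x * conj (G x)
      = ∑' k, coef (autoconv ρ) (freq θ k) * ∫ x in cell, wave (freq θ k) x * conj (G x) := by
    have hi : IntegrableOn (fun x => conj (G x)) cell :=
      Complex.conjCLE.integrable_comp_iff.2 hG.2.1
    rw [← integral_cell_tsum_wave (summable_coef (cTest_autoconv hρ) hθ) hi]
    exact setIntegral_congr_fun measurableSet_cell fun x hx => by simp only [← hs x hx]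
  rw [h1, Complex.conj_re, h2]
  have h3 : ∀ k, coef (autoconv ρ) (freq θ k) * ∫ x in cell, wave (freq θ k) x * conj (G x)
      = ((c k * (freqSq (freq θ k))⁻¹ : ℝ) : ℂ) := by
    intro k
    rw [hG.integral_wave_mul_conj (hm.trans_le (hmk k)).ne', hc]
    push_cast
    rfl
  simp only [h3]
  rw [← Complex.ofReal_tsum, Complex.ofReal_re]
  exact tsum_nonneg fun k => mul_nonneg (hc0 k) (inv_nonneg.2 (hm.le.trans (hmk k)))

lemma IsRegularPart.le_re_zero {θ : Plane} (hθ : θ ∈ dualCell) (h0 : θ ≠ 0) {g : Plane → ℂ}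
    (hg : IsRegularPart θ g) : 1 / (2 * Real.pi) * Real.log (3 / 2) ≤ (g 0).re := by
  have hpi := Real.pi_gt_d2
  -- an inner radius `3/2`, with `2 * (25 / 16) < π` so that the convolution square fits in the cell
  obtain ⟨ρ, hρ⟩ := exists_isRing (a := 3 / 2) (b := 25 / 16) (by norm_num) (by norm_num)
  set G : Plane → ℂ := fun x => g x - ((1 / (2 * Real.pi) * Real.log ‖x‖ : ℝ) : ℂ) with hGd
  have hG : IsGreen θ G := hg.1
  have hGg : ∀ x, G x = g x + ker x := fun x => by
    simp only [hGd, ker]; push_cast; ring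
  have hψt := cTest_autoconv hρ
  have hpos := hG.re_integral_autoconv_nonneg hθ h0 (by linarith) hρ
  have hU : IsOpen {x : Plane | ∀ i, x i ∈ Ioo (-Real.pi) Real.pi} := by
    have : {x : Plane | ∀ i, x i ∈ Ioo (-Real.pi) Real.pi}
        = ⋂ i, (fun x : Plane => x i) ⁻¹' Ioo (-Real.pi) Real.pi := by ext x; simp
    rw [this]
    exact isOpen_iInter_of_finite fun i => isOpen_Ioo.preimage (by fun_prop)
  have hcont : ContinuousAt g 0 :=
    hg.2.continuousAt (hU.mem_nhds fun i => by simp [Real.pi_pos])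
  refine le_of_forall_pos_le_add fun η hη => ?_
  obtain ⟨ε, hε, hεg⟩ := Metric.continuousAt_iff.1 hcont η hη
  set s := min (ε / 2) 1 with hs
  have hs0 : 0 < s := by positivity
  have hsε : s < ε := (min_le_left _ _).trans_lt (by linarith)
  have hs1 : s ≤ 1 := min_le_right _ _
  -- the density that concentrates at the origin
  obtain ⟨σ, hσ⟩ := exists_isRing (a := s / 2) (b := s) (by positivity) (by linarith)
  set S : Plane → ℂ := fun x => (σ x : ℂ) with hS
  have hSt : CTest S := hσ.test.ofReal
  set φ : Plane → ℂ := pot (S - autoconv ρ) with hφ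
  have hdt : CTest (S - autoconv ρ) := hSt.sub hψt
  have hφe : ∀ x, φ x = pot S x - pot (autoconv ρ) x := fun x => by
    have : S - autoconv ρ = S + (-1 : ℂ) • autoconv ρ := by
      rw [neg_one_smul, sub_eq_add_neg]
    have hneg : CTest ((-1 : ℂ) • autoconv ρ) := hψt.const_mul _
    rw [hφ, this, pot_add hSt hneg, pot_smul, Pi.add_apply, Pi.smul_apply, neg_one_smul,
      sub_eq_add_neg]
  -- both densities are radial of mass `1` with support in the disc of radius `25/8 < π`
  have hφs : ∀ x, φ x ≠ 0 → ‖x‖ ≤ 25 / 8 := by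
    intro x hx
    by_contra hcon
    apply hx
    rw [hφe, hσ.pot_of_ge (by linarith), pot_autoconv_of_ge hρ (by linarith), sub_self]
  have h1 := hG.integral_mul_laplacian (contDiff_pot hdt) (r := 25 / 8) (by linarith) hφs
  have h2 : ∀ x, conj (pd 0 (pd 0 (pot (S - autoconv ρ))) x
      + pd 1 (pd 1 (pot (S - autoconv ρ))) x) = autoconv ρ x - S x := by
    intro x
    rw [laplacian_pot hdt, Pi.sub_apply, map_neg, map_sub, conj_autoconv]
    simp [hS]
  simp only [h2] at h1
  have hbdd : ∀ {u : Plane → ℂ}, CTest u → IntegrableOn (fun x => G x * u x) cell := by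
    intro u hu
    obtain ⟨C, -, hC⟩ := hu.norm_bdd
    exact Integrable.mul_bdd hG.2.1 hu.continuous.aestronglyMeasurable (ae_of_all _ hC)
  have hkS : IntegrableOn (fun x => ker x * S x) cell :=
    (integrable_locInt_mul locallyIntegrable_ker hSt.continuous hSt.2).integrableOn
  have hgS : IntegrableOn (fun x => g x * S x) cell := by
    refine ((hbdd hSt).sub hkS).congr (ae_of_all _ fun x => ?_)
    simp only [Pi.sub_apply, hGg]
    ring
  have hsupp : ∀ x, x ∉ cell → S x = 0 := fun x hx => by
    by_contra hne
    have hne' : σ x ≠ 0 := fun h => hne (by simp [hS, h])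
    exact hx (mem_cell_of_norm_lt (by linarith [(hσ.support x hne').2]))
  have hkS0 : ∫ x in cell, ker x * S x = pot S 0 := by
    rw [setIntegral_eq_integral_of_forall_compl_eq_zero fun x hx => by
      rw [hsupp x hx, mul_zero], pot, convK]
    simp only [zero_sub, ker_neg]
  have h3 : ∫ x in cell, g x * S x = (∫ x in cell, G x * autoconv ρ x) - pot (autoconv ρ) 0 := by
    have e1 : ∫ x in cell, G x * (autoconv ρ x - S x)
        = (∫ x in cell, G x * autoconv ρ x) - ∫ x in cell, G x * S x := by
      rw [← integral_sub (hbdd hψt) (hbdd hSt)]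
      simp only [mul_sub]
    have e2 : ∫ x in cell, G x * S x = (∫ x in cell, g x * S x) + pot S 0 := by
      rw [← hkS0, ← integral_add hgS hkS]
      simp only [hGg, add_mul]
    have e3 : conj (pot (S - autoconv ρ) 0) = pot S 0 - pot (autoconv ρ) 0 := by
      have e4 : conj (pot (autoconv ρ) 0) = pot (autoconv ρ) 0 := by
        rw [pot, convK, ← integral_conj]
        simp only [map_mul, conj_autoconv, conj_ker]
      rw [← hφ, hφe, map_sub, hσ.conj_pot, e4]
    rw [e1, e2, e3] at h1
    linear_combination -h1
  have hS1 : ∫ x in cell, S x = 1 := by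
    rw [setIntegral_eq_integral_of_forall_compl_eq_zero hsupp, hσ.integral_ofReal]
  have h4 : ‖(∫ x in cell, g x * S x) - g 0‖ ≤ η := by
    have e1 : (∫ x in cell, g x * S x) - g 0 = ∫ x in cell, (g x - g 0) * S x := by
      simp only [sub_mul]
      rw [integral_sub hgS (hSt.integrable.integrableOn.const_mul _), integral_const_mul, hS1,
        mul_one]
    rw [e1]
    have e2 : η = ∫ x in cell, η * σ x := by
      have : ∫ x in cell, σ x = 1 := by
        rw [setIntegral_eq_integral_of_forall_compl_eq_zero fun x hx => by
          simpa [hS] using hsupp x hx, hσ.integral]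
      rw [integral_const_mul, this, mul_one]
    rw [e2]
    refine norm_integral_le_of_norm_le ?_ (ae_of_all _ fun x => ?_)
    · exact ((hσ.test.1.continuous.integrable_of_hasCompactSupport hσ.test.2).const_mul
        η).integrableOn
    · rw [norm_mul, hS, Complex.norm_real, Real.norm_of_nonneg (hσ.nonneg x)]
      by_cases hx : σ x = 0
      · simp [hx]
      · refine mul_le_mul_of_nonneg_right ?_ (hσ.nonneg x)
        have := hεg (x := x) (by rw [dist_zero_right]; linarith [(hσ.support x hx).2])
        rw [dist_eq_norm] at this
        exact this.le
  have h5 := re_pot_autoconv_zero_le hρ (by norm_num)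
  have h6 := congrArg Complex.re h3
  rw [Complex.sub_re] at h6
  have h7 := (Complex.abs_re_le_norm _).trans h4
  rw [Complex.sub_re] at h7
  have h8 := (abs_le.1 h7).2
  linarith

lemma one_le_log_pi_div {δ : ℝ} (hδ : δ ∈ Ioo 0 (Real.pi / Real.exp 1)) :
    1 ≤ Real.log (Real.pi / δ) := by
  rw [Real.le_log_iff_exp_le (div_pos Real.pi_pos hδ.1), le_div_iff₀ hδ.1, mul_comm]
  exact ((lt_div_iff₀ (Real.exp_pos 1)).1 hδ.2).le

/-- The lower bound for `ν` is strong enough to absorb the negative part of the energy: with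
`2πν ≥ log (3/2) - log δ = log (π/δ) - log (2π/3)`, this amounts to
`log (2π/3) + 2 log (17/16) < 1`. -/
lemma kappa_add_le_nu {θ : Plane} (hθ : θ ∈ dualCell) (h0 : θ ≠ 0) {δ : ℝ}
    (hδ : δ ∈ Ioo 0 (Real.pi / Real.exp 1)) :
    kappa + 1 / (40 * Real.pi) * Real.log (Real.pi / δ) ≤ nu θ δ := by
  have hg : IsRegularPart θ (greenRegular θ) :=
    Classical.epsilon_spec (exists_isRegularPart hθ h0)
  have h1 := hg.le_re_zero hθ h0
  have hpi := Real.pi_pos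
  have hL := one_le_log_pi_div hδ
  have h2 : Real.log δ = Real.log Real.pi - Real.log (Real.pi / δ) := by
    rw [Real.log_div hpi.ne' hδ.1.ne']; ring
  have h3 : Real.log (17 / 16) ≤ 1 / 16 := by
    have := Real.log_le_sub_one_of_pos (show (0 : ℝ) < 17 / 16 by norm_num)
    linarith
  have h4 : Real.log Real.pi - Real.log (3 / 2) ≤ 4 / 5 := by
    rw [← Real.log_div hpi.ne' (by norm_num), Real.log_le_iff_le_exp (by positivity)]
    have e1 : (2.1 : ℝ) ≤ Real.exp (4 / 5) := by
      have := Real.quadratic_le_exp_of_nonneg (show (0 : ℝ) ≤ 4 / 5 by norm_num)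
      norm_num at this ⊢
      linarith
    have e2 := Real.pi_lt_d2
    refine le_trans ?_ e1
    rw [div_le_iff₀ (by norm_num)]
    norm_num at e2 ⊢
    linarith
  rw [nu, h2, kappa]
  have h5 : 1 / (2 * Real.pi) * (1 / 20 * Real.log (Real.pi / δ) + 2 * Real.log (17 / 16))
      ≤ 1 / (2 * Real.pi) * (Real.log (3 / 2) - (Real.log Real.pi - Real.log (Real.pi / δ))) := by
    gcongr
    linarith
  have h6 : 1 / Real.pi * Real.log (17 / 16) + 1 / (40 * Real.pi) * Real.log (Real.pi / δ)
      = 1 / (2 * Real.pi) * (1 / 20 * Real.log (Real.pi / δ) + 2 * Real.log (17 / 16)) := by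
    field_simp
    ring
  rw [h6]
  linarith

end ArrowFibre

end

theorem mainTheorem10 (γ : ℝ) (hγ : 0 < γ) (Ω : Set ArrowFibre.Plane) (hΩ : IsOpen Ω)
    (hne : Ω.Nonempty) (hball : Ω ⊆ Metric.ball 0 1) :
    ∃ C₂ : ℝ, 0 < C₂ ∧
      ∀ δ : ℝ, δ ∈ Set.Ioo 0 (Real.pi / Real.exp 1) →
      ∀ θ : ArrowFibre.Plane, θ ∈ ArrowFibre.dualCell → θ ≠ 0 →
      ∀ n : ℕ, 1 ≤ n →
        |ArrowFibre.mu γ Ω δ θ n - ArrowFibre.Lam γ Ω δ θ n|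
          ≤ C₂ * Real.log (Real.pi / δ) ^ (-(1 / 2) : ℝ) * ArrowFibre.mu γ Ω δ θ n := by
  obtain ⟨C₂, hC₂, h⟩ := ArrowFibre.abs_mu_sub_Lam_le hγ hΩ hne hball
    (c₀ := 1 / (40 * Real.pi)) (by positivity)
  exact ⟨C₂, hC₂, fun δ hδ θ hθ h0 n _ => h δ θ _ (ArrowFibre.one_le_log_pi_div hδ)
    (ArrowFibre.kappa_add_le_nu hθ h0 hδ) n⟩
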